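/- Let $d\in\mathbb{N}$, $\varepsilon>0$ and $\delta>0$ be fixed. For a finite set $P\subset\mathbb{R}^d$ and a point $q\in\mathbb{R}^d$, the simplicial depth $\sigma_P(q)$ is the number of subsets $S\subseteq P$ with $|S|=d+1$ and $q\in\operatorname{conv}(S)$. There is a randomized (Monte Carlo) algorithm $A$, depending only on $d,\varepsilon,\delta$, and there are constants $C\in\mathbb{R}$ and $c\in\mathbb{N}$, depending only on $d,\varepsilon,\delta$, such that the following holds for every nonempty finite set $P\subset\mathbb{R}^d$ with $n=|P|$ points, given as a list in any order, and every $q\in\mathbb{R}^d$ such that $P\cup\{q\}$ is in general position (no $d+1$ points of $P\cup\{q\}$ lie on a common hyperplane). On input $(P,q)$ the algorithm $A$ stops, for all outcomes of its random choices, within time $$C\,n^{d/2+1}\,(1+\log n)^{c}=\tilde O\bigl(n^{d/2+1}\bigr),$$ and with probability at least $1-C\,n^{-\delta}$ it outputs a number $x\in\mathbb{R}$ which is a $(1+\varepsilon)$-approximation of $\sigma_P(q)$, i.e. $$\frac{\sigma_P(q)}{1+\varepsilon}\;\le\; x\;\le\;(1+\varepsilon)\,\sigma_P(q).$$ The model of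 computation is the randomized real RAM: a program is a finite while-program over integer arrays and real arrays of unbounded length, all of whose cells not used by the input are initially $0$; exact real arithmetic ($+,-,\cdot,/$), conversion of integers into reals, and comparison of reals have unit cost; there is no rounding of reals to integers; operations on natural numbers ($+$, truncated $-$, $\cdot$, division with remainder, and comparison), used in particular as array indices, are charged according to the bit lengths of the numbers involved; and an integer uniformly distributed in $\{0,\dots,m\}$ can be drawn, for any computed integer $m\ge 0$, again at a cost given by its bit length. -/

import Mathlib

/-! ## Simplicial depth -/

/-- The simplicial depth of `q` with respect to `P ⊆ ℝ^d`: the number of `(d+1)`-element subsets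
of `P` that contain `q` in their convex hull. -/
noncomputable def simplicialDepth {d : ℕ} (P : Finset (EuclideanSpace ℝ (Fin d)))
    (q : EuclideanSpace ℝ (Fin d)) : ℕ :=
  open Classical in
  ((P.powersetCard (d + 1)).filter
    fun S => q ∈ convexHull ℝ (S : Set (EuclideanSpace ℝ (Fin d)))).card

/-- A set in `ℝ^d` is in general position if no `d+1` of its points lie on a common hyperplane,
i.e. any `d+1` of its points are affinely independent. -/
def InGeneralPosition {d : ℕ} (S : Set (EuclideanSpace ℝ (Fin d))) : Prop :=
  ∀ T : Finset (EuclideanSpace ℝ (Fin d)), (T : Set (EuclideanSpace ℝ (Fin d))) ⊆ S →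
    T.card = d + 1 → AffineIndependent ℝ (fun x : T => (x : EuclideanSpace ℝ (Fin d)))

/-- `x` approximates `σ` within the factor `1 + ε`. For `σ ≥ 0` and `ε > 0` this implies
`|x - σ| ≤ ε * σ`. -/
def IsRelApprox (ε σ x : ℝ) : Prop :=
  σ / (1 + ε) ≤ x ∧ x ≤ (1 + ε) * σ

/-! ## The randomized real RAM

Programs are finite objects: while-programs over finitely many integer arrays and finitely many
real arrays of unbounded length, addressed indirectly by integers. Real arithmetic is exact
and has unit cost. Reals can only be combined by `+, -, *, /` and compared; there is no way
to convert a real into an integer (no rounding). Integer operations are charged by bit length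
(logarithmic cost), so that large integers give no advantage. Randomness comes from drawing
uniformly distributed integers. -/

namespace RealRAM

/-- A memory content together with the time used so far. `nat a i` and `real a i` are the cells
number `i` of the integer array `a` and of the real array `a`. -/
structure State where
  nat : ℕ → ℕ → ℕ
  real : ℕ → ℕ → ℝ
  time : ℕ

namespace State

/-- Let `k` units of time pass. -/
def tick (k : ℕ) (s : State) : State :=
  { s with time := s.time + k }

/-- Store the integer `v` in cell `i` of the integer array `a`. -/
def writeNat (a i v : ℕ) (s : State) : State :=
  { s with nat := Function.update s.nat a (Function.update (s.nat a) i v) }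

/-- Store the real number `v` in cell `i` of the real array `a`. -/
noncomputable def writeReal (a i : ℕ) (v : ℝ) (s : State) : State :=
  { s with real := Function.update s.real a (Function.update (s.real a) i v) }

end State

/-- Integer expressions: constants, array cells, and arithmetic on natural numbers
(with truncated subtraction, and division with remainder). -/
inductive NatExpr : Type
  | lit (k : ℕ)
  | load (a : ℕ) (i : NatExpr)
  | add (e f : NatExpr)
  | sub (e f : NatExpr)
  | mul (e f : NatExpr)
  | div (e f : NatExpr)
  | mod (e f : NatExpr)

namespace NatExpr

def eval (s : State) : NatExpr → ℕ
  | lit k => k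
  | load a i => s.nat a (i.eval s)
  | add e f => e.eval s + f.eval s
  | sub e f => e.eval s - f.eval s
  | mul e f => e.eval s * f.eval s
  | div e f => e.eval s / f.eval s
  | mod e f => e.eval s % f.eval s

/-- Evaluation cost: each node of the expression costs one plus the bit length of its value. -/
def cost (s : State) : NatExpr → ℕ
  | lit k => 1 + Nat.size k
  | load a i => i.cost s + (1 + Nat.size ((load a i).eval s))
  | add e f => e.cost s + f.cost s + (1 + Nat.size ((add e f).eval s))
  | sub e f => e.cost s + f.cost s + (1 + Nat.size ((sub e f).eval s))
  | mul e f => e.cost s + f.cost s + (1 + Nat.size ((mul e f).eval s))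
  | div e f => e.cost s + f.cost s + (1 + Nat.size ((div e f).eval s))
  | mod e f => e.cost s + f.cost s + (1 + Nat.size ((mod e f).eval s))

end NatExpr

/-- Real expressions: integers regarded as reals, array cells, and exact real arithmetic. -/
inductive RealExpr : Type
  | ofNat (e : NatExpr)
  | load (a : ℕ) (i : NatExpr)
  | add (e f : RealExpr)
  | sub (e f : RealExpr)
  | mul (e f : RealExpr)
  | div (e f : RealExpr)

namespace RealExpr

noncomputable def eval (s : State) : RealExpr → ℝ
  | ofNat e => (e.eval s : ℝ)
  | load a i => s.real a (i.eval s)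
  | add e f => e.eval s + f.eval s
  | sub e f => e.eval s - f.eval s
  | mul e f => e.eval s * f.eval s
  | div e f => e.eval s / f.eval s

/-- Evaluation cost: unit cost per real operation, plus the cost of integer subexpressions. -/
def cost (s : State) : RealExpr → ℕ
  | ofNat e => e.cost s + 1
  | load _ i => i.cost s + 1
  | add e f => e.cost s + f.cost s + 1
  | sub e f => e.cost s + f.cost s + 1
  | mul e f => e.cost s + f.cost s + 1
  | div e f => e.cost s + f.cost s + 1

end RealExpr

/-- Branching conditions: comparisons of integers or of reals, and their Boolean combinations. -/
inductive Test : Type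
  | natLe (e f : NatExpr)
  | realLe (e f : RealExpr)
  | neg (t : Test)
  | both (t u : Test)

namespace Test

def holds (s : State) : Test → Prop
  | natLe e f => e.eval s ≤ f.eval s
  | realLe e f => e.eval s ≤ f.eval s
  | neg t => ¬ t.holds s
  | both t u => t.holds s ∧ u.holds s

def cost (s : State) : Test → ℕ
  | natLe e f => e.cost s + f.cost s + 1
  | realLe e f => e.cost s + f.cost s + 1
  | neg t => t.cost s + 1
  | both t u => t.cost s + u.cost s + 1

end Test

/-- Programs. `setNat a i e` and `setReal a i e` store the value of `e` in cell `i` of array `a`;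
`random a i e` stores a uniformly distributed element of `{0, …, e}` there. -/
inductive Program : Type
  | skip
  | setNat (a : ℕ) (i e : NatExpr)
  | setReal (a : ℕ) (i : NatExpr) (e : RealExpr)
  | random (a : ℕ) (i e : NatExpr)
  | seq (A B : Program)
  | ite (t : Test) (A B : Program)
  | while (t : Test) (A : Program)

/-- A loop `while t do body` whose condition may be evaluated at most `k` times; the outcome is
`none` if the loop has not been left by then. -/
noncomputable def loop (t : Test) (body : State → PMF (Option State)) :
    ℕ → State → PMF (Option State)
  | 0, _ => PMF.pure none
  | k + 1, s =>
    open Classical in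
    if t.holds s then
      (body (s.tick (t.cost s + 1))).bind fun r => r.elim (PMF.pure none) (loop t body k)
    else PMF.pure (some (s.tick (t.cost s + 1)))

namespace Program

/-- The distribution of the final state of a run of a program, where `none` means that some loop
has been aborted because its condition was evaluated more than `F` times. Since
every evaluation of a condition takes at least one unit of time, no run that stops within time `F`
is aborted. -/
noncomputable def exec (F : ℕ) : Program → State → PMF (Option State)
  | skip, s => PMF.pure (some (s.tick 1))
  | setNat a i e, s =>
    PMF.pure (some ((s.tick (i.cost s + e.cost s + 1)).writeNat a (i.eval s) (e.eval s)))
  | setReal a i e, s =>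
    PMF.pure (some ((s.tick (i.cost s + e.cost s + 1)).writeReal a (i.eval s) (e.eval s)))
  | random a i e, s =>
    (PMF.uniformOfFintype (Fin (e.eval s + 1))).map fun x =>
      some ((s.tick (i.cost s + e.cost s + 1)).writeNat a (i.eval s) (x : ℕ))
  | seq A B, s => (A.exec F s).bind fun r => r.elim (PMF.pure none) (B.exec F)
  | ite t A B, s =>
    open Classical in
    if t.holds s then A.exec F (s.tick (t.cost s + 1)) else B.exec F (s.tick (t.cost s + 1))
  | .while t A, s => loop t (A.exec F) F s

/-- Started in `s`, the program stops by time `T`, whatever the random choices are. -/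
def StopsWithin (A : Program) (s : State) (T : ℕ) : Prop :=
  ∀ r ∈ (A.exec T s).support, ∃ s' : State, r = some s' ∧ s'.time ≤ T

/-- The probability that the program, started in `s`, does not stop by time `T` with an output
satisfying `good`. The output is cell `0` of the real array `2`. -/
noncomputable def errorProb (A : Program) (s : State) (T : ℕ) (good : ℝ → Prop) : ENNReal :=
  (A.exec T s).toOuterMeasure
    {r | ¬ ∃ s' : State, r = some s' ∧ s'.time ≤ T ∧ good (s'.real 2 0)}

end Program

/-- The initial state for a list `p` of `n` points and a query point `q` in `ℝ^d`: cell `0` of the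
integer array `0` holds `n`, the real array `0` holds the coordinates of `q`, and the real array
`1` holds the coordinates of the points, the `j`-th coordinate of the `i`-th point in cell
`d * i + j`. All other cells are zero. -/
noncomputable def inputState {n d : ℕ} (p : Fin n → EuclideanSpace ℝ (Fin d))
    (q : EuclideanSpace ℝ (Fin d)) : State where
  nat := fun a k => if a = 0 ∧ k = 0 then n else 0
  real := fun a k =>
    if a = 0 then
      if h : k < d then q ⟨k, h⟩ else 0
    else if a = 1 then
      if h : k < n * d then
        p (finProdFinEquiv.symm (⟨k, h⟩ : Fin (n * d))).1
          (finProdFinEquiv.symm (⟨k, h⟩ : Fin (n * d))).2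
      else 0
    else 0
  time := 0

end RealRAM

/-!
Write `D = d + 1` and pass to homogeneous coordinates. In general position a simplex contains `q`
exactly if its `D` vertices form a *feasible basis*: the coordinates of `q` in this basis, which
Cramer's rule gives as quotients of determinants, are nonnegative (`Feasible`,
`feasible_homog_iff`). A program can test this with a constant number of operations on reals. As
every simplex has `D!` orderings, `D! * σ` is the number of feasible `D`-tuples (`card_feasible`),
and it remains to approximate that number. Let `r ≈ √n` be a power of two.

*Many feasible tuples.* If there are at least `r ^ d` of them among the `n ^ D` tuples, then
`K * log n * r ^ (d + 2)` random tuples contain `K * log n` feasible ones on average (`le_mean`),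
and by Chernoff's bound their proportion is a good estimate (`card_hits_not_relApprox_le`). There
are always that many if `q` is one of the points (`le_card_feasible_of_eq`), at least for large `n`.

*Few feasible tuples.* Otherwise all of them can be listed. Pivot steps of the simplex algorithm
connect any two feasible bases (`exists_pivot`), so that a breadth-first search finds all feasible
tuples from one of them. The search is abandoned after `r ^ d` tuples, which keeps its
`r ^ d * n` steps within the time bound, and its outcome also decides between the two cases. The
moves of the search are "delete the first entry and append a new last one"
(`mem_of_shift_closed`).

*A tuple to start from.* The algorithm keeps a list of about `√n` candidates, up to logarithms, so
that all `D`-tuples of candidates can be tested. If none of them is feasible, then `d` of the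
candidates span a hyperplane that has no candidate strictly on the side of `q`
(`exists_separating_tuple`, a consequence of the theorems of Carathéodory and Hahn–Banach). Random
candidates meet every large set of points that is cut off in this way (`exists_net_badSet`), so
only about `√n` points, up to logarithms, lie strictly on the side of `q`, and all of them become
candidates. Each feasible simplex has a vertex on that side (`exists_vertex_on_side`), hence it
has one more vertex among the candidates than before (`Searchable.extend`). As it has only `D`
vertices, after `d + 2` rounds either a feasible tuple has been found or there is none.

*The machine.* `Runs` counts the elementary steps of a deterministic run, and `WP` is a logic for
total correctness with step bounds. All integers that occur are polynomial in `n`, so each step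
costs `O(log n)` (`Runs.exec`, `size_cellBound_le`). The program draws all its random numbers
before it uses any of them, and therefore its final state is a function of one uniformly
distributed tuple (`exec_depthP`). Error probabilities thus become proportions of bad tuples, which
`exists_badSet` bounds.
-/

/-! ### A step-counting semantics for deterministic programs -/

namespace RealRAM

namespace State

/-- The state `s` with its clock set to `t`. -/
def withTime (t : ℕ) (s : State) : State :=
  { s with time := t }

@[simp] theorem withTime_nat (t : ℕ) (s : State) : (s.withTime t).nat = s.nat := rfl
@[simp] theorem withTime_real (t : ℕ) (s : State) : (s.withTime t).real = s.real := rfl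
@[simp] theorem withTime_time (t : ℕ) (s : State) : (s.withTime t).time = t := rfl
@[simp] theorem tick_withTime (k t : ℕ) (s : State) :
    (s.withTime t).tick k = s.withTime (t + k) := rfl
@[simp] theorem writeNat_withTime (a i v t : ℕ) (s : State) :
    (s.withTime t).writeNat a i v = (s.writeNat a i v).withTime t := rfl
@[simp] theorem writeReal_withTime (a i : ℕ) (v : ℝ) (t : ℕ) (s : State) :
    (s.withTime t).writeReal a i v = (s.writeReal a i v).withTime t := rfl

@[simp] theorem writeNat_real (a i v : ℕ) (s : State) : (s.writeNat a i v).real = s.real := rfl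
@[simp] theorem writeReal_nat (a i : ℕ) (v : ℝ) (s : State) :
    (s.writeReal a i v).nat = s.nat := rfl

theorem writeNat_nat (a i v : ℕ) (s : State) :
    (s.writeNat a i v).nat = Function.update s.nat a (Function.update (s.nat a) i v) := rfl

@[simp] theorem writeNat_nat_self (a i v : ℕ) (s : State) :
    (s.writeNat a i v).nat a = Function.update (s.nat a) i v := by
  simp [writeNat_nat]

theorem writeNat_nat_ne {a b : ℕ} (h : b ≠ a) (i v : ℕ) (s : State) :
    (s.writeNat a i v).nat b = s.nat b := by
  simp [writeNat_nat, h]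

end State

theorem NatExpr.eval_congr {s s' : State} (h : s.nat = s'.nat) (e : NatExpr) :
    e.eval s = e.eval s' := by
  induction e <;> simp_all [NatExpr.eval]

@[simp] theorem NatExpr.eval_withTime (t : ℕ) (s : State) (e : NatExpr) :
    e.eval (s.withTime t) = e.eval s :=
  NatExpr.eval_congr (s := s.withTime t) (s' := s) rfl e

@[simp] theorem NatExpr.cost_withTime (t : ℕ) (s : State) (e : NatExpr) :
    e.cost (s.withTime t) = e.cost s := by
  induction e <;> simp_all [NatExpr.cost]

@[simp] theorem RealExpr.eval_withTime (t : ℕ) (s : State) (e : RealExpr) :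
    e.eval (s.withTime t) = e.eval s := by
  induction e <;> simp_all [RealExpr.eval]

@[simp] theorem RealExpr.cost_withTime (t : ℕ) (s : State) (e : RealExpr) :
    e.cost (s.withTime t) = e.cost s := by
  induction e <;> simp_all [RealExpr.cost]

@[simp] theorem Test.holds_withTime (t : ℕ) (s : State) (e : Test) :
    e.holds (s.withTime t) ↔ e.holds s := by
  induction e <;> simp_all [Test.holds]

@[simp] theorem Test.cost_withTime (t : ℕ) (s : State) (e : Test) :
    e.cost (s.withTime t) = e.cost s := by
  induction e <;> simp_all [Test.cost]

/-- All integer cells of `s` are at most `B`. -/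
def Small (B : ℕ) (s : State) : Prop :=
  ∀ a i, s.nat a i ≤ B

theorem Small.writeNat {B : ℕ} {s : State} (hs : Small B s) (a i : ℕ) {v : ℕ} (hv : v ≤ B) :
    Small B (s.writeNat a i v) := by
  intro b j
  by_cases hb : b = a
  · subst hb
    by_cases hj : j = i
    · subst hj; simpa using hv
    · simpa [hj] using hs b j
  · rw [State.writeNat_nat_ne hb]; exact hs b j

/-- An exponent such that `e` evaluates to at most `B ^ deg` if all cells are at most `B`. -/
def NatExpr.deg : NatExpr → ℕ
  | lit k => k
  | load _ _ => 1
  | add e f => e.deg + f.deg + 1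
  | sub e _ => e.deg
  | mul e f => e.deg + f.deg
  | div e _ => e.deg
  | mod e _ => e.deg

theorem NatExpr.eval_le {B : ℕ} (hB : 2 ≤ B) {s : State} (hs : Small B s) (e : NatExpr) :
    e.eval s ≤ B ^ e.deg := by
  induction e with
  | lit k => exact (Nat.lt_pow_self (by omega)).le
  | load a i _ => simpa [eval, deg] using hs a (i.eval s)
  | add e f he hf =>
    have h1 : B ^ e.deg ≤ B ^ (e.deg + f.deg) := Nat.pow_le_pow_right (by omega) (by omega)
    have h2 : B ^ f.deg ≤ B ^ (e.deg + f.deg) := Nat.pow_le_pow_right (by omega) (by omega)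
    have h3 : B ^ (e.deg + f.deg) * 2 ≤ B ^ (e.deg + f.deg + 1) := by
      rw [pow_succ]; exact Nat.mul_le_mul_left _ hB
    simp only [eval, deg]; omega
  | sub e f he hf => exact (Nat.sub_le _ _).trans he
  | mul e f he hf => simp only [eval, deg, pow_add]; exact Nat.mul_le_mul he hf
  | div e f he hf => exact (Nat.div_le_self _ _).trans he
  | mod e f he hf => exact (Nat.mod_le _ _).trans he

/-- The evaluation of `e` costs at most `wt` times the bit length of the largest cell. -/
def NatExpr.wt : NatExpr → ℕ
  | lit k => (lit k).deg + 2
  | load a i => i.wt + ((load a i).deg + 2)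
  | add e f => e.wt + f.wt + ((add e f).deg + 2)
  | sub e f => e.wt + f.wt + ((sub e f).deg + 2)
  | mul e f => e.wt + f.wt + ((mul e f).deg + 2)
  | div e f => e.wt + f.wt + ((div e f).deg + 2)
  | mod e f => e.wt + f.wt + ((mod e f).deg + 2)

theorem size_pos_of_two_le {B : ℕ} (hB : 2 ≤ B) : 1 ≤ Nat.size B :=
  Nat.size_pos.2 (by omega)

theorem size_pow_le (B g : ℕ) : Nat.size (B ^ g) ≤ g * Nat.size B + 1 := by
  rw [Nat.size_le, pow_succ, mul_comm g, pow_mul]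
  have := Nat.pow_le_pow_left (Nat.lt_size_self B).le g
  have h2 : 0 < (2 ^ Nat.size B) ^ g := by positivity
  omega

theorem NatExpr.node_cost_le {B : ℕ} (hB : 2 ≤ B) {s : State} (hs : Small B s) (e : NatExpr) :
    1 + Nat.size (e.eval s) ≤ (e.deg + 2) * Nat.size B := by
  have h1 := Nat.size_le_size (e.eval_le hB hs)
  have h2 := size_pow_le B e.deg
  have h3 := size_pos_of_two_le hB
  nlinarith

theorem NatExpr.cost_le {B : ℕ} (hB : 2 ≤ B) {s : State} (hs : Small B s) (e : NatExpr) :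
    e.cost s ≤ e.wt * Nat.size B := by
  induction e with
  | lit k => exact NatExpr.node_cost_le hB hs (lit k)
  | load a i hi =>
    have := NatExpr.node_cost_le hB hs (load a i)
    simp only [cost, wt, add_mul _ _ (Nat.size B)] at *; omega
  | add e f he hf =>
    have := NatExpr.node_cost_le hB hs (add e f)
    simp only [cost, wt, add_mul _ _ (Nat.size B)] at *; omega
  | sub e f he hf =>
    have := NatExpr.node_cost_le hB hs (sub e f)
    simp only [cost, wt, add_mul _ _ (Nat.size B)] at *; omega
  | mul e f he hf =>
    have := NatExpr.node_cost_le hB hs (mul e f)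
    simp only [cost, wt, add_mul _ _ (Nat.size B)] at *; omega
  | div e f he hf =>
    have := NatExpr.node_cost_le hB hs (div e f)
    simp only [cost, wt, add_mul _ _ (Nat.size B)] at *; omega
  | mod e f he hf =>
    have := NatExpr.node_cost_le hB hs (mod e f)
    simp only [cost, wt, add_mul _ _ (Nat.size B)] at *; omega

/-- The analogue of `NatExpr.wt` for real expressions. -/
def RealExpr.wt : RealExpr → ℕ
  | ofNat e => e.wt + 1
  | load _ i => i.wt + 1
  | add e f => e.wt + f.wt + 1
  | sub e f => e.wt + f.wt + 1
  | mul e f => e.wt + f.wt + 1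
  | div e f => e.wt + f.wt + 1

theorem RealExpr.cost_le {B : ℕ} (hB : 2 ≤ B) {s : State} (hs : Small B s) (e : RealExpr) :
    e.cost s ≤ e.wt * Nat.size B := by
  have h1 := size_pos_of_two_le hB
  induction e with
  | ofNat e => have := e.cost_le hB hs; simp only [cost, wt, add_mul]; omega
  | load a i => have := i.cost_le hB hs; simp only [cost, wt, add_mul]; omega
  | _ => simp only [cost, wt, add_mul]; omega

/-- The analogue of `NatExpr.wt` for tests. -/
def Test.wt : Test → ℕ
  | natLe e f => e.wt + f.wt + 1
  | realLe e f => e.wt + f.wt + 1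
  | neg t => t.wt + 1
  | both t u => t.wt + u.wt + 1

theorem Test.cost_le {B : ℕ} (hB : 2 ≤ B) {s : State} (hs : Small B s) (t : Test) :
    t.cost s ≤ t.wt * Nat.size B := by
  have h1 := size_pos_of_two_le hB
  induction t with
  | natLe e f =>
    have := e.cost_le hB hs; have := f.cost_le hB hs; simp only [cost, wt, add_mul]; omega
  | realLe e f =>
    have := e.cost_le hB hs; have := f.cost_le hB hs; simp only [cost, wt, add_mul]; omega
  | _ => simp only [cost, wt, add_mul]; omega

namespace Program

/-- Each elementary step of a program costs at most `wt` times the bit length of the largest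
cell. -/
def wt : Program → ℕ
  | skip => 1
  | setNat _ i e => i.wt + e.wt + 1
  | setReal _ i e => i.wt + e.wt + 1
  | random _ i e => i.wt + e.wt + 1
  | seq A A' => A.wt + A'.wt
  | ite t A A' => t.wt + 1 + A.wt + A'.wt
  | .while t A => t.wt + 1 + A.wt

/-- Does the program write to the integer array `b`? -/
def modN (b : ℕ) : Program → Bool
  | skip => false
  | setNat a _ _ => a == b
  | setReal _ _ _ => false
  | random a _ _ => a == b
  | seq A A' => A.modN b || A'.modN b
  | ite _ A A' => A.modN b || A'.modN b
  | .while _ A => A.modN b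

/-- Does the program write to a real array? -/
def modR : Program → Bool
  | skip => false
  | setNat _ _ _ => false
  | setReal _ _ _ => true
  | random _ _ _ => false
  | seq A A' => A.modR || A'.modR
  | ite _ A A' => A.modR || A'.modR
  | .while _ A => A.modR

end Program

/-- `Runs B A s j s'`: the program `A`, which makes no random choice on the way, leads from `s` to
`s'` in `j` elementary steps, and all integer cells stay bounded by `B`. Clocks are ignored. -/
inductive Runs (B : ℕ) : Program → State → ℕ → State → Prop
  | skip (s : State) : Runs B .skip s 1 s
  | setNat (a : ℕ) (i e : NatExpr) (s : State) (hs : Small B s) :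
      Runs B (.setNat a i e) s 1 (s.writeNat a (i.eval s) (e.eval s))
  | setReal (a : ℕ) (i : NatExpr) (e : RealExpr) (s : State) (hs : Small B s) :
      Runs B (.setReal a i e) s 1 (s.writeReal a (i.eval s) (e.eval s))
  | seq {A A' : Program} {s s₁ s₂ : State} {j j' : ℕ} (h : Runs B A s j s₁)
      (h' : Runs B A' s₁ j' s₂) : Runs B (.seq A A') s (j + j') s₂
  | ite_true {t : Test} {A : Program} (A' : Program) {s s₁ : State} {j : ℕ} (hs : Small B s)
      (ht : t.holds s) (h : Runs B A s j s₁) : Runs B (.ite t A A') s (j + 1) s₁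
  | ite_false {t : Test} (A : Program) {A' : Program} {s s₁ : State} {j : ℕ} (hs : Small B s)
      (ht : ¬ t.holds s) (h : Runs B A' s j s₁) : Runs B (.ite t A A') s (j + 1) s₁
  | while_true {t : Test} {A : Program} {s s₁ s₂ : State} {j j' : ℕ} (hs : Small B s)
      (ht : t.holds s) (h : Runs B A s j s₁) (h' : Runs B (.while t A) s₁ j' s₂) :
      Runs B (.while t A) s (j + j' + 1) s₂
  | while_false {t : Test} (A : Program) {s : State} (hs : Small B s)
      (ht : ¬ t.holds s) : Runs B (.while t A) s 1 s

theorem Runs.nat_eq {B : ℕ} {A : Program} {s s' : State} {j : ℕ} (h : Runs B A s j s') (b : ℕ)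
    (hb : A.modN b = false) : s'.nat b = s.nat b := by
  induction h with
  | skip => rfl
  | setNat a i e s hs =>
    simp only [Program.modN, beq_eq_false_iff_ne] at hb
    exact State.writeNat_nat_ne hb.symm _ _ _
  | setReal => rfl
  | seq h h' ih ih' =>
    simp only [Program.modN, Bool.or_eq_false_iff] at hb
    rw [ih' hb.2, ih hb.1]
  | ite_true A' hs ht h ih =>
    simp only [Program.modN, Bool.or_eq_false_iff] at hb
    exact ih hb.1
  | ite_false A hs ht h ih =>
    simp only [Program.modN, Bool.or_eq_false_iff] at hb
    exact ih hb.2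
  | while_true hs ht h h' ih ih' => rw [ih' hb]; exact ih hb
  | while_false => rfl

theorem Runs.real_eq {B : ℕ} {A : Program} {s s' : State} {j : ℕ} (h : Runs B A s j s')
    (hb : A.modR = false) : s'.real = s.real := by
  induction h with
  | skip => rfl
  | setNat a i e s hs => rfl
  | setReal => simp [Program.modR] at hb
  | seq h h' ih ih' =>
    simp only [Program.modR, Bool.or_eq_false_iff] at hb
    rw [ih' hb.2, ih hb.1]
  | ite_true A' hs ht h ih =>
    simp only [Program.modR, Bool.or_eq_false_iff] at hb
    exact ih hb.1
  | ite_false A hs ht h ih =>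
    simp only [Program.modR, Bool.or_eq_false_iff] at hb
    exact ih hb.2
  | while_true hs ht h h' ih ih' => rw [ih' hb]; exact ih hb
  | while_false => rfl

/-- One pass of a loop. The clock is advanced by the cost of the test. -/
theorem loop_succ_true {t : Test} {body : State → PMF (Option State)} {s : State} (h : t.holds s)
    (k : ℕ) : loop t body (k + 1) s =
      (body (s.tick (t.cost s + 1))).bind fun r => r.elim (PMF.pure none) (loop t body k) := by
  simp [loop, h]

theorem loop_succ_false {t : Test} {body : State → PMF (Option State)} {s : State}
    (h : ¬ t.holds s) (k : ℕ) :
    loop t body (k + 1) s = PMF.pure (some (s.tick (t.cost s + 1))) := by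
  simp [loop, h]

/-- A deterministic run is the outcome of `exec`, and its time is at most the number of steps
times the cost of a step. For loops the same holds for any fuel that is at least the number of
steps, which is what the induction over the iterations needs. -/
theorem Runs.exec_aux {B : ℕ} (hB : 2 ≤ B) {A : Program} {s s' : State} {j : ℕ}
    (h : Runs B A s j s') :
    (∀ t F, t + j * (A.wt * Nat.size B) ≤ F → ∃ t' ≤ t + j * (A.wt * Nat.size B),
      A.exec F (s.withTime t) = PMF.pure (some (s'.withTime t'))) ∧
    ∀ c A₀, A = .while c A₀ → ∀ t F k, j ≤ k → t + j * (A.wt * Nat.size B) ≤ F →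
      ∃ t' ≤ t + j * (A.wt * Nat.size B),
        loop c (A₀.exec F) k (s.withTime t) = PMF.pure (some (s'.withTime t')) := by
  have hsz := size_pos_of_two_le hB
  have of_loop : ∀ {c : Test} {A₀ : Program} {s s' : State} {j : ℕ},
      (∀ t F k, j ≤ k → t + j * ((Program.while c A₀).wt * Nat.size B) ≤ F →
        ∃ t' ≤ t + j * ((Program.while c A₀).wt * Nat.size B),
          loop c (A₀.exec F) k (s.withTime t) = PMF.pure (some (s'.withTime t'))) →
      (∀ t F, t + j * ((Program.while c A₀).wt * Nat.size B) ≤ F →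
        ∃ t' ≤ t + j * ((Program.while c A₀).wt * Nat.size B),
        (Program.while c A₀).exec F (s.withTime t) = PMF.pure (some (s'.withTime t'))) ∧
      ∀ c' A₀', Program.while c A₀ = .while c' A₀' → ∀ t F k, j ≤ k →
        t + j * ((Program.while c A₀).wt * Nat.size B) ≤ F →
      ∃ t' ≤ t + j * ((Program.while c A₀).wt * Nat.size B),
        loop c' (A₀'.exec F) k (s.withTime t) = PMF.pure (some (s'.withTime t')) := by
    intro c A₀ s s' j h
    refine ⟨fun t F hF => ?_, ?_⟩
    · refine h t F F ?_ hF
      have : 1 ≤ (Program.while c A₀).wt * Nat.size B := by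
        simp only [Program.wt]; nlinarith
      nlinarith
    · rintro c' A₀' ⟨⟩
      exact h
  induction h with
  | skip s =>
    refine ⟨fun t F hF => ⟨t + 1, ?_, by simp [Program.exec]⟩, by simp⟩
    simp only [Program.wt]; omega
  | setNat a i e s hs =>
    refine ⟨fun t F hF => ⟨t + (i.cost s + e.cost s + 1), ?_, by simp [Program.exec]⟩, by simp⟩
    have := i.cost_le hB hs
    have := e.cost_le hB hs
    simp only [Program.wt, add_mul]; omega
  | setReal a i e s hs =>
    refine ⟨fun t F hF => ⟨t + (i.cost s + e.cost s + 1), ?_, by simp [Program.exec]⟩, by simp⟩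
    have := i.cost_le hB hs
    have := e.cost_le hB hs
    simp only [Program.wt, add_mul]; omega
  | @seq A A' s s₁ s₂ j j' h h' ih ih' =>
    refine ⟨fun t F hF => ?_, by simp⟩
    have e1 : (j + j') * ((Program.seq A A').wt * Nat.size B) =
      j * (A.wt * Nat.size B) + j' * (A'.wt * Nat.size B) +
        (j' * (A.wt * Nat.size B) + j * (A'.wt * Nat.size B)) := by
      simp only [Program.wt]; ring
    rw [e1] at hF ⊢
    obtain ⟨t₁, ht₁, h₁⟩ := ih.1 t F (by omega)
    obtain ⟨t₂, ht₂, h₂⟩ := ih'.1 t₁ F (by omega)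
    exact ⟨t₂, by omega, by simp [Program.exec, h₁, h₂]⟩
  | @ite_true c A A' s s₁ j hs hc h ih =>
    refine ⟨fun t F hF => ?_, by simp⟩
    have e1 : (j + 1) * ((Program.ite c A A').wt * Nat.size B) =
      j * (A.wt * Nat.size B) + c.wt * Nat.size B + Nat.size B +
        ((j + 1) * (A'.wt * Nat.size B) + A.wt * Nat.size B + j * ((c.wt + 1) * Nat.size B)) := by
      simp only [Program.wt]; ring
    rw [e1] at hF ⊢
    have h3 := c.cost_le hB hs
    obtain ⟨t₁, ht₁, h₁⟩ := ih.1 (t + (c.cost s + 1)) F (by omega)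
    exact ⟨t₁, by omega, by simp [Program.exec, h₁, hc]⟩
  | @ite_false c A A' s s₁ j hs hc h ih =>
    refine ⟨fun t F hF => ?_, by simp⟩
    have e1 : (j + 1) * ((Program.ite c A A').wt * Nat.size B) =
      j * (A'.wt * Nat.size B) + c.wt * Nat.size B + Nat.size B +
        ((j + 1) * (A.wt * Nat.size B) + A'.wt * Nat.size B + j * ((c.wt + 1) * Nat.size B)) := by
      simp only [Program.wt]; ring
    rw [e1] at hF ⊢
    have h3 := c.cost_le hB hs
    obtain ⟨t₁, ht₁, h₁⟩ := ih.1 (t + (c.cost s + 1)) F (by omega)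
    exact ⟨t₁, by omega, by simp [Program.exec, h₁, hc]⟩
  | @while_true c A s s₁ s₂ j j' hs hc h h' ih ih' =>
    refine of_loop fun t F k hk hF => ?_
    have e1 : (j + j' + 1) * ((Program.while c A).wt * Nat.size B) =
      j * (A.wt * Nat.size B) + j' * ((Program.while c A).wt * Nat.size B) +
        c.wt * Nat.size B + Nat.size B +
        (j * ((c.wt + 1) * Nat.size B) + A.wt * Nat.size B) := by
      simp only [Program.wt]; ring
    rw [e1] at hF ⊢
    have h3 := c.cost_le hB hs
    obtain ⟨k, rfl⟩ : ∃ k', k = k' + 1 := ⟨k - 1, by omega⟩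
    obtain ⟨t₁, ht₁, h₁⟩ := ih.1 (t + (c.cost s + 1)) F (by omega)
    obtain ⟨t₂, ht₂, h₂⟩ := ih'.2 c A rfl t₁ F k (by omega) (by omega)
    refine ⟨t₂, by omega, ?_⟩
    rw [loop_succ_true (by simpa using hc)]
    simp [h₁, h₂]
  | @while_false c A s hs hc =>
    refine of_loop fun t F k hk hF => ?_
    have h3 := c.cost_le hB hs
    obtain ⟨k, rfl⟩ : ∃ k', k = k' + 1 := ⟨k - 1, by omega⟩
    refine ⟨t + (c.cost s + 1), ?_, ?_⟩
    · simp only [Program.wt, add_mul]; omega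
    · rw [loop_succ_false (by simpa using hc)]
      simp

/-- The cost of a deterministic run, for an arbitrary initial value `t` of the clock. -/
theorem Runs.exec {B : ℕ} (hB : 2 ≤ B) {A : Program} {s s' : State} {j : ℕ}
    (h : Runs B A s j s') {t F : ℕ} (hF : t + j * (A.wt * Nat.size B) ≤ F) :
    ∃ t' ≤ t + j * (A.wt * Nat.size B),
      A.exec F (s.withTime t) = PMF.pure (some (s'.withTime t')) :=
  (h.exec_aux hB).1 t F hF

/-! ### Rules for total correctness with step bounds -/

/-- If the cells of `s` are bounded by `B`, then `A` runs from `s` in at most `k` steps to a state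
with property `Q`, and the cells stay bounded by `B`. -/
def WP (B : ℕ) (A : Program) (k : ℕ) (Q : State → Prop) (s : State) : Prop :=
  Small B s → ∃ s' j, j ≤ k ∧ Runs B A s j s' ∧ Small B s' ∧ Q s'

variable {B : ℕ} {A A' : Program} {k k' : ℕ} {Q Q' : State → Prop} {s : State}

theorem WP.mono (h : WP B A k Q s) (hk : k ≤ k') (hQ : ∀ s', Q s' → Q' s') : WP B A k' Q' s := by
  intro hs
  obtain ⟨s', j, hj, hr, hs', hq⟩ := h hs
  exact ⟨s', j, hj.trans hk, hr, hs', hQ _ hq⟩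

theorem WP.imp (h : WP B A k Q s) (hQ : ∀ s', Q s' → Q' s') : WP B A k Q' s :=
  h.mono le_rfl hQ

/-- The arrays that `A` does not write to agree in `s` and `s'`. -/
def Frame (A : Program) (s s' : State) : Prop :=
  (∀ b, A.modN b = false → s'.nat b = s.nat b) ∧ (A.modR = false → s'.real = s.real)

/-- The postcondition may be strengthened by the fact that only the arrays which the program writes
to have changed. -/
theorem WP.frame (h : WP B A k Q s) : WP B A k (fun s' => Q s' ∧ Frame A s s') s := by
  intro hs
  obtain ⟨s', j, hj, hr, hs', hq⟩ := h hs
  exact ⟨s', j, hj, hr, hs', hq, fun b hb => hr.nat_eq b hb, fun hb => hr.real_eq hb⟩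

theorem WP.skip (h : Q s) : WP B .skip 1 Q s :=
  fun hs => ⟨s, 1, le_rfl, .skip s, hs, h⟩

theorem WP.setNat {a : ℕ} {i e : NatExpr} (he : e.eval s ≤ B)
    (h : Q (s.writeNat a (i.eval s) (e.eval s))) : WP B (.setNat a i e) 1 Q s :=
  fun hs => ⟨_, 1, le_rfl, .setNat a i e s hs, hs.writeNat _ _ he, h⟩

theorem WP.setReal {a : ℕ} {i : NatExpr} {e : RealExpr}
    (h : Q (s.writeReal a (i.eval s) (e.eval s))) : WP B (.setReal a i e) 1 Q s :=
  fun hs => ⟨_, 1, le_rfl, .setReal a i e s hs, hs, h⟩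

theorem WP.seq (h : WP B A k (fun s' => WP B A' k' Q s') s) : WP B (.seq A A') (k + k') Q s := by
  intro hs
  obtain ⟨s₁, j₁, hj₁, hr₁, hs₁, h₁⟩ := h hs
  obtain ⟨s₂, j₂, hj₂, hr₂, hs₂, h₂⟩ := h₁ hs₁
  exact ⟨s₂, j₁ + j₂, add_le_add hj₁ hj₂, .seq hr₁ hr₂, hs₂, h₂⟩

theorem WP.ite {t : Test} (h : t.holds s → WP B A k Q s) (h' : ¬ t.holds s → WP B A' k Q s) :
    WP B (.ite t A A') (k + 1) Q s := by
  intro hs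
  by_cases ht : t.holds s
  · obtain ⟨s₁, j₁, hj₁, hr₁, hs₁, h₁⟩ := h ht hs
    exact ⟨s₁, j₁ + 1, by omega, .ite_true _ hs ht hr₁, hs₁, h₁⟩
  · obtain ⟨s₁, j₁, hj₁, hr₁, hs₁, h₁⟩ := h' ht hs
    exact ⟨s₁, j₁ + 1, by omega, .ite_false _ hs ht hr₁, hs₁, h₁⟩

/-- The measure `μ` bounds the number of passes that are still to come. -/
theorem WP.while {t : Test} {Inv : State → Prop} (μ : State → ℕ) {m : ℕ}
    (body : ∀ s, Inv s → t.holds s → WP B A k (fun s' => Inv s' ∧ μ s' < μ s) s)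
    (h : Inv s) (hm : μ s ≤ m) :
    WP B (.while t A) (m * (k + 1) + 1) (fun s' => Inv s' ∧ ¬ t.holds s') s := by
  induction m using Nat.strong_induction_on generalizing s with
  | _ m ih =>
    intro hs
    by_cases ht : t.holds s
    · obtain ⟨s₁, j₁, hj₁, hr₁, hs₁, h₁, hμ⟩ := body s h ht hs
      obtain ⟨s₂, j₂, hj₂, hr₂, hs₂, h₂⟩ := ih (m - 1) (by omega) h₁ (by omega) hs₁
      refine ⟨s₂, j₁ + j₂ + 1, ?_, .while_true hs ht hr₁ hr₂, hs₂, h₂⟩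
      obtain ⟨m, rfl⟩ : ∃ m', m = m' + 1 := ⟨m - 1, by omega⟩
      simp only [Nat.add_sub_cancel] at hj₂
      rw [add_mul]; omega
    · exact ⟨s, 1, by omega, .while_false _ hs ht, hs, h, ht⟩

/-- The scalar variable that occupies cell `0` of the integer array `a`. -/
abbrev var (a : ℕ) : NatExpr := .load a (.lit 0)

/-- Assignment to a scalar variable. -/
abbrev setVar (a : ℕ) (e : NatExpr) : Program := .setNat a (.lit 0) e

/-- `for c := 0 to e - 1 do body`. The expression `e` is evaluated before each pass. -/
def forN (c : ℕ) (e : NatExpr) (body : Program) : Program :=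
  .seq (setVar c (.lit 0)) (.while (.neg (.natLe e (var c)))
    (.seq body (setVar c (.add (var c) (.lit 1)))))

/-- The rule for `forN`: `Inv i` holds before the `i`-th pass. In the passes one may use that the
arrays which the loop does not write to have not changed. -/
theorem WP.forN {c : ℕ} {e : NatExpr} {body : Program} {Inv : ℕ → State → Prop} {m : ℕ}
    (hmB : m ≤ B) (hc : body.modN c = false)
    (init : Inv 0 (s.writeNat c 0 0))
    (bound : ∀ i s', i ≤ m → Inv i s' → Frame (forN c e body) s s' → e.eval s' = m)
    (step : ∀ i < m, ∀ s', Inv i s' → Frame (forN c e body) s s' → s'.nat c 0 = i →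
      WP B body k (fun s'' => Inv (i + 1) (s''.writeNat c 0 (i + 1))) s') :
    WP B (forN c e body) (m * (k + 2) + 2) (Inv m) s := by
  refine WP.mono (k := 1 + (m * (k + 1 + 1) + 1)) (WP.seq ?_) (by linarith) fun _ h => h
  refine WP.setNat (by simp [NatExpr.eval]) ?_
  have hmodc : ∀ b, b ≠ c → ∀ v (s' : State), (s'.writeNat c 0 v).nat b = s'.nat b :=
    fun b hb v s' => State.writeNat_nat_ne hb _ _ _
  have hwF : ∀ s' v, Frame (RealRAM.forN c e body) s s' →
      Frame (RealRAM.forN c e body) s (s'.writeNat c 0 v) := by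
    intro s' v h
    refine ⟨fun b hb => ?_, fun hb => h.2 hb⟩
    rw [← h.1 b hb]
    refine hmodc b ?_ _ _
    rintro rfl
    simp [RealRAM.forN, Program.modN] at hb
  refine (WP.while (Inv := fun s' => s'.nat c 0 ≤ m ∧ Inv (s'.nat c 0) s' ∧
      Frame (RealRAM.forN c e body) s s') (fun s' => m - s'.nat c 0) ?_ ?_ ?_).imp ?_
  · rintro s' ⟨hi, hI, hF⟩ ht
    have hev := bound _ s' hi hI hF
    simp only [Test.holds, NatExpr.eval, hev, not_le] at ht
    refine WP.seq ((step _ ht s' hI hF rfl).frame.imp ?_)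
    rintro s'' ⟨h1, h2⟩
    have h3 : s''.nat c 0 = s'.nat c 0 := by rw [h2.1 c hc]
    have h4 : (NatExpr.add (var c) (.lit 1)).eval s'' = s'.nat c 0 + 1 := by
      simp [NatExpr.eval, h3]
    refine WP.setNat ?_ ?_
    · rw [h4]; omega
    · rw [h4]
      refine ⟨⟨?_, ?_, hwF _ _ ?_⟩, ?_⟩
      · simp [NatExpr.eval]; omega
      · simpa [NatExpr.eval] using h1
      · refine ⟨fun b hb => ?_, fun hb => ?_⟩
        · rw [← hF.1 b hb]
          refine h2.1 b ?_
          simp only [RealRAM.forN, Program.modN, Bool.or_eq_false_iff] at hb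
          exact hb.2.1
        · rw [← hF.2 hb]
          refine h2.2 ?_
          simp only [RealRAM.forN, Program.modR, Bool.or_eq_false_iff] at hb
          exact hb.2.1
      · simp [NatExpr.eval]; omega
  · refine ⟨by simp [NatExpr.eval], by simpa [NatExpr.eval] using init, ?_⟩
    exact hwF s _ ⟨fun _ _ => rfl, fun _ => rfl⟩
  · simp [NatExpr.eval]
  · rintro s' ⟨⟨hi, hI, hF⟩, ht⟩
    have hev := bound _ s' hi hI hF
    simp only [Test.holds, NatExpr.eval, hev, not_not] at ht
    rwa [le_antisymm hi ht] at hI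

end RealRAM

/-! ### Drawing an array of random numbers -/

namespace RealRAM

/-- Two independent uniform draws amount to one uniform draw of a pair, in any encoding `e` of
pairs. -/
theorem uniform_bind_map_uniform {α β γ δ : Type} [Fintype α] [Nonempty α] [Fintype β] [Nonempty β]
    [Fintype γ] [Nonempty γ] (e : γ ≃ α × β) (G : α → β → δ) :
    ((PMF.uniformOfFintype α).bind fun a => (PMF.uniformOfFintype β).map (G a)) =
      (PMF.uniformOfFintype γ).map fun c => G (e c).1 (e c).2 := by
  classical
  ext y
  have hc : Fintype.card γ = Fintype.card α * Fintype.card β := by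
    rw [Fintype.card_congr e, Fintype.card_prod]
  simp only [PMF.bind_apply, PMF.map_apply, PMF.uniformOfFintype_apply, tsum_fintype]
  rw [Equiv.sum_comp e (fun p : α × β => if y = G p.1 p.2 then (Fintype.card γ : ENNReal)⁻¹ else 0),
    Fintype.sum_prod_type]
  refine Finset.sum_congr rfl fun a _ => ?_
  rw [Finset.mul_sum]
  refine Finset.sum_congr rfl fun b _ => ?_
  rw [hc, Nat.cast_mul, ENNReal.mul_inv (by simp) (by simp)]
  split_ifs <;> simp

theorem exec_random {s : State} {a : ℕ} {i e : NatExpr} {N : ℕ} (h : e.eval s = N) (F : ℕ) :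
    (Program.random a i e).exec F s =
      (PMF.uniformOfFintype (Fin (N + 1))).map fun x : Fin (N + 1) =>
        some ((s.tick (i.cost s + e.cost s + 1)).writeNat a (i.eval s) (x : ℕ)) := by
  subst h
  exact PMF.map_comp (fun x : Fin (e.eval s + 1) => (x : ℕ)) _ _

/-- Fill the cells of the array `a` up to index `e` with random numbers from `{0, …, f}`. The
variable `c` holds the current index. -/
def drawLoop (a c : ℕ) (e f : NatExpr) : Program :=
  .while (.neg (.natLe e (var c)))
    (.seq (.random a (var c) f) (setVar c (.add (var c) (.lit 1))))

/-- Started with `c = m - rem`, the loop fills the remaining `rem` cells of the array `a` with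
independent uniformly distributed numbers. The statement is about `loop` with arbitrary fuel, for
the sake of the induction on `rem`. -/
theorem drawLoop_aux {B : ℕ} (hB : 2 ≤ B) {a c : ℕ} (hac : a ≠ c) {e f : NatExpr} {m N : ℕ}
    (hmB : m ≤ B) (hNB : N ≤ B) (F : ℕ) (rem : ℕ) (s : State) (hs : Small B s) (t k : ℕ)
    (he : ∀ s', (∀ b, b ≠ a → b ≠ c → s'.nat b = s.nat b) → e.eval s' = m)
    (hf : ∀ s', (∀ b, b ≠ a → b ≠ c → s'.nat b = s.nat b) → f.eval s' = N)
    (hc : s.nat c 0 + rem = m) (hk : rem < k) :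
    ∃ g : (Fin rem → Fin (N + 1)) → State,
      loop (.neg (.natLe e (var c)))
        ((Program.seq (.random a (var c) f) (setVar c (.add (var c) (.lit 1)))).exec F) k
        (s.withTime t) = (PMF.uniformOfFintype _).map (fun ρ => some (g ρ)) ∧
      ∀ ρ, (g ρ).time ≤ t + (rem + 1) * ((drawLoop a c e f).wt * Nat.size B) ∧
        Small B (g ρ) ∧ (g ρ).real = s.real ∧ (∀ b, b ≠ a → b ≠ c → (g ρ).nat b = s.nat b) ∧
        (∀ i < s.nat c 0, (g ρ).nat a i = s.nat a i) ∧
        ∀ i : Fin rem, (g ρ).nat a (s.nat c 0 + i) = ρ i := by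
  have hsz := size_pos_of_two_le hB
  induction rem generalizing s t k with
  | zero =>
    obtain ⟨k, rfl⟩ : ∃ k', k = k' + 1 := ⟨k - 1, by omega⟩
    have hev := he s fun _ _ _ => rfl
    have hh : ¬ (Test.neg (.natLe e (var c))).holds (s.withTime t) := by
      simp [Test.holds, NatExpr.eval, hev]; omega
    have h3 := (Test.neg (.natLe e (var c))).cost_le hB hs
    refine ⟨fun _ => s.withTime
      (t + ((Test.neg (.natLe e (var c))).cost s + 1)), ?_, fun ρ => ⟨?_, hs, rfl,
        fun _ _ _ => rfl, fun _ _ => rfl, fun i => i.elim0⟩⟩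
    · rw [loop_succ_false hh]
      simp only [Test.cost_withTime, State.tick_withTime]
      exact (PMF.map_const (PMF.uniformOfFintype (Fin 0 → Fin (N + 1))) _).symm
    · simp only [State.withTime_time, drawLoop, Program.wt, add_mul _ _ (Nat.size B)]
      omega
  | succ rem ih =>
    obtain ⟨k, rfl⟩ : ∃ k', k = k' + 1 := ⟨k - 1, by omega⟩
    have hev := he s fun _ _ _ => rfl
    have hfv := hf s fun _ _ _ => rfl
    have hh : (Test.neg (.natLe e (var c))).holds (s.withTime t) := by
      simp [Test.holds, NatExpr.eval, hev]; omega
    have h3 := (Test.neg (.natLe e (var c))).cost_le hB hs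
    have h4 := (var c).cost_le hB hs
    have h5 := f.cost_le hB hs
    set t₁ := t + ((Test.neg (.natLe e (var c))).cost s + 1) with ht₁
    set t₂ := t₁ + ((var c).cost s + f.cost s + 1) with ht₂
    let s₁ : ℕ → State := fun x => s.writeNat a (s.nat c 0) x
    have hs₁c : ∀ x, (s₁ x).nat c = s.nat c := fun x => State.writeNat_nat_ne hac.symm _ _ _
    let s₂ : ℕ → State := fun x => (s₁ x).writeNat c 0 (s.nat c 0 + 1)
    have hs₁ : ∀ x ≤ N, Small B (s₁ x) := fun x hx => hs.writeNat _ _ (hx.trans hNB)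
    have hs₂ : ∀ x ≤ N, Small B (s₂ x) := fun x hx => (hs₁ x hx).writeNat _ _ (by omega)
    have hs₂c : ∀ x, (s₂ x).nat c 0 = s.nat c 0 + 1 := fun x => by simp [s₂]
    have hs₂b : ∀ x b, b ≠ a → b ≠ c → (s₂ x).nat b = s.nat b := fun x b hb hb' => by
      rw [State.writeNat_nat_ne hb', State.writeNat_nat_ne hb]
    have hs₂a : ∀ x, (s₂ x).nat a = Function.update (s.nat a) (s.nat c 0) x := fun x => by
      rw [State.writeNat_nat_ne hac, State.writeNat_nat_self]
    let t₃ : ℕ → ℕ := fun x => t₂ + ((NatExpr.lit 0).cost (s₁ x) +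
      (NatExpr.add (var c) (.lit 1)).cost (s₁ x) + 1)
    have key : ∀ x : Fin (N + 1), ∃ g : (Fin rem → Fin (N + 1)) → State, _ := fun x =>
      ih (s₂ x) (hs₂ x (by omega)) (t₃ x) k
        (fun s' h => he s' fun b hb hb' => by rw [h b hb hb', hs₂b x b hb hb'])
        (fun s' h => hf s' fun b hb hb' => by rw [h b hb hb', hs₂b x b hb hb'])
        (by rw [hs₂c]; omega) (by omega)
    choose g hg1 hg2 using key
    refine ⟨fun ρ => g (ρ 0) (Fin.tail ρ), ?_, fun ρ => ?_⟩
    · rw [loop_succ_true hh]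
      have hbody : (Program.seq (.random a (var c) f)
          (setVar c (.add (var c) (.lit 1)))).exec F (s.withTime t₁) =
          (PMF.uniformOfFintype (Fin (N + 1))).map
            fun x : Fin (N + 1) => some ((s₂ x).withTime (t₃ x)) := by
        rw [Program.exec, exec_random (N := N) (by simpa using hfv), PMF.bind_map]
        rw [PMF.map]
        congr 1
        funext x
        simp [Program.exec, NatExpr.eval, s₂, s₁, t₃, ht₂, hs₁c]
      have : (s.withTime t).tick ((Test.neg (.natLe e (var c))).cost (s.withTime t) + 1) =
          s.withTime t₁ := by simp [ht₁]
      rw [this, hbody, PMF.bind_map]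
      have e1 : ((fun r : Option State => r.elim (PMF.pure none)
          (loop (.neg (.natLe e (var c))) ((Program.seq (.random a (var c) f)
          (setVar c (.add (var c) (.lit 1)))).exec F) k)) ∘
          fun x : Fin (N + 1) => some ((s₂ x).withTime (t₃ x))) =
          fun x => (PMF.uniformOfFintype _).map (fun ρ => some (g x ρ)) := by
        funext x
        exact hg1 x
      rw [e1]
      exact uniform_bind_map_uniform (Fin.consEquiv fun _ => Fin (N + 1)).symm
        (fun x ρ => some (g x ρ))
    · obtain ⟨h6, h7, h8, h9, h10, h11⟩ := hg2 (ρ 0) (Fin.tail ρ)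
      refine ⟨?_, h7, h8, fun b hb hb' => by rw [h9 b hb hb', hs₂b _ b hb hb'], ?_, ?_⟩
      · have h12 := (NatExpr.lit 0).cost_le hB (hs₁ (ρ 0) (by omega))
        have h13 := (NatExpr.add (var c) (.lit 1)).cost_le hB (hs₁ (ρ 0) (by omega))
        refine h6.trans ?_
        have e2 : (rem + 1 + 1) * ((drawLoop a c e f).wt * Nat.size B) =
            (rem + 1) * ((drawLoop a c e f).wt * Nat.size B) +
              (drawLoop a c e f).wt * Nat.size B := by ring
        have e3 : (drawLoop a c e f).wt * Nat.size B =
            (Test.neg (.natLe e (var c))).wt * Nat.size B + Nat.size B +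
            ((var c).wt * Nat.size B + f.wt * Nat.size B + Nat.size B) +
            ((NatExpr.lit 0).wt * Nat.size B +
              (NatExpr.add (var c) (.lit 1)).wt * Nat.size B + Nat.size B) := by
          simp only [drawLoop, Program.wt]; ring
        rw [e2]
        simp only [t₃, ht₂, ht₁]
        omega
      · intro i hi
        rw [h10 i (by rw [hs₂c]; omega), hs₂a, Function.update_of_ne (by omega)]
      · intro i
        refine Fin.cases ?_ (fun i => ?_) i
        · have := h10 (s.nat c 0) (by rw [hs₂c]; omega)
          simpa [hs₂a] using this
        · have := h11 i
          rw [hs₂c] at this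
          rw [Fin.val_succ, show s.nat c 0 + (i + 1) = s.nat c 0 + 1 + (i : ℕ) by ring, this]
          rfl

/-- Started with `c = 0`, `drawLoop` fills the first `m` cells of the array `a` with independent
uniformly distributed numbers. -/
theorem exec_drawLoop {B : ℕ} (hB : 2 ≤ B) {a c : ℕ} (hac : a ≠ c) {e f : NatExpr} {m N : ℕ}
    (hmB : m ≤ B) (hNB : N ≤ B) {F : ℕ} {s : State} (hs : Small B s) {t : ℕ}
    (he : ∀ s', (∀ b, b ≠ a → b ≠ c → s'.nat b = s.nat b) → e.eval s' = m)
    (hf : ∀ s', (∀ b, b ≠ a → b ≠ c → s'.nat b = s.nat b) → f.eval s' = N)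
    (hc : s.nat c 0 = 0) (hF : m < F) :
    ∃ g : (Fin m → Fin (N + 1)) → State,
      (drawLoop a c e f).exec F (s.withTime t) =
        (PMF.uniformOfFintype _).map (fun ρ => some (g ρ)) ∧
      ∀ ρ, (g ρ).time ≤ t + (m + 1) * ((drawLoop a c e f).wt * Nat.size B) ∧
        Small B (g ρ) ∧ (g ρ).real = s.real ∧ (∀ b, b ≠ a → b ≠ c → (g ρ).nat b = s.nat b) ∧
        ∀ i : Fin m, (g ρ).nat a i = ρ i := by
  obtain ⟨g, h1, h2⟩ := drawLoop_aux hB hac hmB hNB F m s hs t F he hf (by omega) hF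
  refine ⟨g, h1, fun ρ => ?_⟩
  obtain ⟨h3, h4, h5, h6, -, h7⟩ := h2 ρ
  exact ⟨h3, h4, h5, h6, fun i => by simpa [hc] using h7 i⟩

end RealRAM

/-! ### Simplices as feasible bases -/

namespace FeasibleBasis

open Function

variable {D : ℕ} {ι : Type*}

/-- The determinant of the matrix with rows `u i`. -/
noncomputable def rowDet (u : Fin D → Fin D → ℝ) : ℝ := (Matrix.of u).det

/-- Cramer's rule. -/
theorem rowDet_smul_eq_sum (u : Fin D → Fin D → ℝ) (x : Fin D → ℝ) :
    rowDet u • x = ∑ k, rowDet (update u k x) • u k := by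
  have h := Matrix.mulVec_cramer (Matrix.of u).transpose x
  rw [Matrix.det_transpose] at h
  unfold rowDet
  rw [← h]
  ext j
  simp only [Matrix.mulVec, dotProduct, Matrix.cramer_transpose_apply, Finset.sum_apply,
    Pi.smul_apply, smul_eq_mul, Matrix.transpose_apply, Matrix.of_apply]
  exact Finset.sum_congr rfl fun k _ => mul_comm _ _

theorem rowDet_update_sum (u : Fin D → Fin D → ℝ) (k : Fin D) (c : Fin D → ℝ) :
    rowDet (update u k (∑ i, c i • u i)) = c k * rowDet u :=
  Matrix.det_updateRow_sum (Matrix.of u) k c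

theorem rowDet_eq_zero {u : Fin D → Fin D → ℝ} {i j : Fin D} (hij : i ≠ j) (h : u i = u j) :
    rowDet u = 0 :=
  Matrix.det_zero_of_row_eq hij h

variable {h : ι → Fin D → ℝ} {e : Fin D → ℝ}

/-- The tuple `t` is a feasible basis for writing `e` as a nonnegative combination of the vectors
`h i`: the vectors `h (t k)` are a basis, and the coordinates of `e` in this basis, which Cramer's
rule expresses as quotients of determinants, are nonnegative. -/
def Feasible (h : ι → Fin D → ℝ) (e : Fin D → ℝ) (t : Fin D → ι) : Prop :=
  rowDet (h ∘ t) ≠ 0 ∧ ∀ k, 0 ≤ rowDet (h ∘ t) * rowDet (update (h ∘ t) k e)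

/-- The coordinate of `x` at the `k`-th vector of the basis `h ∘ t`. -/
noncomputable def coord (h : ι → Fin D → ℝ) (t : Fin D → ι) (x : Fin D → ℝ) (k : Fin D) : ℝ :=
  rowDet (update (h ∘ t) k x) / rowDet (h ∘ t)

theorem sum_coord {t : Fin D → ι} (ht : rowDet (h ∘ t) ≠ 0) (x : Fin D → ℝ) :
    ∑ k, coord h t x k • h (t k) = x := by
  have := rowDet_smul_eq_sum (h ∘ t) x
  simp only [coord, div_eq_inv_mul, mul_smul, ← Finset.smul_sum]
  rw [inv_smul_eq_iff₀ ht]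
  exact this.symm

theorem coord_sum {t : Fin D → ι} (ht : rowDet (h ∘ t) ≠ 0) (c : Fin D → ℝ) (k : Fin D) :
    coord h t (∑ i, c i • h (t i)) k = c k := by
  have := rowDet_update_sum (h ∘ t) k c
  simp only [comp_apply] at this
  rw [coord, this, mul_div_cancel_right₀ _ ht]

theorem coord_eq_iff {t : Fin D → ι} (ht : rowDet (h ∘ t) ≠ 0) {x : Fin D → ℝ} {c : Fin D → ℝ} :
    coord h t x = c ↔ x = ∑ i, c i • h (t i) := by
  constructor
  · rintro rfl; exact (sum_coord ht x).symm
  · rintro rfl; exact funext (coord_sum ht c)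

theorem Feasible.injective {t : Fin D → ι} (ht : Feasible h e t) : Injective t := by
  intro i j hij
  by_contra hne
  exact ht.1 (rowDet_eq_zero hne (by simp [hij]))

/-- Multiplication by `rowDet (h ∘ t) ^ 2` replaces the quotients of Cramer's rule by products,
which a program can compare with zero. -/
theorem feasible_iff_coord {t : Fin D → ι} :
    Feasible h e t ↔ rowDet (h ∘ t) ≠ 0 ∧ ∀ k, 0 ≤ coord h t e k := by
  refine and_congr_right fun h0 => forall_congr' fun k => ?_
  rw [coord, div_eq_mul_inv, mul_comm (rowDet (h ∘ t))]
  constructor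
  · intro h1
    rw [← mul_inv_cancel_right₀ (mul_self_ne_zero.2 h0) (_ * _⁻¹)]
    have : rowDet (update (h ∘ t) k e) * (rowDet (h ∘ t))⁻¹ *
        (rowDet (h ∘ t) * rowDet (h ∘ t)) = rowDet (update (h ∘ t) k e) * rowDet (h ∘ t) := by
      field_simp
    rw [this]
    exact mul_nonneg h1 (inv_nonneg.2 (mul_self_nonneg _))
  · intro h1
    have : rowDet (update (h ∘ t) k e) * rowDet (h ∘ t) =
        rowDet (update (h ∘ t) k e) * (rowDet (h ∘ t))⁻¹ *
        (rowDet (h ∘ t) * rowDet (h ∘ t)) := by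
      field_simp
    rw [this]
    exact mul_nonneg h1 (mul_self_nonneg _)

/-- In general position (`H₁`) feasibility says that `e` is in the cone of the vectors `h (t k)`. -/
theorem feasible_iff (H₁ : ∀ t : Fin D → ι, Injective t → rowDet (h ∘ t) ≠ 0) {t : Fin D → ι} :
    Feasible h e t ↔ Injective t ∧ ∃ c : Fin D → ℝ, (∀ k, 0 ≤ c k) ∧ e = ∑ k, c k • h (t k) := by
  constructor
  · intro ht
    have h2 := feasible_iff_coord.1 ht
    exact ⟨ht.injective, coord h t e, h2.2, (sum_coord h2.1 e).symm⟩
  · rintro ⟨hi, c, hc, he⟩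
    rw [feasible_iff_coord]
    have hd := H₁ t hi
    rw [(coord_eq_iff hd).2 he]
    exact ⟨hd, hc⟩

theorem Feasible.perm (H₁ : ∀ t : Fin D → ι, Injective t → rowDet (h ∘ t) ≠ 0) {t : Fin D → ι}
    (ht : Feasible h e t) (π : Equiv.Perm (Fin D)) : Feasible h e (t ∘ π) := by
  rw [feasible_iff H₁] at ht ⊢
  obtain ⟨hi, c, hc, he⟩ := ht
  refine ⟨hi.comp π.injective, c ∘ π, fun k => hc _, ?_⟩
  rw [he]
  exact (Equiv.sum_comp π fun k => c k • h (t k)).symm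

/-- The sum of the coordinates of `e` at the basis vectors with index outside `S`. -/
noncomputable def weightOutside (h : ι → Fin D → ℝ) (e : Fin D → ℝ) (S : Set ι) (t : Fin D → ι) :
    ℝ :=
  open Classical in ∑ k with t k ∉ S, coord h t e k

/-- If two feasible bases differ, then there is a pivot step from the first one which introduces an
index of the second one and decreases the weight outside the second one. This is the simplex
algorithm for the linear program whose only optimal basis is the second one. -/
theorem exists_pivot (H₁ : ∀ t : Fin D → ι, Injective t → rowDet (h ∘ t) ≠ 0)
    (H₂ : ∀ t : Fin D → ι, Injective t → ∀ k, rowDet (update (h ∘ t) k e) ≠ 0)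
    {s T : Fin D → ι} (hs : Feasible h e s) (hT : Feasible h e T)
    (hne : ∃ k, s k ∉ Set.range T) :
    ∃ k x, Feasible h e (update s k x) ∧
      weightOutside h e (Set.range T) (update s k x) < weightOutside h e (Set.range T) s := by
  classical
  have hd := hs.1
  have hpos : ∀ k, 0 < coord h s e k := fun k =>
    lt_of_le_of_ne ((feasible_iff_coord.1 hs).2 k)
      (div_ne_zero (H₂ s hs.injective k) hd).symm
  obtain ⟨-, μ, hμ, heμ⟩ := (feasible_iff H₁).1 hT
  set U : Finset (Fin D) := {k | s k ∉ Set.range T} with hU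
  have hUne : U.Nonempty := by
    obtain ⟨k, hk⟩ := hne
    exact ⟨k, by simpa [hU] using hk⟩
  -- the coordinates of `e` in terms of the coordinates of the vectors of the second basis
  have hcoord : coord h s e = fun k => ∑ j, μ j * coord h s (h (T j)) k := by
    rw [coord_eq_iff hd]
    conv_lhs => rw [heμ]
    simp only [Finset.sum_smul, mul_smul]
    rw [Finset.sum_comm]
    refine Finset.sum_congr rfl fun j _ => ?_
    rw [← Finset.smul_sum, sum_coord hd]
  have hsum : 0 < ∑ j, μ j * ∑ k ∈ U, coord h s (h (T j)) k := by
    have h1 : ∑ j, μ j * ∑ k ∈ U, coord h s (h (T j)) k = ∑ k ∈ U, coord h s e k := by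
      rw [hcoord]
      simp only [Finset.mul_sum]
      exact Finset.sum_comm
    rw [h1]
    exact Finset.sum_pos (fun k _ => hpos k) hUne
  obtain ⟨j, -, hj⟩ := Finset.exists_lt_of_sum_lt (by simpa using hsum :
    ∑ j : Fin D, (0 : ℝ) < ∑ j, μ j * ∑ k ∈ U, coord h s (h (T j)) k)
  have hjU : 0 < ∑ k ∈ U, coord h s (h (T j)) k := pos_of_mul_pos_right hj (hμ j)
  -- `T j` is the index that enters the basis
  set a := coord h s (h (T j)) with ha
  have hx : T j ∉ Set.range s := by
    rintro ⟨k₀, hk₀⟩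
    have h1 : a = Pi.single k₀ 1 := by
      rw [ha, coord_eq_iff hd, ← hk₀]
      simp [Pi.single_apply, ite_smul]
    rw [h1, Finset.sum_eq_zero] at hjU
    · exact lt_irrefl _ hjU
    · intro k hk
      rw [Pi.single_apply, if_neg]
      rintro rfl
      simp only [hU, Finset.mem_filter, hk₀] at hk
      exact hk.2 ⟨j, rfl⟩
  -- the minimum ratio determines the index that leaves the basis
  obtain ⟨k₁, -, hk₁⟩ := Finset.exists_lt_of_sum_lt (by simpa using hjU :
    ∑ k ∈ U, (0 : ℝ) < ∑ k ∈ U, a k)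
  obtain ⟨k, hk, hmin⟩ := Finset.exists_min_image ({k | 0 < a k} : Finset (Fin D))
    (fun k => coord h s e k / a k) ⟨k₁, by simpa using hk₁⟩
  simp only [Finset.mem_filter, Finset.mem_univ, true_and] at hk hmin
  set θ := coord h s e k / a k with hθ
  have hθpos : 0 < θ := div_pos (hpos k) hk
  have hk0 : coord h s e k - θ * a k = 0 := by rw [hθ, div_mul_cancel₀ _ hk.ne', sub_self]
  let c : Fin D → ℝ := update (fun i => coord h s e i - θ * a i) k θ
  have hinj : Injective (update s k (T j)) := by
    intro i i' hii
    by_cases hi : i = k <;> by_cases hi' : i' = k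
    · rw [hi, hi']
    · subst hi; rw [update_self, update_of_ne hi'] at hii; exact (hx ⟨i', hii.symm⟩).elim
    · subst hi'; rw [update_self, update_of_ne hi] at hii; exact (hx ⟨i, hii⟩).elim
    · rw [update_of_ne hi, update_of_ne hi'] at hii; exact hs.injective hii
  have hc0 : ∀ i, 0 ≤ c i := by
    intro i
    by_cases hi : i = k
    · subst hi; simpa [c] using hθpos.le
    · simp only [c, update_of_ne hi]
      rcases le_or_gt (a i) 0 with hai | hai
      · nlinarith [hpos i]
      · have := (le_div_iff₀ hai).1 (hmin i hai)
        linarith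
  have hce : e = ∑ i, c i • h (update s k (T j) i) := by
    have h1 : ∑ i, c i • h (update s k (T j) i) =
        ∑ i, (coord h s e i - θ * a i) • h (s i) + θ • h (T j) := by
      rw [← Finset.add_sum_erase _ _ (Finset.mem_univ k),
        ← Finset.add_sum_erase _ (fun i => (coord h s e i - θ * a i) • h (s i))
          (Finset.mem_univ k), hk0]
      simp only [c, update_self, zero_smul, zero_add]
      rw [add_comm]
      congr 1
      refine Finset.sum_congr rfl fun i hi => ?_
      rw [update_of_ne (Finset.ne_of_mem_erase hi), update_of_ne (Finset.ne_of_mem_erase hi)]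
    rw [h1]
    simp only [sub_smul, mul_smul, Finset.sum_sub_distrib, ← Finset.smul_sum]
    rw [sum_coord hd, ha, sum_coord hd]
    simp
  have hfeas : Feasible h e (update s k (T j)) := (feasible_iff H₁).2 ⟨hinj, c, hc0, hce⟩
  refine ⟨k, T j, hfeas, ?_⟩
  have hw1 : weightOutside h e (Set.range T) (update s k (T j)) =
      ∑ i ∈ U, (coord h s e i - θ * a i) := by
    rw [weightOutside, (coord_eq_iff hfeas.1).2 hce, hU, Finset.sum_filter, Finset.sum_filter]
    refine Finset.sum_congr (by congr) fun i _ => ?_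
    by_cases hi : i = k
    · subst hi; simp [hk0]
    · simp [c, update_of_ne hi]
  have hw2 : weightOutside h e (Set.range T) s = ∑ i ∈ U, coord h s e i := by
    rw [weightOutside, hU]
    congr
  rw [hw1, hw2, Finset.sum_sub_distrib, ← Finset.mul_sum]
  have := mul_pos hθpos hjU
  linarith

/-- The graph of feasible bases is connected: a set of feasible bases that is closed under pivot
steps and permutations and is nonempty contains all feasible bases. -/
theorem mem_of_pivot_closed [Finite ι] (H₁ : ∀ t : Fin D → ι, Injective t → rowDet (h ∘ t) ≠ 0)
    (H₂ : ∀ t : Fin D → ι, Injective t → ∀ k, rowDet (update (h ∘ t) k e) ≠ 0)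
    {R : Set (Fin D → ι)} (hR : ∀ s ∈ R, Feasible h e s)
    (hpivot : ∀ s ∈ R, ∀ k x, Feasible h e (update s k x) → update s k x ∈ R)
    (hperm : ∀ s ∈ R, ∀ π : Equiv.Perm (Fin D), s ∘ π ∈ R) (hne : R.Nonempty)
    {T : Fin D → ι} (hT : Feasible h e T) : T ∈ R := by
  obtain ⟨s, hs, hmin⟩ := Set.exists_min_image R (weightOutside h e (Set.range T))
    (Set.toFinite R) hne
  have hsub : ∀ k, s k ∈ Set.range T := by
    by_contra! hk
    obtain ⟨k, x, hf, hlt⟩ := exists_pivot H₁ H₂ (hR s hs) hT hk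
    exact absurd (hmin _ (hpivot s hs k x hf)) (not_le.2 hlt)
  choose π hπ using hsub
  have hπi : Injective π := fun i j hij => (hR s hs).injective (by rw [← hπ i, ← hπ j, hij])
  have h2 := hperm s hs (Equiv.ofBijective π (Finite.injective_iff_bijective.1 hπi)).symm
  convert h2
  funext i
  simp only [comp_apply]
  rw [← hπ]
  exact congrArg T (Equiv.ofBijective_apply_symm_apply _ _ i).symm

/-- Deletion of the first entry of a tuple and insertion of the same entry at the end is a rotation.
-/
theorem cycle_mem {d : ℕ} {h : ι → Fin (d + 1) → ℝ} {e : Fin (d + 1) → ℝ}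
    (H₁ : ∀ t : Fin (d + 1) → ι, Injective t → rowDet (h ∘ t) ≠ 0)
    {R : Set (Fin (d + 1) → ι)} (hR : ∀ s ∈ R, Feasible h e s)
    (hshift : ∀ s ∈ R, ∀ x, Feasible h e (Fin.snoc (Fin.tail s) x : Fin (d + 1) → ι) →
      (Fin.snoc (Fin.tail s) x : Fin (d + 1) → ι) ∈ R)
    {s : Fin (d + 1) → ι} (hs : s ∈ R) (m : ℕ) :
    s ∘ (finRotate (d + 1) ^ m : Equiv.Perm _) ∈ R := by
  induction m with
  | zero => exact hs
  | succ m ih =>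
    set u := s ∘ (finRotate (d + 1) ^ m : Equiv.Perm _) with hu
    have h1 : s ∘ (finRotate (d + 1) ^ (m + 1) : Equiv.Perm _) =
        (Fin.snoc (Fin.tail u) (u 0) : Fin (d + 1) → ι) := by
      funext i
      rw [pow_succ]
      refine Fin.lastCases ?_ (fun i => ?_) i
      · simp [hu]
      · simp [hu, Fin.tail]
    rw [h1]
    refine hshift u ih _ ?_
    rw [← h1]
    exact (hR s hs).perm H₁ _

theorem exists_finRotate_pow (d : ℕ) (j : Fin (d + 1)) :
    ∃ m : ℕ, (finRotate (d + 1) ^ m : Equiv.Perm _) j = Fin.last d := by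
  have h : ∀ (m : ℕ) (j : Fin (d + 1)), (j : ℕ) + m = d →
      (finRotate (d + 1) ^ m : Equiv.Perm _) j = Fin.last d := by
    intro m
    induction m with
    | zero => intro j hj; exact Fin.ext (by simpa using hj)
    | succ m ih =>
      intro j hj
      rw [pow_succ, Equiv.Perm.mul_apply, show j = ⟨j, by omega⟩ from rfl,
        finRotate_of_lt (by omega : (j : ℕ) < d)]
      exact ih _ (by simp only; omega)
  exact ⟨d - j, h _ j (by omega)⟩

/-- The moves "delete the first entry and append a new last one" suffice to explore all feasible
bases: if a set of feasible bases is closed under these moves and contains with one basis `s₀` all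
its permutations, then it contains all feasible bases. Rotations are among the moves, so that
every pivot step on every permutation can be carried out. -/
theorem mem_of_shift_closed {d : ℕ} [Finite ι] {h : ι → Fin (d + 1) → ℝ} {e : Fin (d + 1) → ℝ}
    (H₁ : ∀ t : Fin (d + 1) → ι, Injective t → rowDet (h ∘ t) ≠ 0)
    (H₂ : ∀ t : Fin (d + 1) → ι, Injective t → ∀ k, rowDet (update (h ∘ t) k e) ≠ 0)
    {R : Set (Fin (d + 1) → ι)} (hR : ∀ s ∈ R, Feasible h e s)
    (hshift : ∀ s ∈ R, ∀ x, Feasible h e (Fin.snoc (Fin.tail s) x : Fin (d + 1) → ι) →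
      (Fin.snoc (Fin.tail s) x : Fin (d + 1) → ι) ∈ R)
    {s₀ : Fin (d + 1) → ι} (hs₀ : ∀ π : Equiv.Perm (Fin (d + 1)), s₀ ∘ π ∈ R)
    {T : Fin (d + 1) → ι} (hT : Feasible h e T) : T ∈ R := by
  let R' : Set (Fin (d + 1) → ι) := {s | ∀ π : Equiv.Perm (Fin (d + 1)), s ∘ π ∈ R}
  have hR'R : ∀ s ∈ R', s ∈ R := fun s hs => hs 1
  refine hR'R T (mem_of_pivot_closed H₁ H₂ (R := R') (fun s hs => hR s (hR'R s hs)) ?_ ?_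
    ⟨s₀, hs₀⟩ hT)
  · intro s hs k x hf π
    obtain ⟨m, hm⟩ := exists_finRotate_pow d (π.symm k)
    -- a permutation `σ` that moves the new entry to the end and is `π` up to rotations
    let ρ := finRotate (d + 1)
    let σ : Equiv.Perm (Fin (d + 1)) := π * (ρ ^ m)⁻¹
    have hσ : σ (Fin.last d) = k := by
      simp only [σ, Equiv.Perm.mul_apply]
      rw [← hm]
      change π ((ρ ^ m).symm ((ρ ^ m) (π.symm k))) = k
      simp
    have h1 : update s k x ∘ σ = (Fin.snoc (Fin.tail (s ∘ (σ * ρ⁻¹ : Equiv.Perm _))) x :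
        Fin (d + 1) → ι) := by
      funext i
      refine Fin.lastCases ?_ (fun i => ?_) i
      · simp [hσ]
      · have hne : σ i.castSucc ≠ k := by
          rw [← hσ]
          exact fun hh => (Fin.castSucc_lt_last i).ne (σ.injective hh)
        have h2 : ρ.symm i.succ = i.castSucc := by
          rw [Equiv.symm_apply_eq]
          simp [ρ]
        simp [update_of_ne hne, Fin.tail, h2]
    have h3 : update s k x ∘ σ ∈ R := by
      rw [h1]
      refine hshift _ (hs _) x ?_
      rw [← h1]
      exact hf.perm H₁ _
    have h4 := cycle_mem H₁ hR hshift h3 m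
    have h5 : update s k x ∘ π = (update s k x ∘ σ) ∘ (ρ ^ m : Equiv.Perm _) := by
      funext i
      simp [σ]
    rw [h5]
    exact h4
  · intro s hs π τ
    exact hs (π * τ)

end FeasibleBasis

/-! ### Feasible bases and convex hulls -/

namespace FeasibleBasis

open Function

variable {d : ℕ} {ι : Type*}

/-- Homogeneous coordinates. -/
noncomputable def homog (x : EuclideanSpace ℝ (Fin d)) : Fin (d + 1) → ℝ :=
  Fin.snoc (α := fun _ => ℝ) (fun j => x j) 1

theorem homog_eq_sum_iff {κ : Type*} [Fintype κ] (q : EuclideanSpace ℝ (Fin d))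
    (u : κ → EuclideanSpace ℝ (Fin d)) (c : κ → ℝ) :
    homog q = ∑ k, c k • homog (u k) ↔ ∑ k, c k = 1 ∧ ∑ k, c k • u k = q := by
  constructor
  · intro h
    constructor
    · have := congrFun h (Fin.last d)
      simpa [homog] using this.symm
    · ext j
      have := congrFun h j.castSucc
      simpa [homog] using this.symm
  · rintro ⟨h1, rfl⟩
    ext j
    refine Fin.lastCases ?_ (fun j => ?_) j
    · simpa [homog] using h1.symm
    · simp [homog]

theorem rowDet_homog_ne_zero {u : Fin (d + 1) → EuclideanSpace ℝ (Fin d)}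
    (hu : AffineIndependent ℝ u) : rowDet (homog ∘ u) ≠ 0 := by
  intro h0
  obtain ⟨v, hv, hv0⟩ := Matrix.exists_vecMul_eq_zero_iff.2 h0
  have hz : ∀ j, ∑ k, v k * homog (u k) j = 0 := fun j => by
    simpa [Matrix.vecMul, dotProduct] using congrFun hv0 j
  refine hv (funext fun k => ?_)
  refine affineIndependent_iff.1 hu Finset.univ v ?_ ?_ k (Finset.mem_univ k)
  · simpa [homog] using hz (Fin.last d)
  · ext j
    simpa [homog] using hz j.castSucc

theorem affineIndependent_of_inGeneralPosition {S : Set (EuclideanSpace ℝ (Fin d))}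
    (hS : InGeneralPosition S) {u : Fin (d + 1) → EuclideanSpace ℝ (Fin d)} (hu : Injective u)
    (huS : ∀ k, u k ∈ S) : AffineIndependent ℝ u := by
  classical
  have hsub : ((Finset.univ.image u : Finset _) : Set (EuclideanSpace ℝ (Fin d))) ⊆ S := by
    intro x hx
    obtain ⟨k, -, rfl⟩ := Finset.mem_image.1 hx
    exact huS k
  have hcard : (Finset.univ.image u).card = d + 1 := by
    rw [Finset.card_image_of_injective _ hu, Finset.card_fin]
  have h1 := hS (Finset.univ.image u) hsub hcard
  let f : Fin (d + 1) ↪ (Finset.univ.image u : Finset (EuclideanSpace ℝ (Fin d))) :=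
    ⟨fun k => ⟨u k, Finset.mem_image_of_mem u (Finset.mem_univ k)⟩,
      fun i j hij => hu (congrArg Subtype.val hij)⟩
  exact h1.comp_embedding f

/-- The determinants of tuples of points do not vanish. -/
theorem rowDet_ne_zero_of_inGeneralPosition {S : Set (EuclideanSpace ℝ (Fin d))}
    (hS : InGeneralPosition S) {p : ι → EuclideanSpace ℝ (Fin d)} (hp : Injective p)
    (hpS : ∀ i, p i ∈ S) (t : Fin (d + 1) → ι) (ht : Injective t) :
    rowDet ((homog ∘ p) ∘ t) ≠ 0 :=
  rowDet_homog_ne_zero (affineIndependent_of_inGeneralPosition hS (hp.comp ht) fun _ => hpS _)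

/-- Unless `q` is one of the points, the coordinates of `q` in a basis of points do not vanish. -/
theorem rowDet_update_ne_zero_of_inGeneralPosition {S : Set (EuclideanSpace ℝ (Fin d))}
    (hS : InGeneralPosition S) {p : ι → EuclideanSpace ℝ (Fin d)} (hp : Injective p)
    (hpS : ∀ i, p i ∈ S) {q : EuclideanSpace ℝ (Fin d)} (hqS : q ∈ S) (hq : ∀ i, p i ≠ q)
    (t : Fin (d + 1) → ι) (ht : Injective t) (k : Fin (d + 1)) :
    rowDet (update ((homog ∘ p) ∘ t) k (homog q)) ≠ 0 := by
  have h1 : update ((homog ∘ p) ∘ t) k (homog q) = homog ∘ update (p ∘ t) k q := by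
    rw [comp_update]; rfl
  rw [h1]
  refine rowDet_homog_ne_zero (affineIndependent_of_inGeneralPosition hS ?_ fun i => ?_)
  · intro i j hij
    by_cases hi : i = k <;> by_cases hj : j = k
    · rw [hi, hj]
    · subst hi; rw [update_self, update_of_ne hj] at hij; exact (hq _ hij.symm).elim
    · subst hj; rw [update_self, update_of_ne hi] at hij; exact (hq _ hij).elim
    · rw [update_of_ne hi, update_of_ne hj] at hij; exact ht (hp hij)
  · by_cases hi : i = k
    · subst hi; simpa using hqS
    · simpa [update_of_ne hi] using hpS _

/-- In homogeneous coordinates the convex hull becomes a cone. -/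
theorem mem_convexHull_range_iff {κ : Type*} [Fintype κ] (u : κ → EuclideanSpace ℝ (Fin d))
    (q : EuclideanSpace ℝ (Fin d)) :
    q ∈ convexHull ℝ (Set.range u) ↔
      ∃ c : κ → ℝ, (∀ k, 0 ≤ c k) ∧ homog q = ∑ k, c k • homog (u k) := by
  classical
  simp only [homog_eq_sum_iff]
  constructor
  · intro h
    rw [convexHull_range_eq_exists_affineCombination] at h
    obtain ⟨s, w, hw0, hw1, hw⟩ := h
    rw [Finset.affineCombination_eq_linear_combination _ _ _ hw1] at hw
    refine ⟨fun k => if k ∈ s then w k else 0, fun k => ?_, ?_, ?_⟩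
    · by_cases hk : k ∈ s
      · simpa [hk] using hw0 k hk
      · simp [hk]
    · simpa using hw1
    · simpa [ite_smul] using hw
  · rintro ⟨c, h0, h1, h2⟩
    exact mem_convexHull_of_exists_fintype c u h0 h1 (fun _ => Set.mem_range_self _) h2

theorem feasible_homog_iff {p : ι → EuclideanSpace ℝ (Fin d)} {q : EuclideanSpace ℝ (Fin d)}
    (H₁ : ∀ t : Fin (d + 1) → ι, Injective t → rowDet ((homog ∘ p) ∘ t) ≠ 0)
    {t : Fin (d + 1) → ι} :
    Feasible (homog ∘ p) (homog q) t ↔ Injective t ∧ q ∈ convexHull ℝ (Set.range (p ∘ t)) := by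
  rw [feasible_iff H₁, mem_convexHull_range_iff]
  rfl

/-- The number of enumerations of a finite set. -/
theorem card_injective_image_eq {α : Type*} [Fintype α] [DecidableEq α] {m : ℕ} (S : Finset α)
    (hS : S.card = m) :
    Fintype.card {t : Fin m → α // Injective t ∧ Finset.univ.image t = S} = m.factorial := by
  have e : {t : Fin m → α // Injective t ∧ Finset.univ.image t = S} ≃ (Fin m ↪ S) :=
    { toFun := fun t => ⟨fun k => ⟨t.1 k, by
          have h := Finset.mem_image_of_mem t.1 (Finset.mem_univ k)
          rwa [t.2.2] at h⟩,
        fun i j hij => t.2.1 (by simpa using hij)⟩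
      invFun := fun f => ⟨fun k => f k, Subtype.val_injective.comp f.injective, by
        apply Finset.eq_of_subset_of_card_le
        · intro x hx
          obtain ⟨k, -, rfl⟩ := Finset.mem_image.1 hx
          exact (f k).2
        · rw [Finset.card_image_of_injective (f := fun k => (f k : α)) _
            (Subtype.val_injective.comp f.injective)]
          simp [hS]⟩
      left_inv := fun t => rfl
      right_inv := fun f => rfl }
  rw [Fintype.card_congr e, Fintype.card_embedding_eq]
  simp [hS, Nat.descFactorial_self]

open Classical in
/-- The definition of the simplicial depth counts sets, to which the finite subsets are coerced one
by one. As the coercion is injective, one may count finite subsets instead. -/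
theorem simplicialDepth_eq_card (P : Finset (EuclideanSpace ℝ (Fin d)))
    (q : EuclideanSpace ℝ (Fin d)) :
    simplicialDepth P q = ((P.powersetCard (d + 1)).filter
      fun S : Finset (EuclideanSpace ℝ (Fin d)) =>
        q ∈ convexHull ℝ (S : Set (EuclideanSpace ℝ (Fin d)))).card := by
  have h : simplicialDepth P q = (((P.powersetCard (d + 1)).image
      fun S : Finset (EuclideanSpace ℝ (Fin d)) => (S : Set (EuclideanSpace ℝ (Fin d)))).filter
      fun S : Set (EuclideanSpace ℝ (Fin d)) => q ∈ convexHull ℝ S).card := by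
    unfold simplicialDepth
    congr 1
    ext S
    simp [Finset.bind_def]
  rw [h, Finset.filter_image, Finset.card_image_of_injective _ Finset.coe_injective]

open Classical in
/-- Each simplex that contains `q` is counted `(d + 1)!` times as a feasible basis. -/
theorem card_feasible (P : Finset (EuclideanSpace ℝ (Fin d))) (q : EuclideanSpace ℝ (Fin d))
    (hP : InGeneralPosition (insert q (P : Set (EuclideanSpace ℝ (Fin d)))))
    {n : ℕ} (p : Fin n ≃ P) :
    Fintype.card {t : Fin (d + 1) → Fin n //
        Feasible (homog ∘ fun i => (p i : EuclideanSpace ℝ (Fin d))) (homog q) t} =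
      (d + 1).factorial * simplicialDepth P q := by
  have hp : Injective fun i => (p i : EuclideanSpace ℝ (Fin d)) :=
    Subtype.val_injective.comp p.injective
  have H₁ := rowDet_ne_zero_of_inGeneralPosition hP hp (fun i => by simp)
  let φ : (Fin (d + 1) → Fin n) ≃ (Fin (d + 1) → P) := Equiv.arrowCongr (Equiv.refl _) p
  let Q : (Fin (d + 1) → P) → Prop := fun t => Injective t ∧
    q ∈ convexHull ℝ (Set.range fun k => (t k : EuclideanSpace ℝ (Fin d)))
  have h1 : ∀ t : Fin (d + 1) → Fin n,
      Feasible (homog ∘ fun i => (p i : EuclideanSpace ℝ (Fin d))) (homog q) t ↔ Q (φ t) := by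
    intro t
    rw [feasible_homog_iff H₁]
    exact and_congr (p.injective.of_comp_iff t).symm Iff.rfl
  have hcoe : ∀ t : Fin (d + 1) → P,
      ((Finset.univ.image fun k => (t k : EuclideanSpace ℝ (Fin d)) : Finset _) :
        Set (EuclideanSpace ℝ (Fin d))) = Set.range fun k => (t k : EuclideanSpace ℝ (Fin d)) := by
    intro t
    rw [Finset.coe_image, Finset.coe_univ, Set.image_univ]
  rw [Fintype.card_congr (φ.subtypeEquiv (q := Q) h1), Fintype.card_subtype]
  rw [simplicialDepth_eq_card, mul_comm, ← smul_eq_mul (α := ℕ), ← Finset.sum_const]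
  rw [Finset.card_eq_sum_card_fiberwise
    (f := fun t => Finset.univ.image fun k => (t k : EuclideanSpace ℝ (Fin d)))
    (t := (P.powersetCard (d + 1)).filter
      fun S => q ∈ convexHull ℝ (S : Set (EuclideanSpace ℝ (Fin d))))]
  · refine Finset.sum_congr rfl fun S hS => ?_
    rw [Finset.mem_filter, Finset.mem_powersetCard] at hS
    obtain ⟨⟨hSP, hSc⟩, hSq⟩ := hS
    have hS' : (S.attach.image fun x : S => (⟨x, hSP x.2⟩ : P)).card = d + 1 := by
      have hinj : Injective fun x : S => (⟨x, hSP x.2⟩ : P) := fun x y hxy =>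
        Subtype.ext (congrArg (fun z : P => (z : EuclideanSpace ℝ (Fin d))) hxy)
      rw [Finset.card_image_of_injective _ hinj, Finset.card_attach, hSc]
    have h3 := card_injective_image_eq (m := d + 1) _ hS'
    rw [Fintype.card_subtype] at h3
    rw [← h3]
    congr 1
    ext t
    have h4 : (Finset.univ.image t = S.attach.image fun x : S => (⟨x, hSP x.2⟩ : P)) ↔
        (Finset.univ.image fun k => (t k : EuclideanSpace ℝ (Fin d))) = S := by
      have h5 : (S.attach.image fun x : S => (⟨x, hSP x.2⟩ : P)).image Subtype.val = S := by
        rw [Finset.image_image]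
        exact Finset.attach_image_val
      have h6 : (Finset.univ.image t).image Subtype.val =
          Finset.univ.image fun k => (t k : EuclideanSpace ℝ (Fin d)) := by
        rw [Finset.image_image]; rfl
      rw [← (Finset.image_injective Subtype.val_injective).eq_iff, h5, h6]
    simp only [Finset.mem_filter, Finset.mem_univ, true_and, h4]
    constructor
    · rintro ⟨⟨h7, -⟩, h8⟩
      exact ⟨h7, h8⟩
    · rintro ⟨h7, h8⟩
      exact ⟨⟨h7, by rw [← hcoe, h8]; exact hSq⟩, h8⟩
  · intro t ht
    simp only [Finset.coe_filter, Finset.mem_univ, true_and, Set.mem_ofPred_eq] at ht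
    simp only [Finset.coe_filter, Set.mem_ofPred_eq, Finset.mem_powersetCard]
    refine ⟨⟨?_, ?_⟩, by rw [hcoe]; exact ht.2⟩
    · intro x hx
      obtain ⟨k, -, rfl⟩ := Finset.mem_image.1 hx
      exact (t k).2
    · rw [Finset.card_image_of_injective (f := fun k => (t k : EuclideanSpace ℝ (Fin d))) _
        (Subtype.val_injective.comp ht.1)]
      simp

open Classical in
/-- If `q` is one of the points, then it lies in every simplex of which it is a vertex. -/
theorem le_card_feasible_of_eq {n : ℕ} {p : Fin n → EuclideanSpace ℝ (Fin d)}
    {q : EuclideanSpace ℝ (Fin d)}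
    (H₁ : ∀ t : Fin (d + 1) → Fin n, Injective t → rowDet ((homog ∘ p) ∘ t) ≠ 0)
    {i : Fin n} (hi : p i = q) :
    (n - d) ^ d ≤ Fintype.card {t : Fin (d + 1) → Fin n // Feasible (homog ∘ p) (homog q) t} := by
  have hn : 0 < n := i.pos
  have h1 : (n - d) ^ d ≤ Fintype.card (Fin d ↪ {x : Fin n // x ≠ i}) := by
    rw [Fintype.card_embedding_eq]
    have h2 := Nat.pow_sub_le_descFactorial (n - 1) d
    rw [Nat.sub_add_cancel hn] at h2
    simpa using h2
  refine h1.trans (Fintype.card_le_of_injective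
    (fun f => ⟨Fin.cons i fun k => (f k : Fin n), (feasible_homog_iff H₁).2 ⟨?_, ?_⟩⟩) ?_)
  · rw [Fin.cons_injective_iff]
    refine ⟨?_, Subtype.val_injective.comp f.injective⟩
    rintro ⟨k, hk⟩
    exact (f k).2 hk
  · exact subset_convexHull ℝ _ ⟨0, by simpa using hi⟩
  · intro f g hfg
    simp only [Subtype.mk.injEq] at hfg
    have := Fin.cons_right_injective _ hfg
    ext k
    exact congrArg Fin.val (congrFun this k)

/-! ### Separating hyperplanes spanned by points -/

theorem update_zero_cons {α : Type*} (x y : α) (b : Fin d → α) :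
    update (Fin.cons x b : Fin (d + 1) → α) 0 y = Fin.cons y b := by
  simp

theorem comp_cons {α β : Type*} (f : α → β) (x : α) (b : Fin d → α) :
    f ∘ (Fin.cons x b : Fin (d + 1) → α) = Fin.cons (f x) (f ∘ b) := by
  funext i
  refine Fin.cases rfl (fun _ => rfl) i

theorem exists_ne_zero_orthogonal {κ : Type*} [Fintype κ] {D : ℕ} (h : Fintype.card κ < D)
    (w : κ → Fin D → ℝ) : ∃ z : Fin D → ℝ, z ≠ 0 ∧ ∀ k, dotProduct z (w k) = 0 := by
  have h1 := LinearMap.ker_ne_bot_of_finrank_lt (f := (Matrix.of w).mulVecLin) (by simpa using h)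
  obtain ⟨z, hz, hz0⟩ := (Submodule.ne_bot_iff _).1 h1
  refine ⟨z, hz0, fun k => ?_⟩
  have := congrFun (LinearMap.mem_ker.1 hz) k
  rw [dotProduct_comm]
  simpa [Matrix.mulVec] using this

/-- A hyperplane that separates `e` strictly from the vectors `h v`, `v ∈ V`, can be rotated until
it contains `k` of these vectors. -/
theorem exists_separating_vanishing {D : ℕ} {h : ι → Fin D → ℝ} {e : Fin D → ℝ} {V : Finset ι}
    {t : Fin D → ι} (htV : ∀ k, t k ∈ V) (ht : rowDet (h ∘ t) ≠ 0)
    {y : Fin D → ℝ} (hy : ∀ v ∈ V, 0 ≤ dotProduct y (h v)) (hye : dotProduct y e < 0)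
    {k : ℕ} (hk : k + 1 ≤ D) :
    ∃ y : Fin D → ℝ, (∀ v ∈ V, 0 ≤ dotProduct y (h v)) ∧ dotProduct y e < 0 ∧
      k ≤ (V.filter fun v => dotProduct y (h v) = 0).card := by
  classical
  induction k with
  | zero => exact ⟨y, hy, hye, Nat.zero_le _⟩
  | succ k ih =>
    obtain ⟨y, hy, hye, hcard⟩ := ih (by omega)
    set Z := V.filter fun v => dotProduct y (h v) = 0 with hZ
    rcases lt_or_eq_of_le hcard with hlt | heq
    · exact ⟨y, hy, hye, hlt⟩
    -- Rotating towards a functional `z` that vanishes on `e` and on the vectors of `Z` keeps `e`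
    -- where it is and the vectors of `Z` on the hyperplane.
    obtain ⟨z, hz0, hz⟩ := exists_ne_zero_orthogonal (κ := Option Z) (D := D)
      (by simp; omega) (fun o => o.elim e fun v => h v)
    have hze : dotProduct z e = 0 := hz none
    have hzZ : ∀ v ∈ Z, dotProduct z (h v) = 0 := fun v hv => hz (some ⟨v, hv⟩)
    obtain ⟨v₀, hv₀V, hv₀⟩ : ∃ v ∈ V, dotProduct z (h v) ≠ 0 := by
      by_contra! hcon
      refine hz0 (Matrix.eq_zero_of_mulVec_eq_zero (M := Matrix.of (h ∘ t)) ht ?_)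
      ext i
      have := hcon _ (htV i)
      rw [dotProduct_comm] at this
      simpa [Matrix.mulVec] using this
    obtain ⟨z, hze, hzZ, v₀, hv₀V, hv₀⟩ : ∃ z : Fin D → ℝ, dotProduct z e = 0 ∧
        (∀ v ∈ Z, dotProduct z (h v) = 0) ∧ ∃ v ∈ V, dotProduct z (h v) < 0 := by
      rcases lt_or_gt_of_ne hv₀ with h1 | h1
      · exact ⟨z, hze, hzZ, v₀, hv₀V, h1⟩
      · exact ⟨-z, by simpa using hze, fun v hv => by simpa using hzZ v hv, v₀, hv₀V,
          by simpa using h1⟩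
    -- The minimum ratio says which vector the rotating hyperplane meets first.
    obtain ⟨v₁, hv₁, hmin⟩ := Finset.exists_min_image
      (V.filter fun v => dotProduct z (h v) < 0)
      (fun v => dotProduct y (h v) / -dotProduct z (h v)) ⟨v₀, by simp [hv₀V, hv₀]⟩
    rw [Finset.mem_filter] at hv₁
    set θ := dotProduct y (h v₁) / -dotProduct z (h v₁) with hθ
    have hθ0 : 0 ≤ θ := div_nonneg (hy _ hv₁.1) (by linarith [hv₁.2])
    have hev : ∀ x, dotProduct (y + θ • z) x = dotProduct y x + θ * dotProduct z x := by
      intro x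
      rw [add_dotProduct, smul_dotProduct, smul_eq_mul]
    have hv₁0 : dotProduct (y + θ • z) (h v₁) = 0 := by
      rw [hev, hθ, div_neg, neg_mul, div_mul_cancel₀ _ hv₁.2.ne, add_neg_cancel]
    refine ⟨y + θ • z, fun v hv => ?_, by rw [hev, hze]; simpa using hye, ?_⟩
    · rw [hev]
      rcases lt_or_ge (dotProduct z (h v)) 0 with h1 | h1
      · have h2 := hmin v (by simp [hv, h1])
        rw [le_div_iff₀ (by linarith)] at h2
        linarith
      · exact add_nonneg (hy v hv) (mul_nonneg hθ0 h1)
    · have hsub : insert v₁ Z ⊆ V.filter fun v => dotProduct (y + θ • z) (h v) = 0 := by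
        intro v hv
        rw [Finset.mem_insert] at hv
        rw [Finset.mem_filter]
        rcases hv with rfl | hv
        · exact ⟨hv₁.1, hv₁0⟩
        · refine ⟨(Finset.mem_filter.1 hv).1, ?_⟩
          rw [hev, (Finset.mem_filter.1 hv).2, hzZ v hv]
          simp
      have hnot : v₁ ∉ Z := fun hmem => hv₁.2.ne (hzZ _ hmem)
      have := Finset.card_le_card hsub
      rw [Finset.card_insert_of_notMem hnot] at this
      omega

/-- If no simplex with vertices in `V` contains `q`, then `d` points of `V` span a hyperplane that
separates `q` from `V`. In terms of determinants: `b` and no `x ∈ V` lies on the side of `q`. -/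
theorem exists_separating_tuple {n : ℕ} {p : Fin n → EuclideanSpace ℝ (Fin d)}
    {q : EuclideanSpace ℝ (Fin d)}
    (H₁ : ∀ t : Fin (d + 1) → Fin n, Injective t → rowDet ((homog ∘ p) ∘ t) ≠ 0)
    (H₂ : ∀ t : Fin (d + 1) → Fin n, Injective t → ∀ k,
      rowDet (update ((homog ∘ p) ∘ t) k (homog q)) ≠ 0)
    (hp : Injective p) {V : Finset (Fin n)} (hV : d + 1 ≤ V.card)
    (hno : ∀ t : Fin (d + 1) → Fin n, (∀ k, t k ∈ V) → ¬ Feasible (homog ∘ p) (homog q) t) :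
    ∃ b : Fin d → Fin n, (∀ k, b k ∈ V) ∧
      rowDet (Fin.cons (homog q) ((homog ∘ p) ∘ b)) ≠ 0 ∧
      ∀ x ∈ V, rowDet (Fin.cons ((homog ∘ p) x) ((homog ∘ p) ∘ b)) *
        rowDet (Fin.cons (homog q) ((homog ∘ p) ∘ b)) ≤ 0 := by
  classical
  have enum : ∀ (W : Finset (Fin n)) (m : ℕ), W.card = m →
      ∃ t : Fin m → Fin n, Injective t ∧ Finset.univ.image t = W := by
    intro W m hW
    have h1 := card_injective_image_eq W hW
    have h2 : 0 < Fintype.card {t : Fin m → Fin n // Injective t ∧ Finset.univ.image t = W} := by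
      rw [h1]; exact Nat.factorial_pos _
    obtain ⟨t⟩ := Fintype.card_pos_iff.1 h2
    exact ⟨t.1, t.2⟩
  have hq : q ∉ convexHull ℝ (p '' V) := by
    intro hmem
    -- By Carathéodory's theorem `q` is in a simplex with at most `d + 1` vertices, and further
    -- vertices may be added.
    rw [convexHull_eq_union] at hmem
    simp only [Set.mem_iUnion, exists_prop] at hmem
    obtain ⟨T, hTV, hTi, hqT⟩ := hmem
    have hTc : T.card ≤ d + 1 := by
      have h1 := hTi.card_le_finrank_succ
      have h2 := Submodule.finrank_le
        (vectorSpan ℝ (Set.range ((↑) : T → EuclideanSpace ℝ (Fin d))))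
      rw [finrank_euclideanSpace_fin] at h2
      rw [Fintype.card_coe] at h1
      omega
    have hTV' : T ⊆ V.image p := by
      intro x hx
      simpa using hTV hx
    obtain ⟨T', hTT', hT'V, hT'c⟩ := Finset.exists_subsuperset_card_eq hTV' hTc
      (by rwa [Finset.card_image_of_injective _ hp])
    obtain ⟨W, hWV, rfl⟩ := Finset.subset_image_iff.1 hT'V
    rw [Finset.card_image_of_injective _ hp] at hT'c
    obtain ⟨t, hti, htW⟩ := enum W _ hT'c
    refine hno t (fun k => hWV (by rw [← htW]; simp)) ((feasible_homog_iff H₁).2 ⟨hti, ?_⟩)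
    refine convexHull_mono ?_ hqT
    intro x hx
    have h3 := hTT' hx
    rw [← htW, Finset.image_image] at h3
    simpa using h3
  obtain ⟨f, u, hfq, hfV⟩ := geometric_hahn_banach_point_closed (convex_convexHull ℝ (p '' V))
    ((V.finite_toSet.image p).isClosed_convexHull ℝ) hq
  obtain ⟨g, rfl⟩ := (InnerProductSpace.toDual ℝ (EuclideanSpace ℝ (Fin d))).surjective f
  -- In homogeneous coordinates the affine functional `g - u` is linear.
  have hdot : ∀ x, dotProduct (Fin.snoc (α := fun _ => ℝ) (fun j => g j) (-u)) (homog x) =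
      InnerProductSpace.toDual ℝ (EuclideanSpace ℝ (Fin d)) g x - u := by
    intro x
    rw [InnerProductSpace.toDual_apply_apply, PiLp.inner_apply]
    simp only [dotProduct, homog, Fin.sum_univ_castSucc, Fin.snoc_castSucc, Fin.snoc_last]
    simp [sub_eq_add_neg, mul_comm]
  obtain ⟨W, hWV, hWc⟩ := Finset.exists_subset_card_eq hV
  obtain ⟨t, hti, htW⟩ := enum W _ hWc
  have htV : ∀ k, t k ∈ V := fun k => hWV (by rw [← htW]; simp)
  obtain ⟨y, hyV, hye, hycard⟩ := exists_separating_vanishing (h := homog ∘ p) (e := homog q)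
    htV (H₁ t hti) (y := Fin.snoc (α := fun _ => ℝ) (fun j => g j) (-u))
    (fun v hv => by
      have := hfV (p v) (subset_convexHull ℝ _ ⟨v, hv, rfl⟩)
      rw [comp_apply, hdot]
      linarith)
    (by rw [hdot]; linarith) (k := d) le_rfl
  obtain ⟨Z, hZ, hZc⟩ := Finset.exists_subset_card_eq hycard
  obtain ⟨b, hbi, hbZ⟩ := enum Z _ hZc
  have hbmem : ∀ k, b k ∈ V ∧ dotProduct y (homog (p (b k))) = 0 := fun k => by
    have : b k ∈ Z := by rw [← hbZ]; simp
    exact Finset.mem_filter.1 (hZ this)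
  obtain ⟨x₀, hx₀V, hx₀⟩ : ∃ x ∈ V, x ∉ Z := by
    by_contra! hcon
    have := Finset.card_le_card hcon
    omega
  have hE : rowDet (Fin.cons (homog q) ((homog ∘ p) ∘ b)) ≠ 0 := by
    have h1 := H₂ (Fin.cons x₀ b) (by
      rw [Fin.cons_injective_iff]
      refine ⟨?_, hbi⟩
      rintro ⟨k, hk⟩
      exact hx₀ (by rw [← hk, ← hbZ]; simp)) 0
    rwa [comp_cons, update_zero_cons] at h1
  refine ⟨b, fun k => (hbmem k).1, hE, fun x hx => ?_⟩
  -- Cramer's rule: the determinant is a multiple of the functional `y`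
  have h2 := congrArg (dotProduct y) (rowDet_smul_eq_sum
    (Fin.cons (homog q) ((homog ∘ p) ∘ b)) ((homog ∘ p) x))
  rw [Fin.sum_univ_succ, dotProduct_add, dotProduct_sum, Finset.sum_eq_zero, add_zero,
    update_zero_cons, dotProduct_smul, dotProduct_smul, Fin.cons_zero, smul_eq_mul,
    smul_eq_mul] at h2
  · have h3 := hyV x hx
    by_contra! h4
    have h5 : rowDet (Fin.cons ((homog ∘ p) x) ((homog ∘ p) ∘ b)) *
        rowDet (Fin.cons (homog q) ((homog ∘ p) ∘ b)) * dotProduct y (homog q) < 0 :=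
      mul_neg_of_pos_of_neg h4 hye
    have h6 := mul_nonneg (mul_self_nonneg (rowDet (Fin.cons (homog q) ((homog ∘ p) ∘ b)))) h3
    rw [mul_assoc, h2] at h6
    linarith
  · intro k _
    rw [dotProduct_smul, Fin.cons_succ]
    exact (congrArg _ (hbmem k).2).trans (smul_zero _)

/-- A simplex that contains `q` has a vertex strictly on the side of `q` of any hyperplane that does
not contain `q`. -/
theorem exists_vertex_on_side {h : ι → Fin (d + 1) → ℝ} {e : Fin (d + 1) → ℝ}
    {t : Fin (d + 1) → ι} (ht : Feasible h e t) {b : Fin d → ι}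
    (hb : rowDet (Fin.cons e (h ∘ b)) ≠ 0) :
    ∃ k, 0 < rowDet (Fin.cons (h (t k)) (h ∘ b)) * rowDet (Fin.cons e (h ∘ b)) := by
  have h1 := feasible_iff_coord.1 ht
  -- expand `e` in the basis of the simplex
  have h2 : rowDet (Fin.cons e (h ∘ b)) =
      ∑ k, coord h t e k * rowDet (Fin.cons (h (t k)) (h ∘ b)) := by
    have h3 : ∀ x, rowDet (Fin.cons x (h ∘ b)) =
        Matrix.detRowAlternating
          (update (Fin.cons e (h ∘ b) : Fin (d + 1) → Fin (d + 1) → ℝ) 0 x) :=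
      fun x => by rw [update_zero_cons]; rfl
    conv_lhs => rw [← sum_coord h1.1 e, h3]
    rw [AlternatingMap.map_update_sum]
    refine Finset.sum_congr rfl fun k _ => ?_
    rw [AlternatingMap.map_update_smul, h3, smul_eq_mul]
  by_contra! hcon
  have h4 : rowDet (Fin.cons e (h ∘ b)) * rowDet (Fin.cons e (h ∘ b)) ≤ 0 := by
    conv_lhs => enter [1]; rw [h2]
    rw [Finset.sum_mul]
    refine Finset.sum_nonpos fun k _ => ?_
    rw [mul_assoc]
    exact mul_nonpos_of_nonneg_of_nonpos (h1.2 k) (hcon k)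
  exact absurd h4 (not_le.2 (mul_self_pos.2 hb))

end FeasibleBasis

/-! ### Tail bounds for independent uniform draws -/

namespace UniformDraws

variable {Ω : Type*} [Fintype Ω] {M : ℕ}

/-- The exponential moment method: if the product of the nonnegative functions `f i` of the draws
is at least `exp a` on the event `S`, then `S` is as rare as the moments of the factors say. -/
theorem card_le_of_exp_le_prod [DecidableEq Ω] (S : Finset (Fin M → Ω)) (f : Fin M → Ω → ℝ)
    (g : Fin M → ℝ) (a : ℝ) (hf : ∀ i ω, 0 ≤ f i ω)
    (hg : ∀ i, ∑ ω, f i ω ≤ Fintype.card Ω * Real.exp (g i))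
    (hS : ∀ ρ ∈ S, Real.exp a ≤ ∏ i, f i (ρ i)) :
    (S.card : ℝ) ≤ (Fintype.card Ω : ℝ) ^ M * Real.exp (∑ i, g i - a) := by
  have h1 : (S.card : ℝ) * Real.exp a ≤ (Fintype.card Ω : ℝ) ^ M * Real.exp (∑ i, g i) :=
    calc (S.card : ℝ) * Real.exp a = ∑ ρ ∈ S, Real.exp a := by simp
      _ ≤ ∑ ρ ∈ S, ∏ i, f i (ρ i) := Finset.sum_le_sum hS
      _ ≤ ∑ ρ : Fin M → Ω, ∏ i, f i (ρ i) :=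
        Finset.sum_le_sum_of_subset_of_nonneg (Finset.subset_univ _) fun ρ _ _ =>
          Finset.prod_nonneg fun i _ => hf i _
      _ = ∏ i, ∑ ω, f i ω := by
        rw [Finset.prod_univ_sum, Fintype.piFinset_univ]
      _ ≤ ∏ i, (Fintype.card Ω * Real.exp (g i)) :=
        Finset.prod_le_prod (fun i _ => Finset.sum_nonneg fun ω _ => hf i ω) fun i _ => hg i
      _ = (Fintype.card Ω : ℝ) ^ M * Real.exp (∑ i, g i) := by
        rw [Finset.prod_mul_distrib, Real.exp_sum]; simp
  rw [sub_eq_add_neg, Real.exp_add, Real.exp_neg, ← mul_assoc]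
  exact (le_mul_inv_iff₀ (Real.exp_pos _)).2 h1

variable [Nonempty Ω] [DecidableEq Ω] (A : Finset Ω)

/-- The number of draws that hit `A`. -/
def hits (ρ : Fin M → Ω) : ℕ := (Finset.univ.filter fun i => ρ i ∈ A).card

/-- The expected number of draws that hit `A`. -/
noncomputable def mean (M : ℕ) : ℝ := M * (A.card / Fintype.card Ω)

/-- The exponential moment method for the number of hits. A positive `l` yields upper tails and a
negative `l` yields lower tails. -/
theorem card_exp_hits_le (l a : ℝ) (S : Finset (Fin M → Ω))
    (hS : ∀ ρ ∈ S, a ≤ l * hits A ρ) :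
    (S.card : ℝ) ≤ (Fintype.card Ω : ℝ) ^ M *
      Real.exp (mean A M * (Real.exp l - 1) - a) := by
  have hN : (0 : ℝ) < Fintype.card Ω := by exact_mod_cast Fintype.card_pos
  have h := card_le_of_exp_le_prod S (fun _ ω => if ω ∈ A then Real.exp l else 1)
    (fun _ => A.card / Fintype.card Ω * (Real.exp l - 1)) a
    (fun _ ω => by split_ifs <;> positivity) (fun _ => ?_) (fun ρ hρ => ?_)
  · convert h using 3
    simp [mean]; ring
  · have h1 : ∑ ω, (if ω ∈ A then Real.exp l else 1) =
        Fintype.card Ω * (A.card / Fintype.card Ω * (Real.exp l - 1) + 1) := by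
      have h2 : ∀ ω, (if ω ∈ A then Real.exp l else 1) =
          (if ω ∈ A then Real.exp l - 1 else 0) + 1 := fun ω => by split_ifs <;> ring
      simp only [h2, Finset.sum_add_distrib, Finset.sum_ite_mem, Finset.univ_inter,
        Finset.sum_const, nsmul_eq_mul, Finset.card_univ]
      field_simp
    rw [h1]
    exact mul_le_mul_of_nonneg_left (Real.add_one_le_exp _) hN.le
  · have h1 : ∏ i, (if ρ i ∈ A then Real.exp l else 1) = Real.exp (l * hits A ρ) := by
      rw [Finset.prod_ite, Finset.prod_const_one, mul_one, Finset.prod_const, ← Real.exp_nat_mul,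
        hits, mul_comm]
    rw [h1]
    exact Real.exp_le_exp.2 (hS ρ hρ)

/-- The multiplicative Chernoff bound. -/
theorem card_hits_not_relApprox_le {ε : ℝ} (hε : 0 < ε) (S : Finset (Fin M → Ω))
    (hS : ∀ ρ ∈ S, ¬ (mean A M / (1 + ε) ≤ hits A ρ ∧ (hits A ρ : ℝ) ≤ (1 + ε) * mean A M)) :
    (S.card : ℝ) ≤ (Fintype.card Ω : ℝ) ^ M *
      (2 * Real.exp (-(mean A M * (ε / (2 * (1 + ε))) ^ 2))) := by
  classical
  -- For this `t` one has `1 / (1 + ε) = 1 - 2 * t` and `2 * t ≤ ε`, and `l = t` and `l = -t` are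
  -- good enough exponents for the two tails, as `|exp l - 1 - l| ≤ l ^ 2`.
  set t := ε / (2 * (1 + ε)) with ht
  have hμ : 0 ≤ mean A M := by unfold mean; positivity
  have h1ε : 0 < 1 + ε := by linarith
  have ht0 : 0 < t := by positivity
  have ht2 : 2 * t * (1 + ε) = ε := by rw [ht]; field_simp
  have ht1 : t ≤ 1 := by nlinarith
  have h3 : (1 + ε)⁻¹ = 1 - 2 * t := by
    rw [inv_eq_one_div, div_eq_iff h1ε.ne']; linarith
  have hup := Real.abs_exp_sub_one_sub_id_le (x := t) (by rw [abs_of_pos ht0]; exact ht1)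
  have hlo := Real.abs_exp_sub_one_sub_id_le (x := -t) (by rw [abs_neg, abs_of_pos ht0]; exact ht1)
  rw [abs_le] at hup hlo
  have h1 := card_exp_hits_le A t (t * ((1 + ε) * mean A M))
    (S.filter fun ρ => (1 + ε) * mean A M ≤ hits A ρ)
    fun ρ hρ => mul_le_mul_of_nonneg_left (Finset.mem_filter.1 hρ).2 ht0.le
  have h2 := card_exp_hits_le A (-t) (-t * (mean A M / (1 + ε)))
    (S.filter fun ρ => (hits A ρ : ℝ) ≤ mean A M / (1 + ε))
    fun ρ hρ => mul_le_mul_of_nonpos_left (Finset.mem_filter.1 hρ).2 (by linarith)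
  have hcov : S ⊆ (S.filter fun ρ => (1 + ε) * mean A M ≤ hits A ρ) ∪
      (S.filter fun ρ => (hits A ρ : ℝ) ≤ mean A M / (1 + ε)) := by
    intro ρ hρ
    rw [Finset.mem_union, Finset.mem_filter, Finset.mem_filter]
    have := hS ρ hρ
    rw [not_and_or, not_le, not_le] at this
    rcases this with h | h
    · exact Or.inr ⟨hρ, h.le⟩
    · exact Or.inl ⟨hρ, h.le⟩
  have hcard : (S.card : ℝ) ≤ (S.filter fun ρ => (1 + ε) * mean A M ≤ hits A ρ).card +
      (S.filter fun ρ => (hits A ρ : ℝ) ≤ mean A M / (1 + ε)).card := by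
    exact_mod_cast (Finset.card_le_card hcov).trans (Finset.card_union_le _ _)
  have e1 : Real.exp (mean A M * (Real.exp t - 1) - t * ((1 + ε) * mean A M)) ≤
      Real.exp (-(mean A M * t ^ 2)) := by
    refine Real.exp_le_exp.2 ?_
    have : Real.exp t - 1 - t * (1 + ε) ≤ -t ^ 2 := by nlinarith
    nlinarith
  have e2 : Real.exp (mean A M * (Real.exp (-t) - 1) - -t * (mean A M / (1 + ε))) ≤
      Real.exp (-(mean A M * t ^ 2)) := by
    refine Real.exp_le_exp.2 ?_
    rw [div_eq_mul_inv, h3]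
    have : Real.exp (-t) - 1 + t * (1 - 2 * t) ≤ -t ^ 2 := by nlinarith
    nlinarith
  have hpow : (0 : ℝ) ≤ (Fintype.card Ω : ℝ) ^ M := by positivity
  have := mul_le_mul_of_nonneg_left e1 hpow
  have := mul_le_mul_of_nonneg_left e2 hpow
  linarith

/-- The first `r` draws miss a set `A` with probability at most `exp (-r |A| / |Ω|)`. -/
theorem card_miss_le {r : ℕ} (hr : r ≤ M) (S : Finset (Fin M → Ω))
    (hS : ∀ ρ ∈ S, ∀ i : Fin M, (i : ℕ) < r → ρ i ∉ A) :
    (S.card : ℝ) ≤ (Fintype.card Ω : ℝ) ^ M *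
      Real.exp (-(r * (A.card / Fintype.card Ω))) := by
  have hN : (0 : ℝ) < Fintype.card Ω := by exact_mod_cast Fintype.card_pos
  have h := card_le_of_exp_le_prod S (fun i ω => if (i : ℕ) < r ∧ ω ∈ A then 0 else 1)
    (fun i => if (i : ℕ) < r then -(A.card / Fintype.card Ω : ℝ) else 0) 0
    (fun _ ω => by split_ifs <;> positivity) (fun i => ?_) (fun ρ hρ => ?_)
  · convert h using 3
    have : (Finset.univ.filter fun i : Fin M => (i : ℕ) < r).card = r := by
      rw [Fin.card_filter_val_lt, min_eq_right hr]
    rw [Finset.sum_ite, Finset.sum_const, this]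
    simp
  · by_cases hi : (i : ℕ) < r
    · have h1 : ∑ ω, (if (i : ℕ) < r ∧ ω ∈ A then (0 : ℝ) else 1) =
          Fintype.card Ω * (-(A.card / Fintype.card Ω) + 1) := by
        have h2 : ∀ ω, (if (i : ℕ) < r ∧ ω ∈ A then (0 : ℝ) else 1) =
            (if ω ∈ A then -1 else 0) + 1 := fun ω => by
          simp only [hi, true_and]; split_ifs <;> ring
        simp only [h2, Finset.sum_add_distrib, Finset.sum_ite_mem, Finset.univ_inter,
          Finset.sum_const, nsmul_eq_mul, Finset.card_univ]
        field_simp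
      rw [h1, if_pos hi]
      exact mul_le_mul_of_nonneg_left (Real.add_one_le_exp _) hN.le
    · simp [hi]
  · rw [Real.exp_zero, Finset.prod_eq_one]
    intro i _
    rw [if_neg]
    rintro ⟨h1, h2⟩
    exact hS ρ hρ i h1 h2

end UniformDraws

/-! ### Expressions and tests for determinants -/

namespace RealRAM

open FeasibleBasis

/-- The number of points. It is an integer variable, which means that it has an integer array of its
own, of which it occupies cell `0`. -/
abbrev vn : ℕ := 0
/-- The power of two `r` with `n ≤ r ^ 2`. -/
abbrev vr : ℕ := 1
/-- The logarithm of `r`, plus one. -/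
abbrev vlog : ℕ := 2
/-- A loop counter. -/
abbrev vi : ℕ := 3
/-- The loop counter of the rounds. -/
abbrev vround : ℕ := 4
/-- The loop counter over tuples of candidates. -/
abbrev vj : ℕ := 5
/-- The loop counter over single candidates. -/
abbrev vx : ℕ := 6
/-- The number of random simplices that contain `q`. -/
abbrev vhits : ℕ := 7
/-- The length of the queue. -/
abbrev vtail : ℕ := 8
/-- The number of candidates. -/
abbrev vcand : ℕ := 9
/-- One more than the code of a separating tuple, or zero. -/
abbrev vsep : ℕ := 10
/-- A flag. -/
abbrev vok : ℕ := 11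
/-- The code of a tuple. -/
abbrev vc : ℕ := 12
/-- The array of random numbers. -/
abbrev arand : ℕ := 20
/-- The array of candidates. -/
abbrev acand : ℕ := 21
/-- The array that marks the codes in the queue. -/
abbrev amark : ℕ := 22
/-- The queue. -/
abbrev aqueue : ℕ := 23

/-- A power with constant exponent. -/
def powE (e : NatExpr) : ℕ → NatExpr
  | 0 => .lit 1
  | k + 1 => .mul (powE e k) e

@[simp] theorem eval_powE (s : State) (e : NatExpr) (k : ℕ) :
    (powE e k).eval s = e.eval s ^ k := by
  induction k with
  | zero => rfl
  | succ k ih => simp [powE, NatExpr.eval, ih, pow_succ]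

/-- The `k`-th digit of `c` in base `b`. -/
def digitE (b c : NatExpr) (k : ℕ) : NatExpr :=
  .mod (.div c (powE b k)) b

@[simp] theorem eval_digitE (s : State) (b c : NatExpr) (k : ℕ) :
    (digitE b c k).eval s = c.eval s / b.eval s ^ k % b.eval s := by
  simp [digitE, NatExpr.eval]

/-- The number with the base `b` digits `f 0, …, f (m - 1)`. -/
def encodeE (b : NatExpr) (f : ℕ → NatExpr) : ℕ → NatExpr
  | 0 => .lit 0
  | m + 1 => .add (encodeE b f m) (.mul (f m) (powE b m))

@[simp] theorem eval_encodeE (s : State) (b : NatExpr) (f : ℕ → NatExpr) (m : ℕ) :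
    (encodeE b f m).eval s = ∑ k ∈ Finset.range m, (f k).eval s * b.eval s ^ k := by
  induction m with
  | zero => rfl
  | succ m ih => simp [encodeE, NatExpr.eval, ih, Finset.sum_range_succ]

/-- The sum of a list of real expressions. -/
def sumE : List RealExpr → RealExpr
  | [] => .ofNat (.lit 0)
  | e :: l => .add e (sumE l)

theorem eval_sumE (s : State) (l : List RealExpr) :
    (sumE l).eval s = (l.map (RealExpr.eval s)).sum := by
  induction l with
  | nil => simp [sumE, RealExpr.eval, NatExpr.eval]
  | cons e l ih => simp [sumE, RealExpr.eval, ih]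

theorem eval_sumE_ofFn (s : State) {m : ℕ} (f : Fin m → RealExpr) :
    (sumE (List.ofFn f)).eval s = ∑ i, (f i).eval s := by
  rw [eval_sumE, List.map_ofFn, List.sum_ofFn]; rfl

/-- The expression `(-1) ^ j`. -/
def signE (j : ℕ) : RealExpr :=
  if Even j then .ofNat (.lit 1) else .sub (.ofNat (.lit 0)) (.ofNat (.lit 1))

theorem eval_signE (s : State) (j : ℕ) : (signE j).eval s = (-1) ^ j := by
  unfold signE
  split_ifs with h
  · simp [RealExpr.eval, NatExpr.eval, h.neg_one_pow]
  · simp [RealExpr.eval, NatExpr.eval, (Nat.not_even_iff_odd.1 h).neg_one_pow]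

/-- The Laplace expansion of a determinant. -/
def detE : (m : ℕ) → (Fin m → Fin m → RealExpr) → RealExpr
  | 0, _ => .ofNat (.lit 1)
  | m + 1, A => sumE (List.ofFn fun j : Fin (m + 1) =>
      .mul (.mul (signE j) (A 0 j)) (detE m fun i k => A i.succ (j.succAbove k)))

theorem eval_detE (s : State) {m : ℕ} (A : Fin m → Fin m → RealExpr) :
    (detE m A).eval s = rowDet fun i j => (A i j).eval s := by
  induction m with
  | zero => simp [detE, RealExpr.eval, NatExpr.eval, rowDet]
  | succ m ih =>
    rw [detE, eval_sumE_ofFn, rowDet, Matrix.det_succ_row_zero]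
    refine Finset.sum_congr rfl fun j _ => ?_
    simp only [RealExpr.eval, ih, eval_signE]
    rfl

/-- The homogeneous coordinates of the point with index `i`. -/
def pointE (d : ℕ) (i : NatExpr) : Fin (d + 1) → RealExpr :=
  Fin.snoc (α := fun _ => RealExpr)
    (fun j => .load 1 (.add (.mul (.lit d) i) (.lit j))) (.ofNat (.lit 1))

/-- The homogeneous coordinates of the query point. -/
def queryE (d : ℕ) : Fin (d + 1) → RealExpr :=
  Fin.snoc (α := fun _ => RealExpr) (fun j => .load 0 (.lit j)) (.ofNat (.lit 1))

/-- The rows of the matrix of the tuple with code `c`. -/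
def tupleE (d : ℕ) (c : NatExpr) : Fin (d + 1) → Fin (d + 1) → RealExpr :=
  fun k => pointE d (digitE (var vn) c k)

/-- The determinant of the tuple with code `c`. -/
def basisDetE (d : ℕ) (c : NatExpr) : RealExpr :=
  detE (d + 1) (tupleE d c)

/-- The determinant of the tuple with code `c` in which the `k`-th point is replaced by `q`. -/
def replacedDetE (d : ℕ) (c : NatExpr) (k : Fin (d + 1)) : RealExpr :=
  detE (d + 1) (Function.update (tupleE d c) k (queryE d))

/-- The constant zero. -/
def zeroE : RealExpr := .ofNat (.lit 0)

/-- The conjunction of a list of tests. -/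
def allT : List Test → Test
  | [] => .natLe (.lit 0) (.lit 0)
  | t :: l => .both t (allT l)

theorem holds_allT (s : State) (l : List Test) : (allT l).holds s ↔ ∀ t ∈ l, t.holds s := by
  induction l with
  | nil => simp [allT, Test.holds]
  | cons t l ih => simp [allT, Test.holds, ih]

/-- Does the simplex with code `c` contain `q`? -/
def feasibleT (d : ℕ) (c : NatExpr) : Test :=
  .both (.neg (.realLe (.mul (basisDetE d c) (basisDetE d c)) zeroE))
    (allT (List.ofFn fun k => .realLe zeroE (.mul (basisDetE d c) (replacedDetE d c k))))

/-- Does the first point of the tuple with code `c` lie strictly on the side of `q` of the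
hyperplane spanned by the other points? -/
def sideT (d : ℕ) (c : NatExpr) : Test :=
  .neg (.realLe (.mul (basisDetE d c) (replacedDetE d c 0)) zeroE)

/-- Do the points of the tuple with code `c`, except for the first one, span a hyperplane that does
not contain `q`? -/
def spanT (d : ℕ) (c : NatExpr) : Test :=
  .neg (.realLe (.mul (replacedDetE d c 0) (replacedDetE d c 0)) zeroE)

/-- Is `q` the point with index `i`? -/
def equalT (d : ℕ) (i : NatExpr) : Test :=
  .realLe (sumE (List.ofFn fun j : Fin (d + 1) =>
    .mul (.sub (pointE d i j) (queryE d j)) (.sub (pointE d i j) (queryE d j)))) zeroE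

/-- The tuple with code `c`. -/
def digits (n m c : ℕ) [NeZero n] : Fin m → Fin n :=
  fun k => ⟨c / n ^ (k : ℕ) % n, Nat.mod_lt _ (NeZero.pos n)⟩

/-- The code of a tuple. -/
def encode {n m : ℕ} (t : Fin m → Fin n) : ℕ :=
  ∑ k, (t k : ℕ) * n ^ (k : ℕ)

theorem encode_lt {n m : ℕ} (t : Fin m → Fin n) : encode t < n ^ m :=
  (finFunctionFinEquiv t).2

theorem digits_encode {n m : ℕ} [NeZero n] (t : Fin m → Fin n) : digits n m (encode t) = t :=
  finFunctionFinEquiv.symm_apply_apply t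

theorem encode_digits {n m c : ℕ} [NeZero n] (hc : c < n ^ m) : encode (digits n m c) = c :=
  congrArg Fin.val (finFunctionFinEquiv.apply_symm_apply ⟨c, hc⟩)

/-- The tuples `Fin m → Fin n` are in bijection with the numbers below `n ^ m`. -/
def digitsEquiv (n m : ℕ) [NeZero n] : Fin (n ^ m) ≃ (Fin m → Fin n) where
  toFun c := digits n m c
  invFun t := ⟨encode t, encode_lt t⟩
  left_inv c := Fin.ext (encode_digits c.2)
  right_inv t := digits_encode t

variable {n d : ℕ} {p : Fin n → EuclideanSpace ℝ (Fin d)}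
  {q : EuclideanSpace ℝ (Fin d)} {s : State}

/-- The memory still contains the input. -/
def HasInput (p : Fin n → EuclideanSpace ℝ (Fin d)) (q : EuclideanSpace ℝ (Fin d)) (s : State) :
    Prop :=
  s.nat vn 0 = n ∧ s.real = (inputState p q).real

theorem eval_pointE (hs : HasInput p q s) {e : NatExpr} {i : Fin n} (he : e.eval s = i) :
    (fun j => (pointE d e j).eval s) = homog (p i) := by
  funext j
  refine Fin.lastCases ?_ (fun j => ?_) j
  · simp [pointE, homog, RealExpr.eval, NatExpr.eval]
  · simp only [pointE, homog, Fin.snoc_castSucc, RealExpr.eval, NatExpr.eval, he, hs.2]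
    have h1 : d * (i : ℕ) + j = (finProdFinEquiv (i, j) : ℕ) := by
      simp [finProdFinEquiv]; ring
    have h2 : d * (i : ℕ) + j < n * d := by rw [h1]; exact (finProdFinEquiv (i, j)).2
    have h3 : (⟨d * (i : ℕ) + j, h2⟩ : Fin (n * d)) = finProdFinEquiv (i, j) := Fin.ext h1
    simp only [inputState, one_ne_zero, if_false, if_true, dif_pos h2, h3,
      Equiv.symm_apply_apply]

theorem eval_queryE (hs : HasInput p q s) : (fun j => (queryE d j).eval s) = homog q := by
  funext j
  refine Fin.lastCases ?_ (fun j => ?_) j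
  · simp [queryE, homog, RealExpr.eval, NatExpr.eval]
  · simp only [queryE, homog, Fin.snoc_castSucc, RealExpr.eval, NatExpr.eval, hs.2]
    simp [inputState]

theorem eval_zeroE (s : State) : zeroE.eval s = 0 := by
  simp [zeroE, RealExpr.eval, NatExpr.eval]

theorem homog_injective : Function.Injective (homog (d := d)) := by
  intro x y h
  ext j
  have := congrFun h j.castSucc
  simpa [homog] using this

/-- The test compares the squared distance of the two points with zero. -/
theorem holds_equalT (hs : HasInput p q s) {e : NatExpr} {i : Fin n} (he : e.eval s = i) :
    (equalT d e).holds s ↔ p i = q := by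
  have h1 := eval_pointE hs he
  have h2 := eval_queryE hs
  simp only [equalT, Test.holds, eval_sumE_ofFn, eval_zeroE, RealExpr.eval]
  have h3 : ∀ j, ((pointE d e j).eval s - (queryE d j).eval s) *
      ((pointE d e j).eval s - (queryE d j).eval s) =
      (homog (p i) j - homog q j) * (homog (p i) j - homog q j) := fun j => by
    rw [← congrFun h1 j, ← congrFun h2 j]
  simp only [h3]
  rw [← homog_injective.eq_iff]
  constructor
  · intro h
    have h4 := (Finset.sum_eq_zero_iff_of_nonneg fun j _ => mul_self_nonneg _).1
      (le_antisymm h (Finset.sum_nonneg fun j _ => mul_self_nonneg (homog (p i) j - homog q j)))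
    funext j
    exact sub_eq_zero.1 (mul_self_eq_zero.1 (h4 j (Finset.mem_univ j)))
  · intro h
    simp [h]

variable [NeZero n]

theorem eval_tupleE (hs : HasInput p q s) (c : NatExpr) (k : Fin (d + 1)) :
    (fun j => (tupleE d c k j).eval s) = homog (p (digits n (d + 1) (c.eval s) k)) := by
  refine eval_pointE hs ?_
  simp [NatExpr.eval, hs.1, digits]

theorem eval_basisDetE (hs : HasInput p q s) (c : NatExpr) :
    (basisDetE d c).eval s = rowDet ((homog ∘ p) ∘ digits n (d + 1) (c.eval s)) := by
  rw [basisDetE, eval_detE]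
  congr 1
  exact funext fun k => eval_tupleE hs c k

theorem eval_replacedDetE (hs : HasInput p q s) (c : NatExpr) (k : Fin (d + 1)) :
    (replacedDetE d c k).eval s =
      rowDet (Function.update ((homog ∘ p) ∘ digits n (d + 1) (c.eval s)) k (homog q)) := by
  rw [replacedDetE, eval_detE]
  congr 1
  funext i
  by_cases hi : i = k
  · subst hi
    simp only [Function.update_self]
    exact eval_queryE hs
  · simp only [Function.update_of_ne hi]
    exact eval_tupleE hs c i

theorem holds_feasibleT (hs : HasInput p q s) (c : NatExpr) :
    (feasibleT d c).holds s ↔ Feasible (homog ∘ p) (homog q) (digits n (d + 1) (c.eval s)) := by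
  simp only [feasibleT, Test.holds, holds_allT, List.forall_mem_ofFn_iff, RealExpr.eval,
    eval_basisDetE hs, eval_replacedDetE hs, eval_zeroE, Feasible, not_le, mul_self_pos]

theorem holds_sideT (hs : HasInput p q s) (c : NatExpr) :
    (sideT d c).holds s ↔ 0 < rowDet ((homog ∘ p) ∘ digits n (d + 1) (c.eval s)) *
      rowDet (Function.update ((homog ∘ p) ∘ digits n (d + 1) (c.eval s)) 0 (homog q)) := by
  simp only [sideT, Test.holds, RealExpr.eval, eval_basisDetE hs, eval_replacedDetE hs,
    eval_zeroE, not_le]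

theorem holds_spanT (hs : HasInput p q s) (c : NatExpr) :
    (spanT d c).holds s ↔
      rowDet (Function.update ((homog ∘ p) ∘ digits n (d + 1) (c.eval s)) 0 (homog q)) ≠ 0 := by
  simp only [spanT, Test.holds, RealExpr.eval, eval_replacedDetE hs,
    eval_zeroE, not_le, mul_self_pos]

end RealRAM

/-! ### The program -/

namespace RealRAM

open FeasibleBasis

/-- The number of random simplices. -/
def drawsE (d K : ℕ) : NatExpr :=
  .mul (.mul (.lit K) (var vlog)) (powE (var vr) (d + 2))

/-- The largest number of feasible bases that is determined exactly. -/
def capE (d : ℕ) : NatExpr := powE (var vr) d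

/-- The largest number of candidates. -/
def candMaxE (d K : ℕ) : NatExpr :=
  .mul (.mul (.lit ((d + 5) * K)) (var vlog)) (var vr)

/-- Increment a scalar variable. -/
def incr (a : ℕ) : Program := setVar a (.add (var a) (.lit 1))

/-- Compute a power `r` of two with `n ≤ r ^ 2 ≤ 4 n`, and its logarithm plus one. -/
def scaleP : Program :=
  .seq (setVar vr (.lit 1)) (.seq (setVar vlog (.lit 1))
    (.while (.neg (.natLe (var vn) (.mul (var vr) (var vr))))
      (.seq (setVar vr (.mul (var vr) (.lit 2))) (incr vlog))))

/-- Draw the codes of random tuples. -/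
def drawP (d K : ℕ) : Program :=
  drawLoop arand vi (drawsE d K) (.sub (powE (var vn) (d + 1)) (.lit 1))

/-- Count the random tuples that are feasible. -/
def countP (d K : ℕ) : Program :=
  forN vi (drawsE d K) (.ite (feasibleT d (.load arand (var vi))) (incr vhits) .skip)

/-- If `q` is one of the points, then declare the queue to be too long: a length that exceeds the
cap turns off the search and makes the program output the estimate from the random sample. -/
def flagP (d : ℕ) : Program :=
  forN vi (var vn) (.ite (equalT d (var vi)) (setVar vtail (.add (capE d) (.lit 1))) .skip)

/-- The first candidates: some distinct points at even positions, and random points at odd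
positions. The first digits of the random codes serve as the random points. -/
def candP : Program :=
  .seq (forN vi (var vr)
    (.seq (.setNat acand (.mul (.lit 2) (var vi)) (.mod (var vi) (var vn)))
      (.setNat acand (.add (.mul (.lit 2) (var vi)) (.lit 1))
        (.mod (.load arand (var vi)) (var vn)))))
    (setVar vcand (.mul (.lit 2) (var vr)))

/-- Append the code in `vc` to the queue, if it is feasible and new and the queue is not too
long. -/
def pushP (d : ℕ) : Program :=
  .ite (.both (.natLe (.load amark (var vc)) (.lit 0))
      (.both (feasibleT d (var vc)) (.natLe (var vtail) (capE d))))
    (.seq (.setNat amark (var vc) (.lit 1))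
      (.seq (.setNat aqueue (var vtail) (var vc)) (incr vtail)))
    .skip

/-- The code of the `m`-tuple of candidates with number `vj`. -/
def candTupleE (m : ℕ) : NatExpr :=
  encodeE (var vn) (fun k => .load acand (digitE (var vcand) (var vj) k)) m

/-- Find the feasible tuples of candidates. -/
def seedP (d : ℕ) : Program :=
  forN vj (powE (var vcand) (d + 1)) (.seq (setVar vc (candTupleE (d + 1))) (pushP d))

/-- Search for a hyperplane spanned by candidates that has no candidate strictly on the side
of `q`. The code of the last one that has been found is stored in `vsep`, increased by one. -/
def separateP (d : ℕ) : Program :=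
  .seq (setVar vsep (.lit 0)) (forN vj (powE (var vcand) d)
    (.seq (setVar vc (candTupleE d))
      (.seq (.ite (spanT d (.mul (var vn) (var vc))) (setVar vok (.lit 1)) (setVar vok (.lit 0)))
        (.seq (forN vx (var vcand)
          (.ite (sideT d (.add (.load acand (var vx)) (.mul (var vn) (var vc))))
            (setVar vok (.lit 0)) .skip))
          (.ite (.natLe (.lit 1) (var vok)) (setVar vsep (.add (var vc) (.lit 1))) .skip)))))

/-- Append all points on the side of `q` of the hyperplane to the candidates, as long as there is
room. -/
def extendP (d K : ℕ) : Program :=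
  forN vx (var vn)
    (.ite (.both (sideT d (.add (var vx) (.mul (var vn) (.sub (var vsep) (.lit 1)))))
        (.neg (.natLe (candMaxE d K) (var vcand))))
      (.seq (.setNat acand (var vcand) (var vx)) (incr vcand)) .skip)

/-- Find feasible tuples to start from, with growing sets of candidates. -/
def roundsP (d K : ℕ) : Program :=
  forN vround (.lit (d + 2)) (.seq (seedP d)
    (.ite (.natLe (var vtail) (.lit 0))
      (.seq (separateP d) (.ite (.natLe (.lit 1) (var vsep)) (extendP d K) .skip)) .skip))

/-- Breadth-first search in the graph of feasible bases. In pass `i` the first entry of tuple `i /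
n` of the queue is deleted and the point `i % n` is appended to it. -/
def searchP (d : ℕ) : Program :=
  .seq (setVar vi (.lit 0))
    (.while (.both (.neg (.natLe (.mul (var vtail) (var vn)) (var vi)))
        (.natLe (var vtail) (capE d)))
      (.seq (setVar vc (.add (.div (.load aqueue (.div (var vi) (var vn))) (var vn))
          (.mul (.mod (var vi) (var vn)) (powE (var vn) d))))
        (.seq (pushP d) (incr vi))))

/-- Output the exact number, if the search was completed, and otherwise the estimate. -/
def outputP (d K : ℕ) : Program :=
  .ite (.natLe (var vtail) (capE d))
    (.setReal 2 (.lit 0) (.div (.ofNat (var vtail)) (.ofNat (.lit (d + 1).factorial))))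
    (.setReal 2 (.lit 0) (.div (.mul (.ofNat (var vhits)) (.ofNat (powE (var vn) (d + 1))))
      (.ofNat (.mul (drawsE d K) (.lit (d + 1).factorial)))))

/-- The part of the program after the random draws. -/
def mainP (d K : ℕ) : Program :=
  .seq (countP d K) (.seq (flagP d) (.seq candP (.seq (roundsP d K)
    (.seq (searchP d) (outputP d K)))))

/-- An approximation algorithm for the simplicial depth. -/
def depthP (d K : ℕ) : Program :=
  .seq (.seq scaleP (setVar vi (.lit 0))) (.seq (drawP d K) (mainP d K))

/-! ### Correctness of the parts of the program -/

variable {n d K r lg B : ℕ} {p : Fin n → EuclideanSpace ℝ (Fin d)}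
  {q : EuclideanSpace ℝ (Fin d)} {a : ℕ → ℕ} {s s' : State}

theorem State.writeNat_apply (a i v b j : ℕ) (s : State) :
    (s.writeNat a i v).nat b j = if b = a ∧ j = i then v else s.nat b j := by
  by_cases hb : b = a
  · subst hb
    by_cases hj : j = i
    · subst hj; simp
    · simp [hj]
  · simp [State.writeNat_nat_ne hb, hb]

/-- The data that stay constant after the random draws. -/
structure Base (p : Fin n → EuclideanSpace ℝ (Fin d)) (q : EuclideanSpace ℝ (Fin d)) (r lg : ℕ)
    (a : ℕ → ℕ) (s : State) : Prop where
  input : HasInput p q s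
  scale : s.nat vr 0 = r
  log : s.nat vlog 0 = lg
  rand : s.nat arand = a

theorem Base.of_frame {A : Program} (h : Base p q r lg a s) (hF : Frame A s s')
    (h0 : A.modN vn = false := by rfl) (h1 : A.modN vr = false := by rfl)
    (h2 : A.modN vlog = false := by rfl) (h3 : A.modN arand = false := by rfl)
    (h4 : A.modR = false := by rfl) : Base p q r lg a s' :=
  ⟨⟨by rw [hF.1 _ h0]; exact h.input.1, by rw [hF.2 h4]; exact h.input.2⟩,
    by rw [hF.1 _ h1]; exact h.scale, by rw [hF.1 _ h2]; exact h.log,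
    by rw [hF.1 _ h3]; exact h.rand⟩

theorem Base.writeNat (h : Base p q r lg a s) (b i v : ℕ)
    (h0 : vn ≠ b := by decide) (h1 : vr ≠ b := by decide)
    (h2 : vlog ≠ b := by decide) (h3 : arand ≠ b := by decide) :
    Base p q r lg a (s.writeNat b i v) :=
  ⟨⟨by rw [State.writeNat_nat_ne h0]; exact h.input.1, h.input.2⟩,
    by rw [State.writeNat_nat_ne h1]; exact h.scale,
    by rw [State.writeNat_nat_ne h2]; exact h.log,
    by rw [State.writeNat_nat_ne h3]; exact h.rand⟩

/-- The bound `B` is large enough for all numbers that occur. -/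
structure Bounds (B n d K r lg : ℕ) : Prop where
  two_le : 2 ≤ B
  rounds : d + 2 ≤ B
  draws : K * lg * r ^ (d + 2) ≤ B
  codes : n ^ (d + 1) ≤ B
  cand : ((d + 5) * K * lg * r) ^ (d + 1) ≤ B
  queue : r ^ d * n + 1 ≤ B
  cap : r ^ d + 1 ≤ B

theorem Base.eval_drawsE (h : Base p q r lg a s) :
    (drawsE d K).eval s = K * lg * r ^ (d + 2) := by
  simp [drawsE, NatExpr.eval, h.scale, h.log]

theorem Base.eval_capE (h : Base p q r lg a s) : (capE d).eval s = r ^ d := by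
  simp [capE, NatExpr.eval, h.scale]

theorem Base.eval_candMaxE (h : Base p q r lg a s) :
    (candMaxE d K).eval s = (d + 5) * K * lg * r := by
  simp [candMaxE, NatExpr.eval, h.scale, h.log]

variable [NeZero n]

/-- `c` is the code of a feasible tuple. -/
def FeasibleCode (p : Fin n → EuclideanSpace ℝ (Fin d)) (q : EuclideanSpace ℝ (Fin d)) (c : ℕ) :
    Prop :=
  c < n ^ (d + 1) ∧ Feasible (homog ∘ p) (homog q) (digits n (d + 1) c)

open Classical in
/-- The number of feasible tuples. -/
noncomputable def feasibleCard (p : Fin n → EuclideanSpace ℝ (Fin d))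
    (q : EuclideanSpace ℝ (Fin d)) : ℕ :=
  Fintype.card {t : Fin (d + 1) → Fin n // Feasible (homog ∘ p) (homog q) t}

/-- The code `c` is in the queue. -/
def Seen (s : State) (c : ℕ) : Prop :=
  ∃ i < s.nat vtail 0, s.nat aqueue i = c

/-- The queue contains distinct feasible codes, and these are marked. Besides, `q` is not one of the
points. -/
structure Table (p : Fin n → EuclideanSpace ℝ (Fin d)) (q : EuclideanSpace ℝ (Fin d))
    (s : State) : Prop where
  feasible : ∀ c, Seen s c → FeasibleCode p q c
  inj : ∀ i < s.nat vtail 0, ∀ j < s.nat vtail 0, s.nat aqueue i = s.nat aqueue j → i = j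
  mark : ∀ c, s.nat amark c ≠ 0 ↔ Seen s c
  ne : ∀ i, p i ≠ q

/-- The queue is in order, or it is too long, because there are many feasible tuples or because `q`
is one of the points. -/
def TableOK (p : Fin n → EuclideanSpace ℝ (Fin d)) (q : EuclideanSpace ℝ (Fin d)) (r : ℕ)
    (s : State) : Prop :=
  (s.nat vtail 0 = r ^ d + 1 ∧ (r ^ d < feasibleCard p q ∨ ∃ i, p i = q)) ∨
    (s.nat vtail 0 ≤ r ^ d ∧ Table p q s)

theorem Table.le_card (h : Table p q s) : s.nat vtail 0 ≤ feasibleCard p q := by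
  classical
  rw [feasibleCard, ← Fintype.card_fin (s.nat vtail 0)]
  refine Fintype.card_le_of_injective
    (fun i => ⟨digits n (d + 1) (s.nat aqueue i), (h.feasible _ ⟨i, i.2, rfl⟩).2⟩) ?_
  intro i j hij
  have h1 := congrArg (fun t => encode (Subtype.val t)) hij
  simp only [encode_digits (h.feasible _ ⟨i, i.2, rfl⟩).1,
    encode_digits (h.feasible _ ⟨j, j.2, rfl⟩).1] at h1
  exact Fin.ext (h.inj i i.2 j j.2 h1)

/-- If the queue contains all feasible codes, its length is their number. -/
theorem Table.eq_card (h : Table p q s) (hall : ∀ c, FeasibleCode p q c → Seen s c) :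
    s.nat vtail 0 = feasibleCard p q := by
  classical
  refine le_antisymm h.le_card ?_
  rw [feasibleCard, ← Fintype.card_fin (s.nat vtail 0)]
  refine Fintype.card_le_of_surjective
    (fun i : Fin (s.nat vtail 0) => (⟨digits n (d + 1) (s.nat aqueue i),
      (h.feasible _ ⟨i, i.2, rfl⟩).2⟩ : {t : Fin (d + 1) → Fin n //
        Feasible (homog ∘ p) (homog q) t})) ?_
  rintro ⟨t, ht⟩
  obtain ⟨i, hi, hic⟩ := hall (encode t) ⟨encode_lt t, by rwa [digits_encode]⟩
  exact ⟨⟨i, hi⟩, Subtype.ext (by simp only [hic, digits_encode])⟩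

theorem Seen.congr (h1 : s'.nat vtail = s.nat vtail) (h2 : s'.nat aqueue = s.nat aqueue) (c : ℕ) :
    Seen s' c ↔ Seen s c := by
  unfold Seen; rw [h1, h2]

theorem TableOK.congr (h : TableOK p q r s) (h1 : s'.nat vtail = s.nat vtail)
    (h2 : s'.nat aqueue = s.nat aqueue) (h3 : s'.nat amark = s.nat amark) :
    TableOK p q r s' := by
  have hS := Seen.congr h1 h2
  unfold TableOK at *
  rw [h1]
  refine h.imp_right fun h => ⟨h.1, ?_⟩
  exact ⟨fun c hc => h.2.feasible c ((hS c).1 hc),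
    by rw [h1, h2]; exact h.2.inj, fun c => by rw [h3, hS]; exact h.2.mark c, h.2.ne⟩

/-- The effect of appending a new feasible code to the queue. -/
theorem TableOK.push (hT : Table p q s) (hle : s.nat vtail 0 ≤ r ^ d) {c : ℕ}
    (hc : FeasibleCode p q c) (hm : s.nat amark c = 0)
    (h1 : s'.nat vtail 0 = s.nat vtail 0 + 1)
    (h2 : ∀ i, s'.nat aqueue i = if i = s.nat vtail 0 then c else s.nat aqueue i)
    (h3 : ∀ x, s'.nat amark x = if x = c then 1 else s.nat amark x) :
    TableOK p q r s' ∧ ∀ x, Seen s' x ↔ Seen s x ∨ x = c := by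
  have hS : ∀ x, Seen s' x ↔ Seen s x ∨ x = c := by
    intro x
    constructor
    · rintro ⟨i, hi, rfl⟩
      rw [h2]
      by_cases hit : i = s.nat vtail 0
      · exact Or.inr (by simp [hit])
      · exact Or.inl ⟨i, by omega, by simp [hit]⟩
    · rintro (⟨i, hi, rfl⟩ | rfl)
      · exact ⟨i, by omega, by rw [h2, if_neg hi.ne]⟩
      · exact ⟨s.nat vtail 0, by omega, by rw [h2, if_pos rfl]⟩
  have hnot : ¬ Seen s c := fun h => (hT.mark c).2 h hm
  have hT' : Table p q s' := by
    refine ⟨fun x hx => ?_, fun i hi j hj hij => ?_, fun x => ?_, hT.ne⟩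
    · rcases (hS x).1 hx with h | rfl
      · exact hT.feasible x h
      · exact hc
    · rw [h2, h2] at hij
      split_ifs at hij with hi' hj' hj'
      · rw [hi', hj']
      · exact (hnot ⟨j, by omega, hij.symm⟩).elim
      · exact (hnot ⟨i, by omega, hij⟩).elim
      · exact hT.inj i (by omega) j (by omega) hij
    · rw [h3, hS]
      by_cases hx : x = c
      · simp [hx]
      · simpa [hx] using hT.mark x
  refine ⟨?_, hS⟩
  rcases Nat.lt_or_ge (s.nat vtail 0) (r ^ d) with hlt | hge
  · exact Or.inr ⟨by omega, hT'⟩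
  · have := hT'.le_card
    exact Or.inl ⟨by omega, Or.inl (by omega)⟩

/-- As long as the queue is not too long, exactly the code in `vc` is added to it, if it is
feasible. The first entries of the queue never change. -/
theorem pushP_spec (hB : Bounds B n d K r lg) (hs : Base p q r lg a s) (hT : TableOK p q r s)
    (hc : s.nat vc 0 < n ^ (d + 1)) :
    WP B (pushP d) 4 (fun s' => TableOK p q r s' ∧ s.nat vtail 0 ≤ s'.nat vtail 0 ∧
      (∀ i < s.nat vtail 0, s'.nat aqueue i = s.nat aqueue i) ∧
      (s'.nat vtail 0 ≤ r ^ d →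
        ∀ c, Seen s' c ↔ Seen s c ∨ (c = s.nat vc 0 ∧ FeasibleCode p q c))) s := by
  have hcB : s.nat vc 0 ≤ B := hc.le.trans hB.codes
  refine WP.ite (k := 3) (fun ht => ?_) (fun ht => ?_)
  · simp only [Test.holds, holds_feasibleT hs.input, hs.eval_capE, NatExpr.eval,
      nonpos_iff_eq_zero] at ht
    obtain ⟨hm, hf, hle⟩ := ht
    rcases hT with ⟨h1, -⟩ | ⟨-, hT⟩
    · omega
    refine WP.seq (k := 1) (k' := 2)
      (WP.setNat (by simpa [NatExpr.eval] using hB.two_le.trans' one_le_two) ?_)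
    refine WP.seq (k := 1) (k' := 1)
      (WP.setNat (by simpa +decide [NatExpr.eval, State.writeNat_apply] using hcB) ?_)
    refine WP.setNat ?_ ?_
    · simp +decide [NatExpr.eval, State.writeNat_apply]
      have := hB.cap; omega
    · set s₃ := State.writeNat _ _ _ _ with hs₃
      have h1 : s₃.nat vtail 0 = s.nat vtail 0 + 1 := by
        simp +decide [hs₃, NatExpr.eval, State.writeNat_apply]
      have h2 : ∀ i, s₃.nat aqueue i = if i = s.nat vtail 0 then s.nat vc 0
          else s.nat aqueue i := fun i => by
        simp +decide [hs₃, NatExpr.eval, State.writeNat_apply]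
      have h3 : ∀ x, s₃.nat amark x = if x = s.nat vc 0 then 1
          else s.nat amark x := fun x => by
        simp +decide [hs₃, NatExpr.eval, State.writeNat_apply]
      clear_value s₃
      obtain ⟨h4, h5⟩ := TableOK.push (r := r) hT hle ⟨hc, hf⟩ hm h1 h2 h3
      refine ⟨h4, by omega, fun i hi => by rw [h2, if_neg hi.ne], fun _ c => ?_⟩
      rw [h5]
      refine or_congr_right ⟨?_, fun h => h.1⟩
      rintro rfl
      exact ⟨rfl, hc, hf⟩
  · refine WP.mono (WP.skip ?_) (by omega) fun _ h => h
    refine ⟨hT, le_rfl, fun _ _ => rfl, fun hle c => ?_⟩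
    constructor
    · exact Or.inl
    · rintro (h | ⟨rfl, hf⟩)
      · exact h
      · rcases hT with ⟨h1, -⟩ | ⟨-, hT⟩
        · omega
        refine (hT.mark _).1 fun hm => ht ?_
        simp only [Test.holds, holds_feasibleT hs.input, hs.eval_capE, NatExpr.eval,
          nonpos_iff_eq_zero]
        exact ⟨hm, hf.2, hle⟩

end RealRAM

/-! ### Sampling and the first candidates -/

namespace RealRAM

open FeasibleBasis

variable {n d K r lg B : ℕ} {p : Fin n → EuclideanSpace ℝ (Fin d)}
  {q : EuclideanSpace ℝ (Fin d)} {a : ℕ → ℕ} {s s' : State}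

/-- The candidates are points, and there are not too many of them. -/
structure CandOK (n d K r lg : ℕ) (s : State) : Prop where
  pos : 0 < s.nat vcand 0
  le : s.nat vcand 0 ≤ (d + 5) * K * lg * r
  lt : ∀ i < s.nat vcand 0, s.nat acand i < n

/-- The set of candidates. -/
def candSet (n : ℕ) (s : State) : Set (Fin n) :=
  {x | ∃ i < s.nat vcand 0, s.nat acand i = x}

theorem CandOK.congr (hc : CandOK n d K r lg s) (h1 : s'.nat vcand = s.nat vcand)
    (h2 : s'.nat acand = s.nat acand) : CandOK n d K r lg s' :=
  ⟨by rw [h1]; exact hc.pos, by rw [h1]; exact hc.le, by rw [h1, h2]; exact hc.lt⟩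

theorem candSet_congr (h1 : s'.nat vcand = s.nat vcand) (h2 : s'.nat acand = s.nat acand) :
    candSet n s' = candSet n s := by
  simp only [candSet, h1, h2]

theorem CandOK.pow_le (hB : Bounds B n d K r lg) (hc : CandOK n d K r lg s) {m : ℕ}
    (hm : m ≤ d + 1) : s.nat vcand 0 ^ m ≤ B :=
  ((Nat.pow_le_pow_left hc.le m).trans
    (Nat.pow_le_pow_right (hc.pos.trans_le hc.le) hm)).trans hB.cand

variable [NeZero n]

open Classical in
/-- The number of the first `m` random tuples that are feasible. -/
noncomputable def hitCount (p : Fin n → EuclideanSpace ℝ (Fin d)) (q : EuclideanSpace ℝ (Fin d))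
    (a : ℕ → ℕ) (m : ℕ) : ℕ :=
  (Finset.filter (fun i : ℕ => Feasible (homog ∘ p) (homog q) (digits n (d + 1) (a i)))
    (Finset.range m)).card

open Classical in
theorem hitCount_le (m : ℕ) : hitCount p q a m ≤ m :=
  (Finset.card_filter_le _ _).trans (Finset.card_range m).le

open Classical in
theorem hitCount_succ (m : ℕ) : hitCount p q a (m + 1) = hitCount p q a m +
    if Feasible (homog ∘ p) (homog q) (digits n (d + 1) (a m)) then 1 else 0 := by
  simp only [hitCount]
  rw [Finset.range_add_one, Finset.filter_insert]
  split_ifs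
  · rw [Finset.card_insert_of_notMem (by simp)]
  · rfl

theorem countP_spec (hB : Bounds B n d K r lg) (hs : Base p q r lg a s)
    (h0 : s.nat vhits 0 = 0) :
    WP B (countP d K) (K * lg * r ^ (d + 2) * 4 + 2)
      (fun s' => s'.nat vhits 0 = hitCount p q a (K * lg * r ^ (d + 2))) s := by
  refine WP.forN (k := 2)
    (Inv := fun i s' => s'.nat vhits 0 = hitCount p q a i) hB.draws rfl ?_ ?_ ?_
  · simp +decide [State.writeNat_apply, h0, hitCount]
  · intro i s' _ _ hF
    exact (hs.of_frame hF).eval_drawsE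
  · intro i hi s' hI hF hc
    have hs' := hs.of_frame hF
    have hev : (NatExpr.load arand (var vi)).eval s' = a i := by
      simp only [NatExpr.eval, hc, hs'.rand]
    refine WP.ite (fun ht => ?_) (fun ht => ?_)
    · rw [holds_feasibleT hs'.input, hev] at ht
      have h1 := hitCount_le (p := p) (q := q) (a := a) i
      have h2 := hB.draws
      refine WP.setNat ?_ ?_
      · simp only [NatExpr.eval, hI]; omega
      · simp +decide [NatExpr.eval, State.writeNat_apply, hI, hitCount_succ, ht]
    · rw [holds_feasibleT hs'.input, hev] at ht
      refine WP.skip ?_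
      simp +decide [State.writeNat_apply, hI, hitCount_succ, ht]

/-- The queue is still empty afterwards, unless `q` is one of the points. -/
theorem flagP_spec (hB : Bounds B n d K r lg) (hs : Base p q r lg a s)
    (h0 : s.nat vtail 0 = 0) (hm : ∀ c, s.nat amark c = 0) :
    WP B (flagP d) (n * 4 + 2)
      (fun s' => TableOK p q r s' ∧ (s'.nat vtail 0 ≤ r ^ d → s'.nat vtail 0 = 0)) s := by
  have hnB : n ≤ B := (Nat.le_self_pow (Nat.succ_ne_zero d) n).trans hB.codes
  refine ((WP.forN (k := 2) (m := n)
    (Inv := fun i s' => (s'.nat vtail 0 = 0 ∧ ∀ j : Fin n, (j : ℕ) < i → p j ≠ q) ∨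
      (s'.nat vtail 0 = r ^ d + 1 ∧ ∃ i, p i = q))
    hnB rfl ?_ ?_ ?_).frame).imp ?_
  · simp +decide [State.writeNat_apply, h0]
  · intro i s' _ _ hF
    exact (hs.of_frame hF).input.1
  · intro i hi s' hI hF hc
    have hs' := hs.of_frame hF
    refine WP.ite (fun ht => ?_) (fun ht => ?_)
    · rw [holds_equalT hs'.input (i := ⟨i, hi⟩) (by simpa [NatExpr.eval] using hc)] at ht
      refine WP.setNat ?_ ?_
      · simp only [NatExpr.eval, hs'.eval_capE]; exact hB.cap
      · right
        simp +decide only [NatExpr.eval, hs'.eval_capE, State.writeNat_apply]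
        exact ⟨by simp, _, ht⟩
    · rw [holds_equalT hs'.input (i := ⟨i, hi⟩) (by simpa [NatExpr.eval] using hc)] at ht
      refine WP.skip ?_
      rw [State.writeNat_nat_ne (by decide)]
      refine hI.imp_left fun h => ⟨h.1, fun j hj => ?_⟩
      rcases Nat.lt_succ_iff_lt_or_eq.1 hj with h' | rfl
      · exact h.2 j h'
      · exact ht
  · rintro s' ⟨h1, hF⟩
    rcases h1 with ⟨h1, hne⟩ | ⟨h1, h2⟩
    · refine ⟨Or.inr ⟨by omega, ?_⟩, fun _ => h1⟩
      have hno : ∀ c, ¬ Seen s' c := by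
        rintro c ⟨i, hi, -⟩
        omega
      refine ⟨fun c hc => (hno c hc).elim, fun i hi => by omega, fun c => ?_, fun i => hne i i.2⟩
      rw [hF.1 amark rfl, hm]
      simpa using hno c
    · exact ⟨Or.inl ⟨h1, Or.inr h2⟩, fun h => by omega⟩

/-- The first `2 r` candidates. -/
def CandInit (n r : ℕ) (a cand : ℕ → ℕ) : Prop :=
  ∀ i < r, cand (2 * i) = i % n ∧ cand (2 * i + 1) = a i % n

theorem candP_spec (hB : Bounds B n d K r lg) (hs : Base p q r lg a s) (hr : 2 * r ≤ B) :
    WP B candP (r * 4 + 3)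
      (fun s' => s'.nat vcand 0 = 2 * r ∧ CandInit n r a (s'.nat acand)) s := by
  have hnB : n ≤ B := (Nat.le_self_pow (Nat.succ_ne_zero d) n).trans hB.codes
  have hmod : ∀ x, x % n ≤ B := fun x => (Nat.mod_lt x (NeZero.pos n)).le.trans hnB
  have h := WP.forN (s := s) (B := B) (c := vi) (e := var vr) (k := 2) (m := r)
    (body := .seq (.setNat acand (.mul (.lit 2) (var vi)) (.mod (var vi) (var vn)))
      (.setNat acand (.add (.mul (.lit 2) (var vi)) (.lit 1))
        (.mod (.load arand (var vi)) (var vn))))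
    (Inv := fun i s' => CandInit n i a (s'.nat acand)) (by omega) rfl ?_ ?_ ?_
  · refine WP.seq (k := r * 4 + 2) (k' := 1) (h.frame.imp ?_)
    rintro s' ⟨h1, hF⟩
    have hs' := hs.of_frame hF
    refine WP.setNat ?_ ?_
    · simpa [NatExpr.eval, hs'.scale] using hr
    · refine ⟨by simp [NatExpr.eval, hs'.scale], ?_⟩
      rw [State.writeNat_nat_ne (by decide)]
      exact h1
  · intro i hi; omega
  · intro i s' _ _ hF
    exact (hs.of_frame hF).scale
  · intro i hi s' hI hF hc
    have hs' := hs.of_frame hF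
    have hn := hs'.input.1
    refine WP.seq (k := 1) (k' := 1) (WP.setNat ?_ (WP.setNat ?_ ?_))
    · simp only [NatExpr.eval, hn]; exact hmod _
    · simp only [NatExpr.eval]
      rw [State.writeNat_nat_ne (show vn ≠ acand by decide), hn]; exact hmod _
    · intro i' hi'
      simp +decide only [NatExpr.eval, State.writeNat_apply, hn, hc]
      rcases Nat.lt_succ_iff_lt_or_eq.1 hi' with h | rfl
      · have h1 : 2 * i' ≠ 2 * i := by omega
        have h2 : 2 * i' ≠ 2 * i + 1 := by omega
        have h3 : 2 * i' + 1 ≠ 2 * i := by omega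
        have h4 : 2 * i' + 1 ≠ 2 * i + 1 := by omega
        simpa [h1, h2, h3, h4] using hI i' h
      · simp [hs'.rand]

/-- The tuple of candidates with number `j`. -/
def candTuple (n m : ℕ) [NeZero n] (s : State) (j : ℕ) : Fin m → Fin n :=
  fun k => ⟨s.nat acand (j / s.nat vcand 0 ^ (k : ℕ) % s.nat vcand 0) % n,
    Nat.mod_lt _ (NeZero.pos n)⟩

theorem candTuple_mem (hc : CandOK n d K r lg s) (m j : ℕ) (k : Fin m) :
    candTuple n m s j k ∈ candSet n s := by
  have h1 : j / s.nat vcand 0 ^ (k : ℕ) % s.nat vcand 0 < s.nat vcand 0 := Nat.mod_lt _ hc.pos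
  exact ⟨_, h1, (Nat.mod_eq_of_lt (hc.lt _ h1)).symm⟩

theorem exists_candTuple_eq (hc : CandOK n d K r lg s) {m : ℕ} {t : Fin m → Fin n}
    (ht : ∀ k, t k ∈ candSet n s) : ∃ j < s.nat vcand 0 ^ m, candTuple n m s j = t := by
  choose i hi hit using ht
  have : NeZero (s.nat vcand 0) := ⟨hc.pos.ne'⟩
  refine ⟨encode fun k => (⟨i k, hi k⟩ : Fin (s.nat vcand 0)), encode_lt _, ?_⟩
  funext k
  have h1 := congrArg Fin.val (congrFun (digits_encode fun k =>
    (⟨i k, hi k⟩ : Fin (s.nat vcand 0))) k)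
  simp only [digits] at h1
  refine Fin.ext ?_
  simp only [candTuple]
  rw [h1, hit, Nat.mod_eq_of_lt (t k).2]

theorem eval_candTupleE (hs : HasInput p q s) (hc : CandOK n d K r lg s) (m : ℕ) :
    (candTupleE m).eval s = encode (candTuple n m s (s.nat vj 0)) := by
  simp only [candTupleE, eval_encodeE, encode]
  rw [Finset.sum_range]
  refine Finset.sum_congr rfl fun k _ => ?_
  have h1 : s.nat vj 0 / s.nat vcand 0 ^ (k : ℕ) % s.nat vcand 0 < s.nat vcand 0 :=
    Nat.mod_lt _ hc.pos
  simp only [NatExpr.eval, eval_digitE, candTuple, hs.1]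
  rw [Nat.mod_eq_of_lt (hc.lt _ h1)]

theorem candTuple_congr (h1 : s'.nat vcand = s.nat vcand) (h2 : s'.nat acand = s.nat acand)
    (m j : ℕ) : candTuple n m s' j = candTuple n m s j := by
  funext k; simp only [candTuple, h1, h2]

/-- As long as the queue is not too long, all feasible tuples of candidates are added to it. -/
theorem seedP_spec (hB : Bounds B n d K r lg) (hs : Base p q r lg a s) (hT : TableOK p q r s)
    (hc : CandOK n d K r lg s) :
    WP B (seedP d) (((d + 5) * K * lg * r) ^ (d + 1) * 7 + 2) (fun s' => TableOK p q r s' ∧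
      s.nat vtail 0 ≤ s'.nat vtail 0 ∧ (s'.nat vtail 0 ≤ r ^ d → ∀ c, Seen s' c ↔ Seen s c ∨
        (FeasibleCode p q c ∧ ∀ k, digits n (d + 1) c k ∈ candSet n s))) s := by
  have hle := Nat.pow_le_pow_left hc.le (d + 1)
  refine ((WP.forN (m := s.nat vcand 0 ^ (d + 1)) (k := 5)
    (Inv := fun j s' => TableOK p q r s' ∧ s.nat vtail 0 ≤ s'.nat vtail 0 ∧
      (s'.nat vtail 0 ≤ r ^ d → ∀ c, Seen s' c ↔ Seen s c ∨
        (FeasibleCode p q c ∧ ∃ j' < j, c = encode (candTuple n (d + 1) s j'))))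
    (hc.pow_le hB le_rfl) rfl ?_ ?_ ?_)).mono (by omega) ?_
  · refine ⟨hT.congr ?_ ?_ ?_, ?_, fun _ c => ?_⟩
    · exact State.writeNat_nat_ne (by decide) _ _ _
    · exact State.writeNat_nat_ne (by decide) _ _ _
    · exact State.writeNat_nat_ne (by decide) _ _ _
    · rw [State.writeNat_nat_ne (by decide)]
    · rw [Seen.congr (State.writeNat_nat_ne (by decide) _ _ _)
        (State.writeNat_nat_ne (by decide) _ _ _)]
      simp
  · intro j s' _ _ hF
    simp [NatExpr.eval, hF.1 vcand rfl]
  · rintro j hj s' ⟨hT', hmono, hI⟩ hF hjc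
    have hs' := hs.of_frame hF
    have hv : s'.nat vcand = s.nat vcand := hF.1 vcand rfl
    have ha : s'.nat acand = s.nat acand := hF.1 acand rfl
    have hev := eval_candTupleE hs'.input (hc.congr hv ha) (d + 1)
    rw [candTuple_congr hv ha, hjc] at hev
    have hlt := encode_lt (candTuple n (d + 1) s j)
    refine WP.seq (k := 1) (k' := 4) (WP.setNat ?_ ?_)
    · rw [hev]; exact hlt.le.trans hB.codes
    rw [hev]
    set s₁ := s'.writeNat vc 0 (encode (candTuple n (d + 1) s j)) with hs₁
    have e1 : s₁.nat vtail = s'.nat vtail := State.writeNat_nat_ne (by decide) _ _ _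
    have e2 : s₁.nat aqueue = s'.nat aqueue := State.writeNat_nat_ne (by decide) _ _ _
    have e3 : s₁.nat amark = s'.nat amark := State.writeNat_nat_ne (by decide) _ _ _
    have e4 : s₁.nat vc 0 = encode (candTuple n (d + 1) s j) := by simp [hs₁]
    refine (pushP_spec hB (hs'.writeNat vc 0 _) (hT'.congr e1 e2 e3)
      (by rw [e4]; exact hlt)).imp ?_
    rintro s₂ ⟨h1, h2, -, h4⟩
    have f1 : (s₂.writeNat vj 0 (j + 1)).nat vtail = s₂.nat vtail :=
      State.writeNat_nat_ne (by decide) _ _ _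
    have f2 : (s₂.writeNat vj 0 (j + 1)).nat aqueue = s₂.nat aqueue :=
      State.writeNat_nat_ne (by decide) _ _ _
    have f3 : (s₂.writeNat vj 0 (j + 1)).nat amark = s₂.nat amark :=
      State.writeNat_nat_ne (by decide) _ _ _
    rw [e1] at h2
    refine ⟨h1.congr f1 f2 f3, by rw [f1]; exact hmono.trans h2, fun hle' c => ?_⟩
    rw [f1] at hle'
    rw [Seen.congr f1 f2, h4 hle', Seen.congr e1 e2, hI (h2.trans hle'), e4]
    constructor
    · rintro ((h | ⟨h, j', hj', hcj⟩) | ⟨hcj, h⟩)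
      · exact Or.inl h
      · exact Or.inr ⟨h, j', by omega, hcj⟩
      · exact Or.inr ⟨h, j, by omega, hcj⟩
    · rintro (h | ⟨h, j', hj', hcj⟩)
      · exact Or.inl (Or.inl h)
      · rcases Nat.lt_succ_iff_lt_or_eq.1 hj' with h' | rfl
        · exact Or.inl (Or.inr ⟨h, j', h', hcj⟩)
        · exact Or.inr ⟨hcj, h⟩
  · rintro s' ⟨h1, h2, h3⟩
    refine ⟨h1, h2, fun hle' c => ?_⟩
    rw [h3 hle']
    refine or_congr_right (and_congr_right fun hf => ?_)
    constructor
    · rintro ⟨j, -, rfl⟩ k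
      rw [digits_encode]
      exact candTuple_mem hc _ _ _
    · intro hk
      obtain ⟨j, hj, hjt⟩ := exists_candTuple_eq hc hk
      exact ⟨j, hj, by rw [hjt, encode_digits hf.1]⟩

end RealRAM

/-! ### Hyperplanes spanned by candidates -/

namespace RealRAM

open FeasibleBasis

variable {n d K r lg B : ℕ} {p : Fin n → EuclideanSpace ℝ (Fin d)}
  {q : EuclideanSpace ℝ (Fin d)} {a : ℕ → ℕ} {s s' : State}

/-- The point with index `x` lies strictly on the side of `q` of the hyperplane spanned by the
points of the tuple `b`. -/
def OnSide (p : Fin n → EuclideanSpace ℝ (Fin d)) (q : EuclideanSpace ℝ (Fin d))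
    (b : Fin d → Fin n) (x : Fin n) : Prop :=
  0 < rowDet (Fin.cons (homog (p x)) ((homog ∘ p) ∘ b)) *
    rowDet (Fin.cons (homog q) ((homog ∘ p) ∘ b))

/-- The points of the tuple `b` span a hyperplane that does not contain `q`, and none of the points
with index in `V` lies strictly on the side of `q`. -/
def Separates (p : Fin n → EuclideanSpace ℝ (Fin d)) (q : EuclideanSpace ℝ (Fin d))
    (V : Set (Fin n)) (b : Fin d → Fin n) : Prop :=
  rowDet (Fin.cons (homog q) ((homog ∘ p) ∘ b)) ≠ 0 ∧ ∀ x ∈ V, ¬ OnSide p q b x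

variable [NeZero n]

/-- Multiplication of a code by `n` makes room for a new first entry. -/
theorem digits_add_mul (x : Fin n) (b : ℕ) :
    digits n (d + 1) (x + n * b) = Fin.cons x (digits n d b) := by
  funext k
  refine Fin.cases ?_ (fun k => ?_) k
  · exact Fin.ext (by simp [digits, Nat.mod_eq_of_lt x.2])
  · refine Fin.ext ?_
    simp only [digits, Fin.cons_succ, Fin.val_succ]
    rw [pow_succ', ← Nat.div_div_eq_div_mul, Nat.add_mul_div_left _ _ (NeZero.pos n),
      Nat.div_eq_of_lt x.2, zero_add]

/-- Division of a code by `n` deletes the first entry. -/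
theorem digits_shift {c : ℕ} (hc : c < n ^ (d + 1)) (x : Fin n) :
    digits n (d + 1) (c / n + x * n ^ d) = Fin.snoc (Fin.tail (digits n (d + 1) c)) x := by
  have hn := NeZero.pos n
  funext k
  refine Fin.lastCases ?_ (fun k => ?_) k
  · refine Fin.ext ?_
    have h1 : c / n < n ^ d := Nat.div_lt_of_lt_mul (by rwa [pow_succ'] at hc)
    simp only [digits, Fin.snoc_last, Fin.val_last]
    rw [Nat.add_mul_div_right _ _ (pow_pos hn d), Nat.div_eq_of_lt h1, zero_add,
      Nat.mod_eq_of_lt x.2]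
  · refine Fin.ext ?_
    simp only [digits, Fin.snoc_castSucc, Fin.tail, Fin.val_succ, Fin.val_castSucc]
    obtain ⟨j, hj⟩ : ∃ j, d = k + (j + 1) := ⟨d - k - 1, by have := k.2; omega⟩
    have h1 : (x : ℕ) * n ^ d = n ^ (k : ℕ) * (n * (x * n ^ j)) := by
      conv_lhs => rw [hj]
      ring
    rw [h1, Nat.add_mul_div_left _ _ (pow_pos hn _), Nat.add_mul_mod_self_left,
      Nat.div_div_eq_div_mul, pow_succ']

theorem holds_sideT_iff (hs : HasInput p q s) {e : NatExpr} {x : Fin n} {b : ℕ}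
    (he : e.eval s = x + n * b) : (sideT d e).holds s ↔ OnSide p q (digits n d b) x := by
  rw [holds_sideT hs, he, digits_add_mul, comp_cons, update_zero_cons]
  rfl

theorem holds_spanT_iff (hs : HasInput p q s) {e : NatExpr} {b : ℕ} (he : e.eval s = n * b) :
    (spanT d e).holds s ↔
      rowDet (Fin.cons (homog q) ((homog ∘ p) ∘ digits n d b)) ≠ 0 := by
  have h := digits_add_mul (d := d) (0 : Fin n) b
  simp only [Fin.val_zero, zero_add] at h
  rw [holds_spanT hs, he, h, comp_cons, update_zero_cons]

/-- The body of the loop of `separateP`: a separating tuple is recorded, and otherwise nothing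
happens. -/
theorem checkP_spec (hB : Bounds B n d K r lg) (hs : Base p q r lg a s)
    (hc : CandOK n d K r lg s) (hb : s.nat vc 0 < n ^ d) :
    WP B (.seq
        (.ite (spanT d (.mul (var vn) (var vc))) (setVar vok (.lit 1)) (setVar vok (.lit 0)))
        (.seq (forN vx (var vcand)
          (.ite (sideT d (.add (.load acand (var vx)) (.mul (var vn) (var vc))))
            (setVar vok (.lit 0)) .skip))
          (.ite (.natLe (.lit 1) (var vok)) (setVar vsep (.add (var vc) (.lit 1))) .skip)))
      ((d + 5) * K * lg * r * 4 + 6)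
      (fun s' => (Separates p q (candSet n s) (digits n d (s.nat vc 0)) →
          s'.nat vsep 0 = s.nat vc 0 + 1) ∧
        (¬ Separates p q (candSet n s) (digits n d (s.nat vc 0)) →
          s'.nat vsep 0 = s.nat vsep 0)) s := by
  have h2 := hB.two_le
  set b := digits n d (s.nat vc 0) with hbdef
  have hspan := holds_spanT_iff hs.input (e := .mul (var vn) (var vc)) (b := s.nat vc 0)
    (by simp [NatExpr.eval, hs.input.1])
  have hv := hc.pow_le hB (m := 1) (by omega)
  rw [pow_one] at hv
  have hcodes : n ^ d ≤ B := (Nat.pow_le_pow_right (NeZero.pos n) (Nat.le_succ d)).trans hB.codes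
  -- the part after the first test, which has set the flag `vok`
  have key : ∀ s₁ : State, Base p q r lg a s₁ → (∀ b, b ≠ vok → s₁.nat b = s.nat b) →
      (s₁.nat vok 0 ≠ 0 ↔ rowDet (Fin.cons (homog q) ((homog ∘ p) ∘ b)) ≠ 0) →
      WP B (.seq (forN vx (var vcand)
          (.ite (sideT d (.add (.load acand (var vx)) (.mul (var vn) (var vc))))
            (setVar vok (.lit 0)) .skip))
          (.ite (.natLe (.lit 1) (var vok)) (setVar vsep (.add (var vc) (.lit 1))) .skip))
        (s.nat vcand 0 * 4 + 4)
        (fun s' => (Separates p q (candSet n s) b → s'.nat vsep 0 = s.nat vc 0 + 1) ∧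
          (¬ Separates p q (candSet n s) b → s'.nat vsep 0 = s.nat vsep 0)) s₁ := by
    intro s₁ hs₁ heq hok
    refine WP.seq (k := s.nat vcand 0 * 4 + 2) (k' := 2)
      ((WP.forN (m := s.nat vcand 0) (k := 2) (Inv := fun i s' => s'.nat vok 0 ≠ 0 ↔
        rowDet (Fin.cons (homog q) ((homog ∘ p) ∘ b)) ≠ 0 ∧
          ∀ x : Fin n, (∃ i' < i, s.nat acand i' = x) → ¬ OnSide p q b x)
        hv rfl ?_ ?_ ?_).frame.imp ?_)
    · rw [State.writeNat_nat_ne (by decide), hok]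
      simp
    · intro i s' _ _ hF
      simp only [NatExpr.eval]
      rw [hF.1 vcand rfl, heq vcand (by decide)]
    · intro i hi s' hI hF hi'
      have hs' := hs₁.of_frame hF
      have e1 : s'.nat acand = s.nat acand := by rw [hF.1 acand rfl, heq acand (by decide)]
      have e2 : s'.nat vc = s.nat vc := by rw [hF.1 vc rfl, heq vc (by decide)]
      have hside := holds_sideT_iff hs'.input (x := ⟨s.nat acand i, hc.lt i hi⟩)
        (e := .add (.load acand (var vx)) (.mul (var vn) (var vc))) (b := s.nat vc 0)
        (by simp [NatExpr.eval, hs'.input.1, hi', e1, e2])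
      refine WP.ite (k := 1) (fun ht => ?_) (fun ht => ?_)
      · rw [hside] at ht
        refine WP.setNat (by simp [NatExpr.eval]) ?_
        refine iff_of_false ?_ fun h => h.2 _ ⟨i, Nat.lt_succ_self i, rfl⟩ ht
        simp +decide [NatExpr.eval, State.writeNat_apply]
      · rw [hside] at ht
        refine WP.skip ?_
        rw [State.writeNat_nat_ne (by decide), hI]
        refine and_congr_right fun _ => ⟨fun h x hx => ?_, fun h x hx => ?_⟩
        · obtain ⟨i', hi'', hx⟩ := hx
          rcases Nat.lt_succ_iff_lt_or_eq.1 hi'' with h' | rfl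
          · exact h x ⟨i', h', hx⟩
          · have : x = ⟨s.nat acand i', hc.lt i' hi⟩ := Fin.ext hx.symm
            rwa [this]
        · obtain ⟨i', hi'', hx⟩ := hx
          exact h x ⟨i', by omega, hx⟩
    · rintro s₂ ⟨hI, hF⟩
      have e1 : s₂.nat vc = s.nat vc := by rw [hF.1 vc rfl, heq vc (by decide)]
      have e2 : s₂.nat vsep = s.nat vsep := by rw [hF.1 vsep rfl, heq vsep (by decide)]
      change _ ↔ Separates p q (candSet n s) b at hI
      refine WP.ite (k := 1) (fun ht => ?_) (fun ht => ?_)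
      · have hsep := hI.1 (by simpa [Test.holds, NatExpr.eval, Nat.one_le_iff_ne_zero] using ht)
        refine WP.setNat (by simp only [NatExpr.eval, e1]; omega)
          ⟨fun _ => ?_, fun h => (h hsep).elim⟩
        simp [NatExpr.eval, e1]
      · have hsep : ¬ Separates p q (candSet n s) b := fun h => ht (by
          simpa [Test.holds, NatExpr.eval, Nat.one_le_iff_ne_zero] using hI.2 h)
        exact WP.skip ⟨fun h => (hsep h).elim, fun _ => by rw [e2]⟩
  have hle := hc.le
  refine WP.mono (k := 2 + (s.nat vcand 0 * 4 + 4)) (WP.seq (WP.ite (k := 1) (fun ht => ?_)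
    (fun ht => ?_))) (by omega) fun _ h => h
  · rw [hspan] at ht
    refine WP.setNat (by simp [NatExpr.eval]; omega) (key _ (hs.writeNat _ _ _)
      (fun b hb => State.writeNat_nat_ne hb _ _ _) ?_)
    simpa [NatExpr.eval] using ht
  · rw [hspan] at ht
    refine WP.setNat (by simp [NatExpr.eval]) (key _ (hs.writeNat _ _ _)
      (fun b hb => State.writeNat_nat_ne hb _ _ _) ?_)
    simpa [NatExpr.eval] using ht

/-- Either `vsep` contains the code of a separating tuple of candidates, increased by one, or it is
zero and there is no such tuple. -/
theorem separateP_spec (hB : Bounds B n d K r lg) (hs : Base p q r lg a s)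
    (hc : CandOK n d K r lg s) :
    WP B (separateP d) (((d + 5) * K * lg * r) ^ d * ((d + 5) * K * lg * r * 4 + 9) + 3)
      (fun s' => (s'.nat vsep 0 ≠ 0 →
          Separates p q (candSet n s) (digits n d (s'.nat vsep 0 - 1))) ∧
        (s'.nat vsep 0 = 0 → ∀ b : Fin d → Fin n, (∀ k, b k ∈ candSet n s) →
          ¬ Separates p q (candSet n s) b)) s := by
  have hle := Nat.pow_le_pow_left hc.le d
  refine WP.mono (k := 1 + (s.nat vcand 0 ^ d * ((d + 5) * K * lg * r * 4 + 9) + 2))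
    (WP.seq (WP.setNat (by simp [NatExpr.eval]) ?_)) ?_ fun _ h => h
  · set s₀ := s.writeNat vsep ((NatExpr.lit 0).eval s) ((NatExpr.lit 0).eval s) with hs₀
    have g0 : s₀.nat vsep 0 = 0 := by simp [hs₀, NatExpr.eval]
    have g1 : s₀.nat vcand = s.nat vcand := State.writeNat_nat_ne (by decide) _ _ _
    have g2 : s₀.nat acand = s.nat acand := State.writeNat_nat_ne (by decide) _ _ _
    have gs : Base p q r lg a s₀ := hs.writeNat _ _ _
    clear_value s₀
    refine (WP.forN (m := s.nat vcand 0 ^ d) (k := (d + 5) * K * lg * r * 4 + 7)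
      (Inv := fun j s' => (s'.nat vsep 0 ≠ 0 →
          Separates p q (candSet n s) (digits n d (s'.nat vsep 0 - 1))) ∧
        (s'.nat vsep 0 = 0 → ∀ j' < j, ¬ Separates p q (candSet n s) (candTuple n d s j')))
      (hc.pow_le hB (Nat.le_succ d)) rfl ?_ ?_ ?_).imp ?_
    · rw [State.writeNat_nat_ne (by decide), g0]
      simp
    · intro j s' _ _ hF
      simp [NatExpr.eval, hF.1 vcand rfl, g1]
    · intro j hj s' hI hF hj'
      have hs' := gs.of_frame hF
      have e1 : s'.nat vcand = s.nat vcand := by rw [hF.1 vcand rfl, g1]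
      have e2 : s'.nat acand = s.nat acand := by rw [hF.1 acand rfl, g2]
      have hc' := hc.congr e1 e2
      have hev := eval_candTupleE hs'.input hc' d
      rw [candTuple_congr e1 e2, hj'] at hev
      have hlt := encode_lt (candTuple n d s j)
      refine WP.mono (k := 1 + ((d + 5) * K * lg * r * 4 + 6)) (WP.seq (WP.setNat ?_ ?_))
        (by omega) fun _ h => h
      · rw [hev]
        exact hlt.le.trans
          ((Nat.pow_le_pow_right (NeZero.pos n) (Nat.le_succ d)).trans hB.codes)
      rw [hev]
      set s₁ := s'.writeNat vc _ (encode (candTuple n d s j)) with hs₁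
      have f1 : s₁.nat vcand = s'.nat vcand := State.writeNat_nat_ne (by decide) _ _ _
      have f2 : s₁.nat acand = s'.nat acand := State.writeNat_nat_ne (by decide) _ _ _
      have f3 : s₁.nat vsep = s'.nat vsep := State.writeNat_nat_ne (by decide) _ _ _
      have f4 : s₁.nat vc 0 = encode (candTuple n d s j) := by simp [hs₁, NatExpr.eval]
      have gs₁ : Base p q r lg a s₁ := hs'.writeNat _ _ _
      clear_value s₁
      refine (checkP_spec hB gs₁ (hc'.congr f1 f2)
        (by rw [f4]; exact hlt)).imp ?_
      rintro s₂ ⟨h1, h2⟩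
      rw [candSet_congr (f1.trans e1) (f2.trans e2), f4, digits_encode] at h1 h2
      rw [State.writeNat_nat_ne (by decide)]
      by_cases hsep : Separates p q (candSet n s) (candTuple n d s j)
      · rw [h1 hsep]
        refine ⟨fun _ => ?_, by simp⟩
        rw [Nat.add_sub_cancel, digits_encode]
        exact hsep
      · rw [h2 hsep, f3]
        refine ⟨hI.1, fun h0 j' hj'' => ?_⟩
        rcases Nat.lt_succ_iff_lt_or_eq.1 hj'' with h' | rfl
        · exact hI.2 h0 j' h'
        · exact hsep
    · rintro s' ⟨h1, h2⟩
      refine ⟨h1, fun h0 b hb => ?_⟩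
      obtain ⟨j, hj, rfl⟩ := exists_candTuple_eq hc hb
      exact h2 h0 j hj
  · have := Nat.mul_le_mul_right ((d + 5) * K * lg * r * 4 + 9) hle
    omega

open Classical in
/-- Only points on the side of `q` are appended to the list of candidates, and all of them are,
unless the list becomes full. -/
theorem extendP_spec (hB : Bounds B n d K r lg) (hs : Base p q r lg a s)
    (hc : CandOK n d K r lg s) :
    WP B (extendP d K) (n * 5 + 2) (fun s' => CandOK n d K r lg s' ∧
      s.nat vcand 0 ≤ s'.nat vcand 0 ∧
      (∀ i < s.nat vcand 0, s'.nat acand i = s.nat acand i) ∧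
      s'.nat vcand 0 ≤ s.nat vcand 0 +
        (Finset.univ.filter (OnSide p q (digits n d (s.nat vsep 0 - 1)))).card ∧
      ∀ x : Fin n, OnSide p q (digits n d (s.nat vsep 0 - 1)) x →
        x ∈ candSet n s' ∨ (d + 5) * K * lg * r ≤ s'.nat vcand 0) s := by
  have hnB : n ≤ B := (Nat.le_self_pow (Nat.succ_ne_zero d) n).trans hB.codes
  have hcB : (d + 5) * K * lg * r ≤ B := (Nat.le_self_pow (Nat.succ_ne_zero d) _).trans hB.cand
  set b := digits n d (s.nat vsep 0 - 1) with hb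
  refine (WP.forN (m := n) (k := 3) (Inv := fun i s' => CandOK n d K r lg s' ∧
      s.nat vcand 0 ≤ s'.nat vcand 0 ∧
      (∀ i < s.nat vcand 0, s'.nat acand i = s.nat acand i) ∧
      s'.nat vcand 0 ≤ s.nat vcand 0 +
        (Finset.univ.filter fun x : Fin n => (x : ℕ) < i ∧ OnSide p q b x).card ∧
      ∀ x : Fin n, (x : ℕ) < i → OnSide p q b x →
        x ∈ candSet n s' ∨ (d + 5) * K * lg * r ≤ s'.nat vcand 0)
      hnB rfl ?_ ?_ ?_).imp ?_
  · have e1 : (s.writeNat vx 0 0).nat vcand = s.nat vcand :=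
      State.writeNat_nat_ne (by decide) _ _ _
    have e2 : (s.writeNat vx 0 0).nat acand = s.nat acand :=
      State.writeNat_nat_ne (by decide) _ _ _
    refine ⟨hc.congr e1 e2, by rw [e1], fun i _ => by rw [e2], by rw [e1]; omega, ?_⟩
    intro x hx
    omega
  · intro i s' _ _ hF
    exact (hs.of_frame hF).input.1
  · rintro i hi s' ⟨h1, h2, h3, h4, h5⟩ hF hi'
    have hs' := hs.of_frame hF
    have e1 : s'.nat vsep = s.nat vsep := hF.1 vsep rfl
    have hside := holds_sideT_iff hs'.input (x := ⟨i, hi⟩)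
      (e := .add (var vx) (.mul (var vn) (.sub (var vsep) (.lit 1)))) (b := s.nat vsep 0 - 1)
      (by simp [NatExpr.eval, hs'.input.1, hi', e1])
    rw [← hb] at hside
    have hsub : (Finset.univ.filter fun x : Fin n => (x : ℕ) < i ∧ OnSide p q b x) ⊆
        Finset.univ.filter fun x : Fin n => (x : ℕ) < i + 1 ∧ OnSide p q b x := by
      intro x
      simp only [Finset.mem_filter, Finset.mem_univ, true_and]
      exact fun h => ⟨by omega, h.2⟩
    refine WP.ite (k := 2) (fun ht => ?_) (fun ht => ?_)
    · simp only [Test.holds, hs'.eval_candMaxE, NatExpr.eval, not_le] at ht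
      obtain ⟨ht1, ht2⟩ := ht
      have ht1 := hside.1 ht1
      refine WP.seq (k := 1) (k' := 1)
        (WP.setNat (by simp only [NatExpr.eval, hi']; omega) (WP.setNat ?_ ?_))
      · simp +decide only [NatExpr.eval, State.writeNat_apply]
        simp only [false_and, if_false]
        omega
      · set s₁ := State.writeNat _ _ _ _ with hs₁
        have f1 : s₁.nat vcand 0 = s'.nat vcand 0 + 1 := by
          simp +decide [hs₁, NatExpr.eval, State.writeNat_apply]
        have f2 : ∀ j, s₁.nat acand j = if j = s'.nat vcand 0 then i else s'.nat acand j :=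
          fun j => by simp +decide [hs₁, NatExpr.eval, State.writeNat_apply, hi']
        clear_value s₁
        have f3 : ∀ x ∈ candSet n s', x ∈ candSet n s₁ := by
          rintro x ⟨j, hj, hx⟩
          exact ⟨j, by omega, by rw [f2, if_neg hj.ne, hx]⟩
        refine ⟨⟨by omega, by omega, fun j hj => ?_⟩, by omega, fun j hj => ?_, ?_, ?_⟩
        · rw [f2]
          split_ifs with h
          · exact hi
          · exact h1.lt j (by omega)
        · rw [f2, if_neg (by omega), h3 j hj]
        · have hss : (Finset.univ.filter fun x : Fin n => (x : ℕ) < i ∧ OnSide p q b x) ⊂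
              Finset.univ.filter fun x : Fin n => (x : ℕ) < i + 1 ∧ OnSide p q b x := by
            refine (Finset.ssubset_iff_of_subset hsub).2 ⟨⟨i, hi⟩, ?_, ?_⟩
            · simp [ht1]
            · simp
          have := Finset.card_lt_card hss
          omega
        · intro x hx hxs
          rcases Nat.lt_succ_iff_lt_or_eq.1 hx with h' | h'
          · exact (h5 x h' hxs).imp (f3 x) (by omega)
          · exact Or.inl ⟨s'.nat vcand 0, by omega, by rw [f2, if_pos rfl, h']⟩
    · simp only [Test.holds, hs'.eval_candMaxE, NatExpr.eval, not_and, not_not] at ht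
      refine WP.mono (WP.skip ?_) one_le_two fun _ h => h
      have e1 : (s'.writeNat vx 0 (i + 1)).nat vcand = s'.nat vcand :=
        State.writeNat_nat_ne (by decide) _ _ _
      have e2 : (s'.writeNat vx 0 (i + 1)).nat acand = s'.nat acand :=
        State.writeNat_nat_ne (by decide) _ _ _
      refine ⟨h1.congr e1 e2, by rw [e1]; exact h2, fun j hj => by rw [e2]; exact h3 j hj, ?_, ?_⟩
      · rw [e1]
        exact h4.trans (Nat.add_le_add_left (Finset.card_le_card hsub) _)
      · intro x hx hxs
        rw [candSet_congr e1 e2, e1]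
        rcases Nat.lt_succ_iff_lt_or_eq.1 hx with h' | h'
        · exact h5 x h' hxs
        · have : x = ⟨i, hi⟩ := Fin.ext h'
          rw [this] at hxs
          exact Or.inr (ht (hside.2 hxs))
  · rintro s' ⟨h1, h2, h3, h4, h5⟩
    refine ⟨h1, h2, h3, h4.trans (Nat.add_le_add_left (Finset.card_le_card ?_) _),
      fun x => h5 x x.2⟩
    intro x
    simp

end RealRAM

/-! ### The search for feasible tuples -/

namespace RealRAM

open FeasibleBasis Function

variable {n d K r lg B : ℕ} {p : Fin n → EuclideanSpace ℝ (Fin d)}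
  {q : EuclideanSpace ℝ (Fin d)} {a : ℕ → ℕ} {s s' : State}

open Classical in
/-- The situation in which the search for feasible tuples is complete: the points are in general
position, also together with `q`, there are enough of them, and the points `a i % n` with `i < r`
meet all sets of more than `m` points that are cut off by a hyperplane on the side of `q`. -/
structure Searchable (p : Fin n → EuclideanSpace ℝ (Fin d)) (q : EuclideanSpace ℝ (Fin d))
    (a : ℕ → ℕ) (r m : ℕ) : Prop where
  injective : Injective p
  basis : ∀ t : Fin (d + 1) → Fin n, Injective t → rowDet ((homog ∘ p) ∘ t) ≠ 0
  update : ∀ t : Fin (d + 1) → Fin n, Injective t → ∀ k,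
    rowDet (update ((homog ∘ p) ∘ t) k (homog q)) ≠ 0
  lt_scale : d + 1 ≤ r
  lt_card : d + 1 ≤ n
  net : ∀ b : Fin d → Fin n, m < (Finset.univ.filter (OnSide p q b)).card →
    ∃ i < r, ∃ x : Fin n, a i % n = x ∧ OnSide p q b x

/-- If no tuple of candidates is feasible, then there is a separating tuple of candidates. -/
theorem Searchable.exists_separates (hG : Searchable p q a r (K * lg * r))
    (hr : 2 * r ≤ s.nat vcand 0) (hi : CandInit n r a (s.nat acand))
    (hno : ∀ t : Fin (d + 1) → Fin n, (∀ k, t k ∈ candSet n s) →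
      ¬ Feasible (homog ∘ p) (homog q) t) :
    ∃ b : Fin d → Fin n, (∀ k, b k ∈ candSet n s) ∧ Separates p q (candSet n s) b := by
  classical
  have hcard : d + 1 ≤ (Finset.univ.filter (· ∈ candSet n s)).card := by
    rw [← Fintype.card_fin (d + 1), ← Finset.card_univ]
    refine Finset.card_le_card_of_injOn (fun i => Fin.castLE hG.lt_card i) (fun i _ => ?_)
      (Fin.castLE_injective hG.lt_card).injOn
    have h1 := i.2
    have h2 := hG.lt_scale
    have h3 := hG.lt_card
    simp only [Finset.coe_filter, Finset.mem_univ, true_and, Set.mem_ofPred_eq]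
    refine ⟨2 * i, by omega, ?_⟩
    rw [(hi i (by omega)).1, Nat.mod_eq_of_lt (by omega)]
    rfl
  obtain ⟨b, hb, h1, h2⟩ := exists_separating_tuple hG.basis hG.update hG.injective hcard
    (fun t ht => hno t fun k => by simpa using ht k)
  exact ⟨b, fun k => by simpa using hb k, h1, fun x hx => not_lt.2 (h2 x (by simpa using hx))⟩

open Classical in
/-- If the candidates are extended by all points on the side of `q` of a hyperplane that has no
candidates on this side, then the number of candidates does not grow much, because the net meets
all large sets of this kind, and each feasible tuple gets one more candidate. -/
theorem Searchable.extend (hG : Searchable p q a r (K * lg * r)) (hK : 1 ≤ K * lg)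
    (hr : 2 * r ≤ s.nat vcand 0) (hi : CandInit n r a (s.nat acand)) {k : ℕ} (hk : k < d + 2)
    (hv : s.nat vcand 0 ≤ 2 * r + k * (K * lg * r))
    (hcount : ∀ t, Feasible (homog ∘ p) (homog q) t →
      k ≤ (Finset.univ.filter fun j => t j ∈ candSet n s).card)
    {b : Fin d → Fin n} (hsep : Separates p q (candSet n s) b)
    (hle : s.nat vcand 0 ≤ s'.nat vcand 0)
    (hpre : ∀ i < s.nat vcand 0, s'.nat acand i = s.nat acand i)
    (hnew : s'.nat vcand 0 ≤ s.nat vcand 0 + (Finset.univ.filter (OnSide p q b)).card)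
    (hall : ∀ x, OnSide p q b x →
      x ∈ candSet n s' ∨ (d + 5) * K * lg * r ≤ s'.nat vcand 0) :
    s'.nat vcand 0 ≤ 2 * r + (k + 1) * (K * lg * r) ∧
      ∀ t, Feasible (homog ∘ p) (homog q) t →
        k + 1 ≤ (Finset.univ.filter fun j => t j ∈ candSet n s').card := by
  have hcard : (Finset.univ.filter (OnSide p q b)).card ≤ K * lg * r := by
    by_contra! h
    obtain ⟨i, hir, x, hx, hs⟩ := hG.net b h
    exact hsep.2 x ⟨2 * i + 1, by omega, by rw [(hi i hir).2, hx]⟩ hs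
  have hv' : s'.nat vcand 0 ≤ 2 * r + (k + 1) * (K * lg * r) := by
    rw [add_mul]; omega
  have hr0 : 0 < r := by have := hG.lt_scale; omega
  -- The list of candidates is not full: there are at most `2 * r` candidates to begin with, and at
  -- most `K * lg * r` new ones in each of the at most `d + 2` rounds.
  have hlt : s'.nat vcand 0 < (d + 5) * K * lg * r := by
    refine hv'.trans_lt ?_
    have h1 : (k + 1) * (K * lg * r) ≤ (d + 2) * (K * lg * r) := Nat.mul_le_mul_right _ hk
    have h2 : 1 * r ≤ K * lg * r := Nat.mul_le_mul_right _ hK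
    have h3 : (d + 5) * K * lg * r = (d + 2) * (K * lg * r) + 3 * (K * lg * r) := by ring
    omega
  have hsub : candSet n s ⊆ candSet n s' := by
    rintro x ⟨i, hi, hx⟩
    exact ⟨i, by omega, by rw [hpre i hi, hx]⟩
  refine ⟨hv', fun t ht => ?_⟩
  obtain ⟨j, hj⟩ := exists_vertex_on_side ht hsep.1
  have h1 : t j ∈ candSet n s' := (hall _ hj).resolve_right (by omega)
  have h2 : t j ∉ candSet n s := fun h => hsep.2 _ h hj
  refine (hcount t ht).trans_lt (Finset.card_lt_card ((Finset.ssubset_iff_of_subset ?_).2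
    ⟨j, by simpa using h1, by simpa using h2⟩))
  intro i
  simpa using fun h => hsub h

/-- The code of the tuple that arises from the tuple with code `c` by deletion of the first point
and insertion of the point `x` at the end. -/
def shiftCode (n d c x : ℕ) : ℕ := c / n + x * n ^ d

theorem shiftCode_lt {c x : ℕ} (hc : c < n ^ (d + 1)) (hx : x < n) :
    shiftCode n d c x < n ^ (d + 1) := by
  have h1 : c / n < n ^ d := Nat.div_lt_of_lt_mul (by rwa [pow_succ'] at hc)
  have h2 : (x + 1) * n ^ d ≤ n * n ^ d := Nat.mul_le_mul_right _ hx
  rw [shiftCode, pow_succ']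
  rw [add_mul, one_mul] at h2
  omega

/-- The output is computed from the length of the queue, if this does not exceed the cap, and from
the number of hits otherwise. -/
theorem outputP_spec (hs : Base p q r lg a s) :
    WP B (outputP d K) 2 (fun s' =>
      (s.nat vtail 0 ≤ r ^ d ∧
        s'.real 2 0 = (s.nat vtail 0 : ℝ) / ((d + 1).factorial : ℕ)) ∨
      (r ^ d < s.nat vtail 0 ∧ s'.real 2 0 = (s.nat vhits 0 : ℝ) * (n ^ (d + 1) : ℕ) /
        ((K * lg * r ^ (d + 2) * (d + 1).factorial : ℕ) : ℝ))) s := by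
  refine WP.ite (k := 1) (fun ht => ?_) (fun ht => ?_)
  · simp only [Test.holds, NatExpr.eval, hs.eval_capE] at ht
    refine WP.setReal (Or.inl ⟨ht, ?_⟩)
    simp [State.writeReal, RealExpr.eval, NatExpr.eval]
  · simp only [Test.holds, NatExpr.eval, hs.eval_capE, not_le] at ht
    refine WP.setReal (Or.inr ⟨ht, ?_⟩)
    have h := hs.eval_drawsE (K := K)
    simp [State.writeReal, RealExpr.eval, NatExpr.eval, hs.input.1, h]

variable [NeZero n]

open Classical in
/-- The state before round `k`: either no feasible tuple has been found, but each feasible tuple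
has at least `k` of its points among the candidates, or the queue consists of the feasible tuples
of candidates. -/
structure RoundInv (p : Fin n → EuclideanSpace ℝ (Fin d)) (q : EuclideanSpace ℝ (Fin d))
    (a : ℕ → ℕ) (K r lg k : ℕ) (s : State) : Prop where
  table : TableOK p q r s
  cand : CandOK n d K r lg s
  le : 2 * r ≤ s.nat vcand 0
  init : CandInit n r a (s.nat acand)
  progress : Searchable p q a r (K * lg * r) → s.nat vtail 0 ≤ r ^ d →
    (s.nat vtail 0 = 0 ∧ s.nat vcand 0 ≤ 2 * r + k * (K * lg * r) ∧
      ∀ t, Feasible (homog ∘ p) (homog q) t →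
        k ≤ (Finset.univ.filter fun j => t j ∈ candSet n s).card) ∨
    (0 < s.nat vtail 0 ∧ ∀ c, Seen s c ↔ FeasibleCode p q c ∧
      ∀ j, digits n (d + 1) c j ∈ candSet n s)

theorem RoundInv.congr {k : ℕ} (h : RoundInv p q a K r lg k s)
    (h1 : s'.nat vtail = s.nat vtail) (h2 : s'.nat aqueue = s.nat aqueue)
    (h3 : s'.nat amark = s.nat amark) (h4 : s'.nat vcand = s.nat vcand)
    (h5 : s'.nat acand = s.nat acand) : RoundInv p q a K r lg k s' := by
  refine ⟨h.table.congr h1 h2 h3, h.cand.congr h4 h5, by rw [h4]; exact h.le,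
    by rw [h5]; exact h.init, fun hG => ?_⟩
  rw [h1, h4, candSet_congr h4 h5]
  simp only [Seen.congr h1 h2]
  exact h.progress hG

theorem RoundInv.writeNat {k : ℕ} (h : RoundInv p q a K r lg k s) (v : ℕ) :
    RoundInv p q a K r lg k (s.writeNat vround 0 v) :=
  h.congr (State.writeNat_nat_ne (by decide) _ _ _) (State.writeNat_nat_ne (by decide) _ _ _)
    (State.writeNat_nat_ne (by decide) _ _ _) (State.writeNat_nat_ne (by decide) _ _ _)
    (State.writeNat_nat_ne (by decide) _ _ _)

/-- A bound for the number of steps of a round. -/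
def roundSteps (n d K r lg : ℕ) : ℕ :=
  ((d + 5) * K * lg * r) ^ (d + 1) * 7 + 2 +
    (((d + 5) * K * lg * r) ^ d * ((d + 5) * K * lg * r * 4 + 9) + 3 + (n * 5 + 2 + 1) + 1)

/-- If the queue is still empty after the candidates have been tested, then, under the assumptions
of `Searchable`, there is a separating tuple, and the extension of the candidates makes progress. As
soon as there is something in the queue, the candidates do not change any more. -/
theorem round_spec (hB : Bounds B n d K r lg) (hK : 1 ≤ K * lg) {k : ℕ} (hk : k < d + 2)
    (hs : Base p q r lg a s) (hI : RoundInv p q a K r lg k s) :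
    WP B (.seq (seedP d) (.ite (.natLe (var vtail) (.lit 0))
      (.seq (separateP d) (.ite (.natLe (.lit 1) (var vsep)) (extendP d K) .skip)) .skip))
      (roundSteps n d K r lg) (RoundInv p q a K r lg (k + 1)) s := by
  classical
  refine WP.seq ((seedP_spec hB hs hI.table hI.cand).frame.imp ?_)
  rintro s₁ ⟨⟨hT₁, hmono, hseen⟩, hF₁⟩
  have hs₁ := hs.of_frame hF₁
  have e4 : s₁.nat vcand = s.nat vcand := hF₁.1 vcand rfl
  have e5 : s₁.nat acand = s.nat acand := hF₁.1 acand rfl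
  have hC₁ := hI.cand.congr e4 e5
  have hle₁ : 2 * r ≤ s₁.nat vcand 0 := by rw [e4]; exact hI.le
  have hi₁ : CandInit n r a (s₁.nat acand) := by rw [e5]; exact hI.init
  rw [← candSet_congr e4 e5] at hseen
  -- If there is something in the queue, then it consists of the feasible tuples of candidates.
  have hfound : Searchable p q a r (K * lg * r) → s₁.nat vtail 0 ≤ r ^ d →
      ∀ c, Seen s₁ c ↔ FeasibleCode p q c ∧ ∀ j, digits n (d + 1) c j ∈ candSet n s₁ := by
    intro hG hle c
    rw [hseen hle]
    rcases hI.progress hG (hmono.trans hle) with ⟨h0, -⟩ | ⟨-, h⟩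
    · refine or_iff_right ?_
      rintro ⟨i, hi, -⟩
      omega
    · rw [h, candSet_congr e4 e5, or_self]
  refine WP.ite (fun ht => ?_) (fun ht => ?_)
  · simp only [Test.holds, NatExpr.eval, nonpos_iff_eq_zero] at ht
    refine WP.seq ((separateP_spec hB hs₁ hC₁).frame.imp ?_)
    rintro s₂ ⟨⟨hsep, hnosep⟩, hF₂⟩
    have hs₂ := hs₁.of_frame hF₂
    have g4 : s₂.nat vcand = s₁.nat vcand := hF₂.1 vcand rfl
    have g5 : s₂.nat acand = s₁.nat acand := hF₂.1 acand rfl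
    have hno : Searchable p q a r (K * lg * r) → ∀ t : Fin (d + 1) → Fin n,
        (∀ k, t k ∈ candSet n s₁) → ¬ Feasible (homog ∘ p) (homog q) t := by
      intro hG t ht' hf
      obtain ⟨i, hi, -⟩ := (hfound hG (by omega) (encode t)).2
        ⟨⟨encode_lt t, by rwa [digits_encode]⟩, by rwa [digits_encode]⟩
      omega
    refine WP.ite (fun ht' => ?_) (fun ht' => ?_)
    · simp only [Test.holds, NatExpr.eval] at ht'
      refine (extendP_spec hB hs₂ (hC₁.congr g4 g5)).frame.imp ?_
      rintro s₃ ⟨⟨h1, h2, h3, h4, h5⟩, hF₃⟩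
      have f1 : s₃.nat vtail = s₁.nat vtail := (hF₃.1 vtail rfl).trans (hF₂.1 vtail rfl)
      have f2 : s₃.nat aqueue = s₁.nat aqueue := (hF₃.1 aqueue rfl).trans (hF₂.1 aqueue rfl)
      have f3 : s₃.nat amark = s₁.nat amark := (hF₃.1 amark rfl).trans (hF₂.1 amark rfl)
      rw [g4, g5] at h3
      rw [g4] at h2 h4
      refine ⟨hT₁.congr f1 f2 f3, h1, hle₁.trans h2, ?_, fun hG _ => Or.inl ?_⟩
      · intro i hi
        rw [h3 _ (by omega), h3 _ (by omega)]
        exact hi₁ i hi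
      · refine ⟨by rw [f1, ht], ?_⟩
        have hv : s₁.nat vcand 0 ≤ 2 * r + k * (K * lg * r) := by
          rcases hI.progress hG (by omega) with ⟨-, h, -⟩ | ⟨h, -⟩
          · rwa [e4]
          · omega
        have hcount : ∀ t, Feasible (homog ∘ p) (homog q) t →
            k ≤ (Finset.univ.filter fun j => t j ∈ candSet n s₁).card := by
          rcases hI.progress hG (by omega) with ⟨-, -, h⟩ | ⟨h, -⟩
          · rwa [candSet_congr e4 e5]
          · omega
        exact hG.extend hK hle₁ hi₁ hk hv hcount (hsep (by omega)) h2 h3 h4 h5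
    · simp only [Test.holds, NatExpr.eval, not_le, Nat.lt_one_iff] at ht'
      refine WP.mono (WP.skip ?_) (by omega) fun _ h => h
      refine RoundInv.congr ⟨hT₁, hC₁, hle₁, hi₁, fun hG _ => ?_⟩ (hF₂.1 vtail rfl)
        (hF₂.1 aqueue rfl) (hF₂.1 amark rfl) g4 g5
      obtain ⟨b, hb, hb'⟩ := hG.exists_separates hle₁ hi₁ (hno hG)
      exact (hnosep ht' b hb hb').elim
  · simp only [Test.holds, NatExpr.eval, nonpos_iff_eq_zero] at ht
    refine WP.mono (WP.skip ?_) (by omega) fun _ h => h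
    exact ⟨hT₁, hC₁, hle₁, hi₁, fun hG hle => Or.inr ⟨by omega, hfound hG hle⟩⟩

/-- Under the assumptions of `Searchable`, and as long as the queue is not too long, a feasible
tuple is found if there is one. The set `V` consists of the final candidates. That the queue
contains all feasible tuples with entries in `V` ensures that it contains all permutations of its
entries. -/
theorem roundsP_spec (hB : Bounds B n d K r lg) (hK : 1 ≤ K * lg)
    (hs : Base p q r lg a s) (hI : RoundInv p q a K r lg 0 s) :
    WP B (roundsP d K) ((d + 2) * (roundSteps n d K r lg + 2) + 2)
      (fun s' => TableOK p q r s' ∧ (Searchable p q a r (K * lg * r) → s'.nat vtail 0 ≤ r ^ d →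
        (∀ t, ¬ Feasible (homog ∘ p) (homog q) t) ∨
        ∃ V : Set (Fin n), 0 < s'.nat vtail 0 ∧ ∀ c, Seen s' c ↔ FeasibleCode p q c ∧
          ∀ j, digits n (d + 1) c j ∈ V)) s := by
  refine (WP.forN (m := d + 2) (Inv := fun k => RoundInv p q a K r lg k) hB.rounds rfl
    (hI.writeNat _) (fun _ _ _ _ _ => rfl) (fun k hk s' hI' hF _ => ?_)).imp ?_
  · exact (round_spec hB hK hk (hs.of_frame hF) hI').imp fun s' h => h.writeNat _
  · intro s' h
    refine ⟨h.table, fun hG hle => ?_⟩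
    rcases h.progress hG hle with ⟨-, -, h1⟩ | h1
    · refine Or.inl fun t ht => ?_
      classical
      -- A tuple has only `d + 1` entries.
      have h2 := (h1 t ht).trans (Finset.card_filter_le _ _)
      simp at h2
    · exact Or.inr ⟨_, h1⟩

/-- A search that is closed under shifts and contains all permutations of a feasible tuple is
complete. -/
theorem Searchable.eq_card {m : ℕ} (hG : Searchable p q a r m) (hT : Table p q s)
    (hstart : (∀ t, ¬ Feasible (homog ∘ p) (homog q) t) ∨
      ∃ (V : Set (Fin n)) (c₀ : ℕ), FeasibleCode p q c₀ ∧ (∀ j, digits n (d + 1) c₀ j ∈ V) ∧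
        ∀ c, FeasibleCode p q c → (∀ j, digits n (d + 1) c j ∈ V) → Seen s c)
    (hshift : ∀ c, Seen s c → ∀ x < n, FeasibleCode p q (shiftCode n d c x) →
      Seen s (shiftCode n d c x)) : s.nat vtail 0 = feasibleCard p q := by
  refine hT.eq_card fun c hc => ?_
  rcases hstart with h | ⟨V, c₀, h0, h0V, hV⟩
  · exact (h _ hc.2).elim
  have h1 : digits n (d + 1) c ∈ {t | Seen s (encode t)} := by
    refine mem_of_shift_closed hG.basis hG.update ?_ ?_ (s₀ := digits n (d + 1) c₀) ?_ hc.2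
    · intro t ht
      have := (hT.feasible _ ht).2
      rwa [digits_encode] at this
    · intro t ht x hx
      have h2 := digits_shift (encode_lt t) x
      rw [digits_encode] at h2
      have h3 : encode (Fin.snoc (Fin.tail t) x : Fin (d + 1) → Fin n) =
          shiftCode n d (encode t) x := by
        rw [← h2]
        exact encode_digits (shiftCode_lt (encode_lt t) x.2)
      have h4 := hshift _ ht x x.2 ⟨shiftCode_lt (encode_lt t) x.2, by
        rw [shiftCode, h2]; exact hx⟩
      rw [← h3] at h4
      exact h4
    · intro π
      have h2 := h0.2.perm hG.basis π
      refine hV _ ⟨encode_lt _, by rwa [digits_encode]⟩ fun j => ?_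
      rw [digits_encode]
      exact h0V (π j)
  rw [Set.mem_ofPred_eq, encode_digits hc.1] at h1
  exact h1

/-- Unless the queue becomes too long, it is closed under shifts in the end. -/
theorem searchP_spec (hB : Bounds B n d K r lg) (hs : Base p q r lg a s) (hT : TableOK p q r s) :
    WP B (searchP d) (r ^ d * n * 7 + 2) (fun s' => TableOK p q r s' ∧
      s.nat vtail 0 ≤ s'.nat vtail 0 ∧ (s'.nat vtail 0 ≤ r ^ d →
        (∀ c, Seen s c → Seen s' c) ∧
        ∀ c, Seen s' c → ∀ x < n, FeasibleCode p q (shiftCode n d c x) →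
          Seen s' (shiftCode n d c x))) s := by
  have hn := NeZero.pos n
  have hnB : n ≤ B := (Nat.le_self_pow (Nat.succ_ne_zero d) n).trans hB.codes
  refine WP.mono (k := 1 + (r ^ d * n * (6 + 1) + 1))
    (WP.seq (WP.setNat (by simp [NatExpr.eval]) ?_)) (by omega) fun _ h => h
  set s₀ := s.writeNat vi ((NatExpr.lit 0).eval s) ((NatExpr.lit 0).eval s) with hs₀
  have e0 : s₀.nat vi 0 = 0 := by simp [hs₀, NatExpr.eval]
  have e1 : s₀.nat vtail = s.nat vtail := State.writeNat_nat_ne (by decide) _ _ _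
  have e2 : s₀.nat aqueue = s.nat aqueue := State.writeNat_nat_ne (by decide) _ _ _
  have e3 : s₀.nat amark = s.nat amark := State.writeNat_nat_ne (by decide) _ _ _
  have hb₀ : Base p q r lg a s₀ := hs.writeNat _ _ _
  clear_value s₀
  -- The invariant says that the first `vi` pairs of an entry of the queue and a point have been
  -- treated.
  refine (WP.while (k := 6) (m := r ^ d * n) (Inv := fun s' => Base p q r lg a s' ∧
    TableOK p q r s' ∧ s.nat vtail 0 ≤ s'.nat vtail 0 ∧ (s'.nat vtail 0 ≤ r ^ d →
      (∀ c, Seen s c → Seen s' c) ∧ s'.nat vi 0 ≤ s'.nat vtail 0 * n ∧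
      ∀ i < s'.nat vi 0, FeasibleCode p q (shiftCode n d (s'.nat aqueue (i / n)) (i % n)) →
        Seen s' (shiftCode n d (s'.nat aqueue (i / n)) (i % n))))
    (fun s' => r ^ d * n - s'.nat vi 0) ?_ ?_ (Nat.sub_le _ _)).imp ?_
  · rintro s₁ ⟨hb, hT₁, hmono, hI⟩ ht
    simp only [Test.holds, NatExpr.eval, hb.eval_capE, hb.input.1, not_le] at ht
    obtain ⟨hlt, hle⟩ := ht
    obtain ⟨hI1, hI2, hI3⟩ := hI hle
    have hlt' : s₁.nat vi 0 < r ^ d * n := hlt.trans_le (Nat.mul_le_mul_right _ hle)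
    have htab : Table p q s₁ := by
      rcases hT₁ with ⟨h, -⟩ | ⟨-, h⟩
      · omega
      · exact h
    have hi : s₁.nat vi 0 / n < s₁.nat vtail 0 := Nat.div_lt_of_lt_mul (by rwa [mul_comm])
    have hcode := (htab.feasible _ ⟨_, hi, rfl⟩).1
    have hnew := shiftCode_lt hcode (Nat.mod_lt (s₁.nat vi 0) hn)
    have hev : (NatExpr.add (.div (.load aqueue (.div (var vi) (var vn))) (var vn))
        (.mul (.mod (var vi) (var vn)) (powE (var vn) d))).eval s₁ =
        shiftCode n d (s₁.nat aqueue (s₁.nat vi 0 / n)) (s₁.nat vi 0 % n) := by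
      simp [NatExpr.eval, hb.input.1, shiftCode]
    refine WP.seq (k := 1) (k' := 5) (WP.setNat (by rw [hev]; exact hnew.le.trans hB.codes) ?_)
    rw [hev]
    set s₂ := s₁.writeNat vc _ _ with hs₂
    have f0 : s₂.nat vi = s₁.nat vi := State.writeNat_nat_ne (by decide) _ _ _
    have f1 : s₂.nat vtail = s₁.nat vtail := State.writeNat_nat_ne (by decide) _ _ _
    have f2 : s₂.nat aqueue = s₁.nat aqueue := State.writeNat_nat_ne (by decide) _ _ _
    have f3 : s₂.nat amark = s₁.nat amark := State.writeNat_nat_ne (by decide) _ _ _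
    have f4 : s₂.nat vc 0 = shiftCode n d (s₁.nat aqueue (s₁.nat vi 0 / n)) (s₁.nat vi 0 % n) := by
      simp [hs₂, NatExpr.eval]
    have hb₂ : Base p q r lg a s₂ := hb.writeNat _ _ _
    clear_value s₂
    refine WP.seq (k := 4) (k' := 1) ((pushP_spec hB hb₂ (hT₁.congr f1 f2 f3)
      (by rw [f4]; exact hnew)).frame.imp ?_)
    rintro s₃ ⟨⟨h1, h2, h3, h4⟩, hF⟩
    have hb₃ := hb₂.of_frame hF
    have g0 : s₃.nat vi = s₁.nat vi := (hF.1 vi rfl).trans f0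
    rw [f1] at h2 h3
    rw [f2] at h3
    rw [f4] at h4
    refine WP.setNat ?_ ?_
    · simp only [NatExpr.eval, g0]
      have := hB.queue
      omega
    set s₄ := s₃.writeNat vi _ _ with hs₄
    have k0 : s₄.nat vi 0 = s₁.nat vi 0 + 1 := by simp [hs₄, NatExpr.eval, g0]
    have k1 : s₄.nat vtail = s₃.nat vtail := State.writeNat_nat_ne (by decide) _ _ _
    have k2 : s₄.nat aqueue = s₃.nat aqueue := State.writeNat_nat_ne (by decide) _ _ _
    have k3 : s₄.nat amark = s₃.nat amark := State.writeNat_nat_ne (by decide) _ _ _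
    have hb₄ : Base p q r lg a s₄ := hb₃.writeNat _ _ _
    clear_value s₄
    have hS := Seen.congr k1 k2
    refine ⟨⟨hb₄, h1.congr k1 k2 k3, by rw [k1]; omega, fun hle' => ?_⟩, by omega⟩
    rw [k1] at hle'
    have h4' := h4 hle'
    simp only [Seen.congr f1 f2] at h4'
    refine ⟨fun c hc => ?_, ?_, fun i hi' hf => ?_⟩
    · rw [hS, h4']
      exact Or.inl (hI1 c hc)
    · rw [k0, k1]
      exact hlt.trans_le (Nat.mul_le_mul_right _ h2)
    · rw [k0] at hi'
      have hin : i / n < s₁.nat vtail 0 := (Nat.div_le_div_right (by omega)).trans_lt hi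
      rw [k2, h3 _ hin] at hf ⊢
      rw [hS, h4']
      rcases Nat.lt_succ_iff_lt_or_eq.1 hi' with h' | rfl
      · exact Or.inl (hI3 i h' hf)
      · exact Or.inr ⟨rfl, hf⟩
  · refine ⟨hb₀, hT.congr e1 e2 e3, by rw [e1], fun _ => ⟨fun c hc => ?_, by omega, ?_⟩⟩
    · rwa [Seen.congr e1 e2]
    · intro i hi
      omega
  · rintro s' ⟨⟨hb, hT', hmono, hI⟩, ht⟩
    refine ⟨hT', hmono, fun hle => ?_⟩
    obtain ⟨hI1, -, hI3⟩ := hI hle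
    simp only [Test.holds, NatExpr.eval, hb.eval_capE, hb.input.1, not_le, not_and] at ht
    have ht' : s'.nat vtail 0 * n ≤ s'.nat vi 0 := by
      by_contra! h
      exact absurd (ht h) (by omega)
    refine ⟨hI1, ?_⟩
    rintro c ⟨i, hi, rfl⟩ x hx hf
    have h1 : (n * i + x) / n = i := by
      rw [Nat.mul_add_div hn, Nat.div_eq_of_lt hx, add_zero]
    have h2 : (n * i + x) % n = x := by
      rw [Nat.mul_add_mod, Nat.mod_eq_of_lt hx]
    have h3 : n * i + x < s'.nat vi 0 := by
      refine lt_of_lt_of_le ?_ ht'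
      have := Nat.mul_le_mul_left n (Nat.succ_le_of_lt hi)
      rw [Nat.succ_eq_add_one, mul_add, mul_one, mul_comm n (s'.nat vtail 0)] at this
      omega
    have h4 := hI3 _ h3
    rw [h1, h2] at h4
    exact h4 hf

/-- A bound for the number of steps after the random draws. -/
def mainSteps (n d K r lg : ℕ) : ℕ :=
  K * lg * r ^ (d + 2) * 4 + 2 + (n * 4 + 2 + (r * 4 + 3 +
    ((d + 2) * (roundSteps n d K r lg + 2) + 2 + (r ^ d * n * 7 + 2 + 2))))

/-- The output is the exact number of feasible tuples, or the estimate from the random sample, which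
is only used if there are many feasible tuples or `q` is one of the points. -/
theorem mainP_spec (hB : Bounds B n d K r lg) (hK : 1 ≤ K * lg) (hr : 0 < r)
    (hs : Base p q r lg a s) (hh : s.nat vhits 0 = 0) (ht : s.nat vtail 0 = 0)
    (hm : ∀ c, s.nat amark c = 0) :
    WP B (mainP d K) (mainSteps n d K r lg) (fun s' =>
      ((∀ i, p i ≠ q) ∧ ∃ T : ℕ, s'.real 2 0 = (T : ℝ) / ((d + 1).factorial : ℕ) ∧
        (Searchable p q a r (K * lg * r) → T = feasibleCard p q)) ∨
      ((r ^ d < feasibleCard p q ∨ ∃ i, p i = q) ∧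
        s'.real 2 0 = (hitCount p q a (K * lg * r ^ (d + 2)) : ℝ) * (n ^ (d + 1) : ℕ) /
          ((K * lg * r ^ (d + 2) * (d + 1).factorial : ℕ) : ℝ))) s := by
  have h2r : 2 * r ≤ (d + 5) * K * lg * r := by
    rw [mul_assoc (d + 5)]
    exact Nat.mul_le_mul_right _ ((show 2 ≤ (d + 5) * 1 by omega).trans
      (Nat.mul_le_mul_left _ hK))
  have hcB : (d + 5) * K * lg * r ≤ B := (Nat.le_self_pow (Nat.succ_ne_zero d) _).trans hB.cand
  refine WP.seq ((countP_spec hB hs hh).frame.imp ?_)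
  rintro s₁ ⟨hhits, hF₁⟩
  have hs₁ := hs.of_frame hF₁
  refine WP.seq ((flagP_spec hB hs₁ (by rw [hF₁.1 vtail rfl, ht])
    (fun c => by rw [hF₁.1 amark rfl, hm])).frame.imp ?_)
  rintro s₂ ⟨⟨hT, hT0⟩, hF₂⟩
  have hs₂ := hs₁.of_frame hF₂
  refine WP.seq ((candP_spec hB hs₂ (h2r.trans hcB)).frame.imp ?_)
  rintro s₃ ⟨⟨hv, hc⟩, hF₃⟩
  have hs₃ := hs₂.of_frame hF₃
  have e1 : s₃.nat vtail = s₂.nat vtail := hF₃.1 vtail rfl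
  have hI : RoundInv p q a K r lg 0 s₃ := by
    refine ⟨hT.congr e1 (hF₃.1 aqueue rfl) (hF₃.1 amark rfl), ⟨by omega, by omega, ?_⟩, hv.ge, hc,
      fun _ hle => Or.inl ⟨?_, by omega, fun t _ => Nat.zero_le _⟩⟩
    · intro i hi
      rw [hv] at hi
      have h1 := hc (i / 2) (by omega)
      rcases Nat.mod_two_eq_zero_or_one i with h | h
      · rw [← Nat.div_add_mod i 2, h, add_zero, h1.1]
        exact Nat.mod_lt _ (NeZero.pos n)
      · rw [← Nat.div_add_mod i 2, h, h1.2]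
        exact Nat.mod_lt _ (NeZero.pos n)
    · rw [e1] at hle ⊢
      exact hT0 hle
  refine WP.seq ((roundsP_spec hB hK hs₃ hI).frame.imp ?_)
  rintro s₄ ⟨⟨hT₄, hG₄⟩, hF₄⟩
  have hs₄ := hs₃.of_frame hF₄
  refine WP.seq ((searchP_spec hB hs₄ hT₄).frame.imp ?_)
  rintro s₅ ⟨⟨hT₅, hmono, hclosed⟩, hF₅⟩
  have hs₅ := hs₄.of_frame hF₅
  refine (outputP_spec hs₅).imp ?_
  have hhits₅ : s₅.nat vhits 0 = hitCount p q a (K * lg * r ^ (d + 2)) := by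
    rw [hF₅.1 vhits rfl, hF₄.1 vhits rfl, hF₃.1 vhits rfl, hF₂.1 vhits rfl, hhits]
  rintro s' (⟨hle, hout⟩ | ⟨hlt, hout⟩)
  · have htab : Table p q s₅ := by
      rcases hT₅ with ⟨h, -⟩ | ⟨-, h⟩
      · omega
      · exact h
    refine Or.inl ⟨htab.ne, _, hout, fun hG => ?_⟩
    obtain ⟨hkeep, hshift⟩ := hclosed hle
    refine hG.eq_card htab ?_ hshift
    refine (hG₄ hG (hmono.trans hle)).imp_right ?_
    rintro ⟨V, hpos, hV⟩
    have h0 := (hV _).1 ⟨0, hpos, rfl⟩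
    exact ⟨V, _, h0.1, h0.2, fun c hc hcV => hkeep c ((hV c).2 ⟨hc, hcV⟩)⟩
  · refine Or.inr ⟨?_, by rw [hout, hhits₅]⟩
    rcases hT₅ with ⟨-, h⟩ | ⟨h, -⟩
    · exact h
    · omega

end RealRAM

/-! ### Distribution of the output -/

namespace RealRAM

open FeasibleBasis

variable {n d K r lg B : ℕ} {p : Fin n → EuclideanSpace ℝ (Fin d)}
  {q : EuclideanSpace ℝ (Fin d)} {s : State}

/-- The powers `r = 2 ^ i` satisfy `r * r = 4 ^ i`, so the loop stops at the logarithm of `n` to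
base `4`. -/
theorem scaleP_spec (hB : 2 ^ Nat.clog 4 n ≤ B) (hn : s.nat vn 0 = n) :
    WP B (.seq scaleP (setVar vi (.lit 0))) (Nat.clog 4 n * 3 + 4) (fun s' =>
      s'.nat vr 0 = 2 ^ Nat.clog 4 n ∧ s'.nat vlog 0 = Nat.clog 4 n + 1 ∧ s'.nat vi 0 = 0) s := by
  have hB1 : 1 ≤ B := Nat.one_le_two_pow.trans hB
  have hB2 : Nat.clog 4 n + 1 ≤ B := (Nat.lt_two_pow_self).trans_le hB
  refine WP.mono (k := (1 + (1 + (Nat.clog 4 n * (2 + 1) + 1))) + 1) (WP.seq ?_) (by omega)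
    fun _ h => h
  refine WP.seq (WP.setNat (by simpa [NatExpr.eval] using hB1)
    (WP.seq (WP.setNat (by simpa [NatExpr.eval] using hB1) ?_)))
  refine (WP.while (Inv := fun s' => s'.nat vn 0 = n ∧ ∃ i ≤ Nat.clog 4 n,
    s'.nat vr 0 = 2 ^ i ∧ s'.nat vlog 0 = i + 1)
    (fun s' => Nat.clog 4 n + 1 - s'.nat vlog 0) ?_ ?_ ?_).imp ?_
  · rintro s₁ ⟨hn', i, hi, hr, hl⟩ ht
    simp only [Test.holds, NatExpr.eval, hn', hr, not_le] at ht
    have hlt : i < Nat.clog 4 n := by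
      rw [Nat.lt_clog_iff_pow_lt (by norm_num)]
      refine lt_of_eq_of_lt ?_ ht
      rw [← mul_pow]; rfl
    have h2 : 2 ^ (i + 1) ≤ B := (Nat.pow_le_pow_right (by norm_num) hlt).trans hB
    refine WP.seq (k := 1) (k' := 1) (WP.setNat ?_ (WP.setNat ?_ ?_))
    · simpa [NatExpr.eval, hr, ← pow_succ] using h2
    · simp +decide [NatExpr.eval, State.writeNat_apply, hl]
      omega
    · simp +decide only [NatExpr.eval, State.writeNat_apply]
      simp only [hn', hr, hl, if_true, if_false, true_and]
      exact ⟨⟨i + 1, hlt, by rw [pow_succ], rfl⟩, by omega⟩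
  · simp +decide only [NatExpr.eval, State.writeNat_apply]
    simp only [hn, if_true, if_false, true_and]
    exact ⟨0, Nat.zero_le _, by simp, rfl⟩
  · simp +decide [NatExpr.eval, State.writeNat_apply]
  · rintro s₁ ⟨⟨hn', i, hi, hr, hl⟩, ht⟩
    simp only [Test.holds, NatExpr.eval, hn', hr, not_not] at ht
    have hi' : i = Nat.clog 4 n := by
      refine le_antisymm hi ((Nat.clog_le_iff_le_pow (by norm_num)).2 (ht.trans_eq ?_))
      rw [← mul_pow]; rfl
    refine WP.setNat (by simp [NatExpr.eval]) ?_
    simp +decide [NatExpr.eval, State.writeNat_apply, hr, hl, hi']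

variable [NeZero n]

/-- What is known about the output, if `a` is the sequence of random numbers. -/
def GoodOutput (p : Fin n → EuclideanSpace ℝ (Fin d)) (q : EuclideanSpace ℝ (Fin d))
    (K r lg : ℕ) (a : ℕ → ℕ) (x : ℝ) : Prop :=
  ((∀ i, p i ≠ q) ∧ ∃ T : ℕ, x = (T : ℝ) / ((d + 1).factorial : ℕ) ∧
    (Searchable p q a r (K * lg * r) → T = feasibleCard p q)) ∨
  ((r ^ d < feasibleCard p q ∨ ∃ i, p i = q) ∧
    x = (hitCount p q a (K * lg * r ^ (d + 2)) : ℝ) * (n ^ (d + 1) : ℕ) /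
      ((K * lg * r ^ (d + 2) * (d + 1).factorial : ℕ) : ℝ))

/-- A bound for the running time. -/
def timeBound (n d K r lg B : ℕ) : ℕ :=
  ((lg * 3 + 1) * (Program.seq scaleP (setVar vi (.lit 0))).wt +
    (K * lg * r ^ (d + 2) + 1) * (drawP d K).wt +
    mainSteps n d K r lg * (mainP d K).wt) * Nat.size B

/-- The final state is a function of the random numbers, which are independent and uniformly
distributed. -/
theorem exec_depthP (hr : r = 2 ^ Nat.clog 4 n) (hlg : lg = Nat.clog 4 n + 1)
    (hB : Bounds B n d K r lg) (hrB : r ≤ B) (hK : 1 ≤ K * lg)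
    (p : Fin n → EuclideanSpace ℝ (Fin d)) (q : EuclideanSpace ℝ (Fin d)) :
    ∃ g : (Fin (K * lg * r ^ (d + 2)) → Fin (n ^ (d + 1) - 1 + 1)) → State,
      (depthP d K).exec (timeBound n d K r lg B) (inputState p q) =
        (PMF.uniformOfFintype _).map (fun ρ => some (g ρ)) ∧
      ∀ ρ, (g ρ).time ≤ timeBound n d K r lg B ∧
        ∃ a : ℕ → ℕ, (∀ i : Fin (K * lg * r ^ (d + 2)), a i = ρ i) ∧
          GoodOutput p q K r lg a ((g ρ).real 2 0) := by
  have hnB : n ≤ B := (Nat.le_self_pow (Nat.succ_ne_zero d) n).trans hB.codes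
  have hS := size_pos_of_two_le hB.two_le
  have hr0 : 0 < r := by rw [hr]; positivity
  set T := timeBound n d K r lg B with hT
  have hsmall : Small B (inputState p q) := by
    intro b i
    simp only [inputState]
    split_ifs <;> omega
  obtain ⟨s₁, j₁, hj₁, hrun₁, hs₁, ⟨h1, h2, h3⟩, hF₁⟩ :=
    (scaleP_spec (n := n) (s := inputState p q) (hr ▸ hrB) (by simp [inputState])).frame hsmall
  rw [← hr] at h1
  rw [← hlg] at h2
  set w₁ := (Program.seq scaleP (setVar vi (.lit 0))).wt with hw₁
  set w₂ := (drawP d K).wt with hw₂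
  set w₃ := (mainP d K).wt with hw₃
  set M := K * lg * r ^ (d + 2) with hM
  have hTeq : T = (lg * 3 + 1) * (w₁ * Nat.size B) + (M + 1) * (w₂ * Nat.size B) +
      mainSteps n d K r lg * (w₃ * Nat.size B) := by
    rw [hT, timeBound]; ring
  have hj₁' : j₁ * (w₁ * Nat.size B) ≤ (lg * 3 + 1) * (w₁ * Nat.size B) :=
    Nat.mul_le_mul_right _ (by omega)
  obtain ⟨t₁, ht₁, hex₁⟩ := hrun₁.exec hB.two_le (t := 0) (F := T) (by
    change 0 + j₁ * (w₁ * Nat.size B) ≤ T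
    omega)
  replace ht₁ : t₁ ≤ 0 + j₁ * (w₁ * Nat.size B) := ht₁
  have hin : HasInput p q s₁ :=
    ⟨by rw [hF₁.1 vn rfl]; simp [inputState], by rw [hF₁.2 rfl]⟩
  have hw₂1 : 1 ≤ w₂ * Nat.size B := Nat.mul_pos (by simp [hw₂, drawP, drawLoop, Program.wt]) hS
  have hMT : M < T := by
    have : (M + 1) * 1 ≤ (M + 1) * (w₂ * Nat.size B) := Nat.mul_le_mul_left _ hw₂1
    omega
  obtain ⟨g, hg, hgs⟩ := exec_drawLoop (a := arand) (c := vi) (m := M) (N := n ^ (d + 1) - 1)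
    (e := drawsE d K) (f := .sub (powE (var vn) (d + 1)) (.lit 1)) (F := T) (t := t₁) hB.two_le
    (by decide) hB.draws ((Nat.sub_le _ _).trans hB.codes) hs₁
    (fun s' h => by
      simp [drawsE, NatExpr.eval, h vr (by decide) (by decide), h vlog (by decide) (by decide),
        h1, h2, hM])
    (fun s' h => by
      simp [NatExpr.eval, h vn (by decide) (by decide), hin.1]) h3 hMT
  have hmain : ∀ ρ, ∃ s' : State, (mainP d K).exec T (g ρ) = PMF.pure (some s') ∧ s'.time ≤ T ∧
      ∃ a : ℕ → ℕ, (∀ i : Fin M, a i = ρ i) ∧ GoodOutput p q K r lg a (s'.real 2 0) := by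
    intro ρ
    obtain ⟨k1, k2, k3, k4, k5⟩ := hgs ρ
    have hzero : ∀ b c, b ≠ 0 → b ≠ vr → b ≠ vlog → b ≠ vi → b ≠ arand → (g ρ).nat b c = 0 := by
      intro b c b0 b1 b2 b3 b4
      rw [k4 b b4 b3, hF₁.1 b]
      · simp [inputState, b0]
      · simp only [Program.modN, scaleP, incr, Bool.or_eq_false_iff, beq_eq_false_iff_ne]
        exact ⟨⟨b1.symm, b2.symm, b1.symm, b2.symm⟩, b3.symm⟩
    have hbase : Base p q r lg ((g ρ).nat arand) (g ρ) := by
      refine ⟨⟨?_, by rw [k3]; exact hin.2⟩, ?_, ?_, rfl⟩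
      · rw [k4 vn (by decide) (by decide)]; exact hin.1
      · rw [k4 vr (by decide) (by decide)]; exact h1
      · rw [k4 vlog (by decide) (by decide)]; exact h2
    have hz : ∀ b c, b = vhits ∨ b = vtail ∨ b = amark → (g ρ).nat b c = 0 := by
      rintro b c (rfl | rfl | rfl) <;> exact hzero _ _ (by decide) (by decide) (by decide)
        (by decide) (by decide)
    obtain ⟨s', j, hj, hrun, -, hpost⟩ := mainP_spec hB hK hr0 hbase (hz _ _ (by simp))
      (hz _ _ (by simp)) (fun c => hz _ c (by simp)) k2
    have hj' : j * (w₃ * Nat.size B) ≤ mainSteps n d K r lg * (w₃ * Nat.size B) :=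
      Nat.mul_le_mul_right _ hj
    have k1' : (g ρ).time ≤ t₁ + (M + 1) * (w₂ * Nat.size B) := k1
    obtain ⟨t', ht', hex⟩ := hrun.exec hB.two_le (t := (g ρ).time) (F := T) (by
      change (g ρ).time + j * (w₃ * Nat.size B) ≤ T
      omega)
    replace ht' : t' ≤ (g ρ).time + j * (w₃ * Nat.size B) := ht'
    exact ⟨s'.withTime t', hex, by simp only [State.withTime_time]; omega, _, k5, hpost⟩
  choose g' hg' hgt hgo using hmain
  refine ⟨g', ?_, fun ρ => ⟨hgt ρ, hgo ρ⟩⟩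
  have e1 : (Program.seq scaleP (setVar vi (.lit 0))).exec T (inputState p q) =
      PMF.pure (some (s₁.withTime t₁)) := hex₁
  rw [depthP, Program.exec, e1, PMF.pure_bind]
  simp only [Option.elim_some]
  rw [Program.exec, drawP, hg, PMF.bind_map]
  have e2 : ((fun x : Option State => x.elim (PMF.pure none) ((mainP d K).exec T)) ∘
      fun ρ => some (g ρ)) = fun ρ => PMF.pure (some (g' ρ)) := by
    funext ρ
    simp [hg']
  rw [e2]
  rfl

/-- The probability of an event that is a function of uniformly distributed random numbers. -/
theorem errorProb_le_of_exec_eq {Ω : Type*} [Fintype Ω] [Nonempty Ω] {A : Program} {T : ℕ}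
    {g : Ω → State} (hA : A.exec T s = (PMF.uniformOfFintype Ω).map fun ρ => some (g ρ))
    (hT : ∀ ρ, (g ρ).time ≤ T) {good : ℝ → Prop} (S : Finset Ω)
    (hS : ∀ ρ, ¬ good ((g ρ).real 2 0) → ρ ∈ S) :
    A.errorProb s T good ≤ ENNReal.ofReal (S.card / Fintype.card Ω) := by
  classical
  have hcard : (0 : ℝ) < Fintype.card Ω := by exact_mod_cast Fintype.card_pos
  rw [Program.errorProb, hA, PMF.toOuterMeasure_map_apply]
  refine (MeasureTheory.measure_mono (t := (S : Set Ω)) ?_).trans ?_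
  · intro ρ hρ
    refine hS ρ fun h => hρ ⟨g ρ, rfl, hT ρ, h⟩
  · rw [PMF.toOuterMeasure_uniformOfFintype_apply, ENNReal.ofReal_div_of_pos hcard]
    simp

/-- If the final state is a function of random numbers and the clock never exceeds `T`, then the
program always stops in time. -/
theorem stopsWithin_of_exec_eq {Ω : Type*} [Fintype Ω] [Nonempty Ω] {A : Program} {T : ℕ}
    {g : Ω → State} (hA : A.exec T s = (PMF.uniformOfFintype Ω).map fun ρ => some (g ρ))
    (hT : ∀ ρ, (g ρ).time ≤ T) : A.StopsWithin s T := by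
  intro x hx
  rw [hA, PMF.mem_support_map_iff] at hx
  obtain ⟨ρ, -, rfl⟩ := hx
  exact ⟨g ρ, rfl, hT ρ⟩

end RealRAM

/-! ### Error probability -/

namespace RealRAM

open FeasibleBasis UniformDraws Function

variable {n d K r lg : ℕ} {p : Fin n → EuclideanSpace ℝ (Fin d)}
  {q : EuclideanSpace ℝ (Fin d)} {a : ℕ → ℕ} [NeZero n]

theorem pow_sub_one_add_one (n m : ℕ) [NeZero n] : n ^ m - 1 + 1 = n ^ m :=
  Nat.sub_add_cancel (Nat.one_le_pow _ _ (NeZero.pos n))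

/-- Random codes are drawn from `{0, …, n ^ m - 1}`, and `Fin (N + 1)` is the index type for `{0, …,
N}`. -/
theorem card_codes (n m : ℕ) [NeZero n] : Fintype.card (Fin (n ^ m - 1 + 1)) = n ^ m := by
  rw [Fintype.card_fin, pow_sub_one_add_one]

open Classical in
/-- The codes of feasible tuples. -/
noncomputable def feasibleSet (p : Fin n → EuclideanSpace ℝ (Fin d))
    (q : EuclideanSpace ℝ (Fin d)) : Finset (Fin (n ^ (d + 1) - 1 + 1)) :=
  Finset.univ.filter fun ω : Fin (n ^ (d + 1) - 1 + 1) =>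
    Feasible (homog ∘ p) (homog q) (digits n (d + 1) ω)

theorem card_feasibleSet : (feasibleSet p q).card = feasibleCard p q := by
  classical
  rw [feasibleSet, feasibleCard, ← Fintype.card_subtype]
  exact Fintype.card_congr (Equiv.subtypeEquiv
    ((finCongr (pow_sub_one_add_one n (d + 1))).trans (digitsEquiv n (d + 1))) fun _ => Iff.rfl)

theorem hitCount_eq_hits {M : ℕ} {ρ : Fin M → Fin (n ^ (d + 1) - 1 + 1)}
    (ha : ∀ i : Fin M, a i = ρ i) : hitCount p q a M = hits (feasibleSet p q) ρ := by
  classical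
  rw [hitCount, hits, Finset.card_filter, Finset.card_filter, Finset.sum_range]
  refine Finset.sum_congr rfl fun i _ => ?_
  simp [feasibleSet, ha]

open Classical in
/-- The codes of tuples that start with a point on the side of `q`. -/
noncomputable def sideSet (p : Fin n → EuclideanSpace ℝ (Fin d))
    (q : EuclideanSpace ℝ (Fin d)) (b : Fin d → Fin n) : Finset (Fin (n ^ (d + 1) - 1 + 1)) :=
  Finset.univ.filter fun ω : Fin (n ^ (d + 1) - 1 + 1) =>
    OnSide p q b ⟨ω % n, Nat.mod_lt _ (NeZero.pos n)⟩

open Classical in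
/-- Each point is the first entry of `n ^ d` tuples. -/
theorem card_sideSet (b : Fin d → Fin n) :
    n ^ d * (Finset.univ.filter (OnSide p q b)).card ≤ (sideSet p q b).card := by
  have h1 : n ^ d * n = n ^ (d + 1) - 1 + 1 := by rw [pow_sub_one_add_one, pow_succ]
  have h2 : ((Finset.univ : Finset (Fin (n ^ d))) ×ˢ Finset.univ.filter (OnSide p q b)).card =
      n ^ d * (Finset.univ.filter (OnSide p q b)).card := by
    rw [Finset.card_product, Finset.card_univ, Fintype.card_fin]
  rw [← h2]
  refine Finset.card_le_card_of_injOn (fun x => Fin.cast h1 (finProdFinEquiv x)) ?_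
    ((Fin.cast_injective h1).comp finProdFinEquiv.injective).injOn
  rintro ⟨y, x⟩ hx
  simp only [Finset.coe_product, Finset.coe_univ, Set.mem_prod, Set.mem_univ, true_and,
    Finset.mem_coe, Finset.mem_filter, Finset.mem_univ] at hx
  simp only [sideSet, Finset.mem_coe, Finset.mem_filter, Finset.mem_univ, true_and]
  convert hx using 1
  exact Fin.ext (by simp [finProdFinEquiv, Nat.mod_eq_of_lt x.2])

/-- If there are many feasible tuples, then the expected number of hits is large. -/
theorem le_mean (hn : n ≤ r * r) (hD : r ^ d ≤ feasibleCard p q) :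
    (K * lg : ℝ) ≤ mean (feasibleSet p q) (K * lg * r ^ (d + 2)) := by
  have hN : (0 : ℝ) < (n ^ (d + 1) : ℕ) := by
    exact_mod_cast pow_pos (NeZero.pos n) (d + 1)
  rw [mean, card_feasibleSet, card_codes, ← mul_div_assoc,
    le_div_iff₀ hN]
  have h1 : n ^ (d + 1) ≤ r ^ (d + 2) * r ^ d :=
    (Nat.pow_le_pow_left hn (d + 1)).trans_eq (by ring)
  have h2 : K * lg * n ^ (d + 1) ≤ K * lg * r ^ (d + 2) * feasibleCard p q := by
    rw [mul_assoc (K * lg)]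
    exact Nat.mul_le_mul_left _ (h1.trans (Nat.mul_le_mul_left _ hD))
  exact_mod_cast h2

/-- A relative approximation `h` of the expected number of hits, rescaled, is a relative
approximation of `σ`. -/
theorem isRelApprox_of_hits {ε σ h M N D f : ℝ} (hM : 0 < M) (hN : 0 < N) (hf : 0 < f)
    (hD : D = f * σ) (h1 : M * (D / N) / (1 + ε) ≤ h) (h2 : h ≤ (1 + ε) * (M * (D / N))) :
    IsRelApprox ε σ (h * N / (M * f)) := by
  subst hD
  have e1 : σ / (1 + ε) = M * (f * σ / N) / (1 + ε) * N / (M * f) := by field_simp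
  have e2 : (1 + ε) * σ = (1 + ε) * (M * (f * σ / N)) * N / (M * f) := by field_simp
  constructor
  · rw [e1]; gcongr
  · rw [e2]; gcongr

theorem isRelApprox_self {ε σ : ℝ} (hε : 0 < ε) (hσ : 0 ≤ σ) : IsRelApprox ε σ σ :=
  ⟨div_le_self hσ (by linarith), by nlinarith⟩

open Classical in
/-- With high probability, the first draws meet all large sets of points that are cut off by a
hyperplane. -/
theorem exists_net_badSet (p : Fin n → EuclideanSpace ℝ (Fin d)) (q : EuclideanSpace ℝ (Fin d))
    (hn : n ≤ r * r) {M : ℕ} (hrM : r ≤ M) :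
    ∃ S : Finset (Fin M → Fin (n ^ (d + 1) - 1 + 1)),
      (S.card : ℝ) ≤ (Fintype.card (Fin (n ^ (d + 1) - 1 + 1)) : ℝ) ^ M *
        (n ^ d * Real.exp (-(K * lg))) ∧
      ∀ ρ ∉ S, ∀ b : Fin d → Fin n, K * lg * r < (Finset.univ.filter (OnSide p q b)).card →
        ∃ i : Fin M, (i : ℕ) < r ∧ ρ i ∈ sideSet p q b := by
  set W := (Fintype.card (Fin (n ^ (d + 1) - 1 + 1)) : ℝ) ^ M with hW
  let F : (Fin d → Fin n) → Finset (Fin M → Fin (n ^ (d + 1) - 1 + 1)) := fun b =>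
    if K * lg * r < (Finset.univ.filter (OnSide p q b)).card then
      Finset.univ.filter fun ρ : Fin M → Fin (n ^ (d + 1) - 1 + 1) =>
        ∀ i : Fin M, (i : ℕ) < r → ρ i ∉ sideSet p q b
    else ∅
  have hF : ∀ b, ((F b).card : ℝ) ≤ W * Real.exp (-(K * lg)) := by
    intro b
    by_cases hb : K * lg * r < (Finset.univ.filter (OnSide p q b)).card
    · simp only [F, if_pos hb]
      refine (card_miss_le (sideSet p q b) hrM _ fun ρ hρ => (Finset.mem_filter.1 hρ).2).trans ?_
      refine mul_le_mul_of_nonneg_left (Real.exp_le_exp.2 (neg_le_neg ?_)) (by positivity)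
      have hN : (0 : ℝ) < (n ^ (d + 1) : ℕ) := by
        exact_mod_cast pow_pos (NeZero.pos n) (d + 1)
      rw [card_codes, ← mul_div_assoc, le_div_iff₀ hN]
      have h1 : K * lg * n ^ (d + 1) ≤ r * (sideSet p q b).card :=
        calc K * lg * n ^ (d + 1) = K * lg * n ^ d * n := by ring
          _ ≤ K * lg * n ^ d * (r * r) := Nat.mul_le_mul_left _ hn
          _ = r * (n ^ d * (K * lg * r)) := by ring
          _ ≤ r * (sideSet p q b).card := Nat.mul_le_mul_left _
            ((Nat.mul_le_mul_left _ hb.le).trans (card_sideSet b))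
      exact_mod_cast h1
    · simp only [F, if_neg hb, Finset.card_empty, Nat.cast_zero]
      positivity
  refine ⟨Finset.univ.biUnion F, ?_, fun ρ hρ b hb => ?_⟩
  · calc ((Finset.univ.biUnion F).card : ℝ) ≤ ∑ b, ((F b).card : ℝ) := by
          exact_mod_cast Finset.card_biUnion_le
      _ ≤ ∑ _b : Fin d → Fin n, W * Real.exp (-(K * lg)) := Finset.sum_le_sum fun b _ => hF b
      _ = W * (n ^ d * Real.exp (-(K * lg))) := by
        rw [Finset.sum_const, Finset.card_univ, Fintype.card_fun, Fintype.card_fin,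
          Fintype.card_fin, nsmul_eq_mul]
        push_cast
        ring
  · by_contra! h
    refine hρ (Finset.mem_biUnion.2 ⟨b, Finset.mem_univ _, ?_⟩)
    simp only [F, if_pos hb, Finset.mem_filter, Finset.mem_univ, true_and]
    exact h

/-- The output is a good approximation, unless the random numbers belong to a small set. -/
theorem exists_badSet (hp : Injective p)
    (H₁ : ∀ t : Fin (d + 1) → Fin n, Injective t → rowDet ((homog ∘ p) ∘ t) ≠ 0)
    (H₂ : (∀ i, p i ≠ q) → ∀ t : Fin (d + 1) → Fin n, Injective t → ∀ k,
      rowDet (update ((homog ∘ p) ∘ t) k (homog q)) ≠ 0)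
    (hn : n ≤ r * r) (hdr : d + 1 ≤ r) (hdn : d + 1 ≤ n) (hrn : r ≤ n - d) (hK : 1 ≤ K * lg)
    {σ : ℕ} (hσ : feasibleCard p q = (d + 1).factorial * σ) {ε : ℝ} (hε : 0 < ε) :
    ∃ S : Finset (Fin (K * lg * r ^ (d + 2)) → Fin (n ^ (d + 1) - 1 + 1)),
      (S.card : ℝ) ≤ Fintype.card (Fin (K * lg * r ^ (d + 2)) → Fin (n ^ (d + 1) - 1 + 1)) *
        (2 * Real.exp (-(K * lg * (ε / (2 * (1 + ε))) ^ 2)) + n ^ d * Real.exp (-(K * lg))) ∧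
      ∀ ρ ∉ S, ∀ (a : ℕ → ℕ) (x : ℝ), (∀ i : Fin (K * lg * r ^ (d + 2)), a i = ρ i) →
        GoodOutput p q K r lg a x → IsRelApprox ε σ x := by
  classical
  have hr : 0 < r := by omega
  set M := K * lg * r ^ (d + 2) with hM
  have hrM : r ≤ M := by
    calc r ≤ r ^ (d + 2) := Nat.le_self_pow (by omega) r
      _ = 1 * r ^ (d + 2) := (one_mul _).symm
      _ ≤ K * lg * r ^ (d + 2) := Nat.mul_le_mul_right _ hK
  obtain ⟨S₂, hS₂, hnet⟩ := exists_net_badSet (K := K) (lg := lg) p q hn hrM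
  set S₁ : Finset (Fin M → Fin (n ^ (d + 1) - 1 + 1)) :=
    if r ^ d ≤ feasibleCard p q then
      Finset.univ.filter fun ρ : Fin M → Fin (n ^ (d + 1) - 1 + 1) =>
        ¬ (mean (feasibleSet p q) M / (1 + ε) ≤ hits (feasibleSet p q) ρ ∧
          (hits (feasibleSet p q) ρ : ℝ) ≤ (1 + ε) * mean (feasibleSet p q) M)
    else ∅ with hS₁def
  have hS₁ : (S₁.card : ℝ) ≤ (Fintype.card (Fin (n ^ (d + 1) - 1 + 1)) : ℝ) ^ M *
      (2 * Real.exp (-(K * lg * (ε / (2 * (1 + ε))) ^ 2))) := by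
    by_cases hD : r ^ d ≤ feasibleCard p q
    · rw [hS₁def, if_pos hD]
      refine (card_hits_not_relApprox_le (feasibleSet p q) hε _
        fun ρ hρ => (Finset.mem_filter.1 hρ).2).trans ?_
      have := le_mean (K := K) (lg := lg) hn hD
      gcongr
    · rw [hS₁def, if_neg hD, Finset.card_empty, Nat.cast_zero]
      positivity
  refine ⟨S₁ ∪ S₂, ?_, ?_⟩
  · have h1 : ((S₁ ∪ S₂).card : ℝ) ≤ S₁.card + S₂.card := by
      exact_mod_cast Finset.card_union_le _ _
    have h2 : (Fintype.card (Fin M → Fin (n ^ (d + 1) - 1 + 1)) : ℝ) =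
        (Fintype.card (Fin (n ^ (d + 1) - 1 + 1)) : ℝ) ^ M := by
      rw [Fintype.card_fun, Fintype.card_fin M]
      push_cast
      rfl
    rw [h2, mul_add]
    linarith
  · intro ρ hρ a x ha hx
    rw [Finset.mem_union, not_or] at hρ
    have hf : (0 : ℝ) < ((d + 1).factorial : ℕ) := by exact_mod_cast Nat.factorial_pos _
    rcases hx with ⟨hne, T, hxT, hT⟩ | ⟨hcase, hx⟩
    · have hG : Searchable p q a r (K * lg * r) := by
        refine ⟨hp, H₁, H₂ hne, hdr, hdn, fun b hb => ?_⟩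
        obtain ⟨i, hir, hi⟩ := hnet ρ hρ.2 b hb
        refine ⟨i, hir, ⟨ρ i % n, Nat.mod_lt _ (NeZero.pos n)⟩, by rw [ha], ?_⟩
        exact (Finset.mem_filter.1 hi).2
      have hxσ : x = σ := by
        rw [hxT, hT hG, hσ, Nat.cast_mul, mul_div_cancel_left₀ _ hf.ne']
      rw [hxσ]
      exact isRelApprox_self hε (Nat.cast_nonneg _)
    · have hD : r ^ d ≤ feasibleCard p q := by
        rcases hcase with h | ⟨i, hi⟩
        · exact h.le
        · refine (Nat.pow_le_pow_left hrn d).trans ((le_card_feasible_of_eq H₁ hi).trans_eq ?_)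
          rw [feasibleCard]
      have hρ1 := hρ.1
      rw [hS₁def, if_pos hD] at hρ1
      simp only [Finset.mem_filter, Finset.mem_univ, true_and, not_not] at hρ1
      rw [mean, card_feasibleSet, card_codes] at hρ1
      rw [hx, hitCount_eq_hits ha, Nat.cast_mul _ (d + 1).factorial]
      refine isRelApprox_of_hits ?_ ?_ hf ?_ hρ1.1 hρ1.2
      · exact_mod_cast hr.trans_le hrM
      · exact_mod_cast pow_pos (NeZero.pos n) (d + 1)
      · rw [hσ]; push_cast; ring

end RealRAM

/-! ### Running time and conclusion -/

namespace RealRAM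

open FeasibleBasis Function

/-- The parameter `r` of the algorithm. -/
def scale (n : ℕ) : ℕ := 2 ^ Nat.clog 4 n

/-- The parameter `lg` of the algorithm. -/
def logScale (n : ℕ) : ℕ := Nat.clog 4 n + 1

variable {n d K : ℕ}

theorem scale_pos (n : ℕ) : 1 ≤ scale n := Nat.one_le_two_pow

theorem scale_mul_self (n : ℕ) : scale n * scale n = 4 ^ Nat.clog 4 n := by
  rw [scale, ← mul_pow]; rfl

theorem le_scale_mul_self (n : ℕ) : n ≤ scale n * scale n := by
  rw [scale_mul_self]
  exact Nat.le_pow_clog (by norm_num) n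

theorem scale_mul_self_le (hn : 1 ≤ n) : scale n * scale n ≤ 4 * n := by
  rw [scale_mul_self]
  rcases hn.eq_or_lt with rfl | hn
  · simp
  · have h1 := Nat.pow_pred_clog_lt_self (b := 4) (by norm_num) hn
    have h2 : 0 < Nat.clog 4 n := Nat.clog_pos (by norm_num) hn
    rw [← Nat.succ_pred_eq_of_pos h2, pow_succ]
    omega

theorem logScale_le_scale (n : ℕ) : logScale n ≤ scale n := Nat.lt_two_pow_self

/-- All integers that occur are at most this number. -/
def cellBound (n d K : ℕ) : ℕ := ((d + 5) * K * logScale n * scale n) ^ (2 * d + 2)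

/-- The largest allowed number of candidates dominates the other parameters. -/
theorem scale_le_candMax (hK : 1 ≤ K) :
    (d + 5) * scale n ≤ (d + 5) * K * logScale n * scale n ∧
      K * logScale n * scale n ≤ (d + 5) * K * logScale n * scale n := by
  have hl : 1 ≤ logScale n := Nat.le_add_left _ _
  constructor
  · refine Nat.mul_le_mul_right _ ?_
    rw [mul_assoc]
    exact Nat.le_mul_of_pos_right _ (Nat.mul_pos hK hl)
  · have h : (d + 5) * K * logScale n * scale n = (d + 5) * (K * logScale n * scale n) := by ring
    rw [h]
    exact Nat.le_mul_of_pos_left _ (by omega)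

/-- As `n ≤ r ^ 2`, a power of the largest allowed number of candidates bounds all numbers that
occur. -/
theorem bounds_cellBound (hK : 1 ≤ K) :
    Bounds (cellBound n d K) n d K (scale n) (logScale n) ∧ scale n ≤ cellBound n d K := by
  obtain ⟨h1, h2⟩ := scale_le_candMax (n := n) (d := d) hK
  have hr := scale_pos n
  unfold cellBound
  set X := (d + 5) * K * logScale n * scale n with hX
  set r := scale n with hrdef
  have hXd : d + 5 ≤ X := (Nat.le_mul_of_pos_right _ hr).trans h1
  have hX1 : 1 ≤ X := by omega
  have h2r : 2 * r ≤ X := (Nat.mul_le_mul_right r (by omega)).trans h1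
  have hXB : ∀ m ≤ 2 * d + 2, X ^ m ≤ X ^ (2 * d + 2) := fun m hm => Nat.pow_le_pow_right hX1 hm
  have hX1B : X ≤ X ^ (2 * d + 2) := Nat.le_self_pow (by omega) X
  have hrX : ∀ m, r ^ m ≤ X ^ m := fun m => Nat.pow_le_pow_left (by omega) m
  have hdouble : ∀ m, 2 * r ^ (m + 1) ≤ X ^ (m + 1) := fun m => by
    rw [pow_succ, pow_succ]
    calc 2 * (r ^ m * r) = r ^ m * (2 * r) := by ring
      _ ≤ X ^ m * X := Nat.mul_le_mul (hrX m) h2r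
  have hpos : ∀ m, 1 ≤ r ^ m := fun m => Nat.one_le_pow _ _ hr
  refine ⟨⟨by omega, by omega, ?_, ?_, hXB _ (by omega), ?_, ?_⟩, by omega⟩
  · calc K * logScale n * r ^ (d + 2) = K * logScale n * r * r ^ (d + 1) := by ring
      _ ≤ X * X ^ (d + 1) := Nat.mul_le_mul h2 (hrX _)
      _ = X ^ (d + 2) := by ring
      _ ≤ _ := hXB _ (by omega)
  · calc n ^ (d + 1) ≤ (r * r) ^ (d + 1) := Nat.pow_le_pow_left (le_scale_mul_self n) _
      _ = r ^ (2 * d + 2) := by ring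
      _ ≤ _ := hrX _
  · have h3 : r ^ d * n ≤ r ^ (d + 1 + 1) :=
      (Nat.mul_le_mul_left _ (le_scale_mul_self n)).trans_eq (by ring)
    have := hdouble (d + 1)
    have := hpos (d + 1 + 1)
    have := hXB (d + 1 + 1) (by omega)
    omega
  · have h3 : r ^ d ≤ r ^ (d + 1) := Nat.pow_le_pow_right hr (by omega)
    have := hdouble d
    have := hpos (d + 1)
    have := hXB (d + 1) (by omega)
    omega

/-- All integers that occur have bit length `O(log n)`. -/
theorem size_cellBound_le :
    Nat.size (cellBound n d K) ≤ ((2 * d + 2) * ((d + 5) * K + 2) + 1) * logScale n := by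
  have h1 : Nat.size ((d + 5) * K * logScale n * scale n) ≤ (d + 5) * K + 2 * Nat.clog 4 n := by
    rw [Nat.size_le, pow_add, two_mul, pow_add, ← mul_assoc]
    refine Nat.mul_lt_mul_of_lt_of_le ?_ le_rfl (Nat.two_pow_pos _)
    exact Nat.mul_lt_mul_of_lt_of_le Nat.lt_two_pow_self (logScale_le_scale n)
      (Nat.two_pow_pos _)
  refine (size_pow_le _ _).trans ?_
  have hl : 1 ≤ logScale n := Nat.le_add_left _ _
  have h2 : (d + 5) * K + 2 * Nat.clog 4 n ≤ ((d + 5) * K + 2) * logScale n := by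
    have : (d + 5) * K * 1 ≤ (d + 5) * K * logScale n := Nat.mul_le_mul_left _ hl
    rw [add_mul ((d + 5) * K)]
    unfold logScale at this ⊢
    omega
  have h3 := Nat.mul_le_mul_left (2 * d + 2) (h1.trans h2)
  rw [add_mul _ 1 (logScale n), mul_assoc (2 * d + 2) (_ + 2)]
  omega

/-- The sampling, the tests of tuples of candidates and the search all take about `r ^ (d + 2)`
steps, up to logarithms. -/
theorem mainSteps_le (hK : 1 ≤ K) : mainSteps n d K (scale n) (logScale n) ≤
    (36 * (d + 2) + 32) *
      (((d + 5) * K * logScale n) ^ (d + 1) * scale n ^ (d + 2)) := by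
  have hr := scale_pos n
  have hl : 1 ≤ logScale n := Nat.le_add_left _ _
  have hn := le_scale_mul_self n
  unfold mainSteps roundSteps
  set r := scale n with hrdef
  set Y := (d + 5) * K * logScale n with hY
  have hKY : K * logScale n ≤ Y := by
    rw [hY, mul_assoc]
    exact Nat.le_mul_of_pos_left _ (by omega)
  have hY1 : 1 ≤ Y := (Nat.mul_pos hK hl).trans_le hKY
  set G := Y ^ (d + 1) * r ^ (d + 2) with hG
  have hYG : Y ≤ Y ^ (d + 1) := Nat.le_self_pow (by omega) Y
  have hrG : ∀ m ≤ d + 2, r ^ m ≤ G := fun m hm =>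
    (Nat.pow_le_pow_right hr hm).trans (Nat.le_mul_of_pos_left _ (Nat.pow_pos hY1))
  have g1 : K * logScale n * r ^ (d + 2) ≤ G := Nat.mul_le_mul_right _ (hKY.trans hYG)
  have g2 : n ≤ G := hn.trans ((pow_two r).ge.trans (hrG 2 (by omega)))
  have g3 : r ≤ G := (pow_one r).ge.trans (hrG 1 (by omega))
  have g4 : r ^ d * n ≤ G :=
    (Nat.mul_le_mul_left _ hn).trans ((by ring : r ^ d * (r * r) = r ^ (d + 2)).le.trans
      (hrG _ le_rfl))
  have g0 : 1 ≤ G := hr.trans g3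
  have g5 : (Y * r) ^ (d + 1) ≤ G := by
    rw [mul_pow]
    exact Nat.mul_le_mul_left _ (Nat.pow_le_pow_right hr (by omega))
  have g6 : (Y * r) ^ d * (Y * r * 4 + 9) ≤ 13 * G := by
    have h1 : (Y * r) ^ d ≤ (Y * r) ^ (d + 1) :=
      Nat.pow_le_pow_right (Nat.mul_pos hY1 hr) (by omega)
    calc (Y * r) ^ d * (Y * r * 4 + 9) = 4 * (Y * r) ^ (d + 1) + 9 * (Y * r) ^ d := by ring
      _ ≤ 13 * G := by omega
  have g7 : (Y * r) ^ (d + 1) * 7 + 2 + ((Y * r) ^ d * (Y * r * 4 + 9) + 3 + (n * 5 + 2 + 1) + 1) +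
      2 ≤ 36 * G := by omega
  have g8 := Nat.mul_le_mul_left (d + 2) g7
  have e : (36 * (d + 2) + 32) * G = (d + 2) * (36 * G) + 32 * G := by ring
  rw [e]
  omega

/-- The factor in the bound for the running time that depends only on `d` and `K`. -/
def timeConst (d K : ℕ) : ℕ :=
  (4 * (Program.seq scaleP (setVar vi (.lit 0))).wt + 2 * (drawP d K).wt +
    (36 * (d + 2) + 32) * (mainP d K).wt) * ((d + 5) * K) ^ (d + 1) *
      ((2 * d + 2) * ((d + 5) * K + 2) + 1)

/-- The steps are `O(lg ^ (d + 1) * r ^ (d + 2))` in number, and each of them costs `O(lg)`. -/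
theorem timeBound_le (hK : 1 ≤ K) :
    timeBound n d K (scale n) (logScale n) (cellBound n d K) ≤
      timeConst d K * (logScale n ^ (d + 2) * scale n ^ (d + 2)) := by
  have hr := scale_pos n
  have hl : 1 ≤ logScale n := Nat.le_add_left _ _
  have hmain := mainSteps_le (n := n) (d := d) hK
  have hsize := size_cellBound_le (n := n) (d := d) (K := K)
  unfold timeBound timeConst
  set w₁ := (Program.seq scaleP (setVar vi (.lit 0))).wt
  set w₂ := (drawP d K).wt
  set w₃ := (mainP d K).wt
  set S := (2 * d + 2) * ((d + 5) * K + 2) + 1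
  set G := ((d + 5) * K * logScale n) ^ (d + 1) * scale n ^ (d + 2) with hG
  have hKY : K * logScale n ≤ (d + 5) * K * logScale n := by
    rw [mul_assoc]
    exact Nat.le_mul_of_pos_left _ (by omega)
  have hY1 : 1 ≤ (d + 5) * K * logScale n := (Nat.mul_pos hK hl).trans_le hKY
  have hYG : (d + 5) * K * logScale n ≤ ((d + 5) * K * logScale n) ^ (d + 1) :=
    Nat.le_self_pow (by omega) _
  have g1 : K * logScale n * scale n ^ (d + 2) ≤ G := Nat.mul_le_mul_right _ (hKY.trans hYG)
  have g2 : logScale n ≤ G := by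
    refine le_trans ?_ ((Nat.le_mul_of_pos_right _ (Nat.pow_pos hr)).trans g1)
    exact Nat.le_mul_of_pos_left _ hK
  calc ((logScale n * 3 + 1) * w₁ + (K * logScale n * scale n ^ (d + 2) + 1) * w₂ +
        mainSteps n d K (scale n) (logScale n) * w₃) * Nat.size (cellBound n d K)
      ≤ (4 * G * w₁ + 2 * G * w₂ + (36 * (d + 2) + 32) * G * w₃) * (S * logScale n) := by
        refine Nat.mul_le_mul (Nat.add_le_add (Nat.add_le_add ?_ ?_) ?_) hsize
        · exact Nat.mul_le_mul_right _ (by omega)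
        · exact Nat.mul_le_mul_right _ (by omega)
        · exact Nat.mul_le_mul_right _ hmain
    _ = _ := by rw [hG, mul_pow ((d + 5) * K)]; ring

theorem four_pow_clog_le (hn : 1 ≤ n) : (4 : ℝ) ^ Nat.clog 4 n ≤ 4 * n := by
  have := scale_mul_self_le hn
  rw [scale_mul_self] at this
  exact_mod_cast this

theorem one_le_log_four : 1 ≤ Real.log 4 := by
  rw [Real.le_log_iff_exp_le (by norm_num)]
  have := Real.exp_one_lt_d9
  linarith

theorem logScale_le (hn : 1 ≤ n) : (logScale n : ℝ) ≤ 2 * (1 + Real.log n) := by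
  have hn0 : (0 : ℝ) < n := by exact_mod_cast hn
  have h1 := Real.log_le_log (by positivity) (four_pow_clog_le hn)
  rw [Real.log_pow, Real.log_mul (by norm_num) hn0.ne'] at h1
  have h2 := one_le_log_four
  have h3 : 0 ≤ Real.log n := Real.log_nonneg (by exact_mod_cast hn)
  have h4 : (Nat.clog 4 n : ℝ) ≤ 1 + Real.log n := by
    by_contra! h
    nlinarith
  rw [logScale]
  push_cast
  linarith

theorem log_le_logScale (hn : 1 ≤ n) : Real.log n ≤ 2 * logScale n := by
  have hn0 : (0 : ℝ) < n := by exact_mod_cast hn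
  have h1 : (n : ℝ) ≤ 4 ^ Nat.clog 4 n := by exact_mod_cast Nat.le_pow_clog (by norm_num) n
  have h2 := Real.log_le_log hn0 h1
  rw [Real.log_pow, show (4 : ℝ) = 2 ^ 2 by norm_num, Real.log_pow] at h2
  have h3 := Real.log_two_lt_d9
  have h4 : (0 : ℝ) ≤ Nat.clog 4 n := Nat.cast_nonneg _
  rw [logScale]
  push_cast at h2 ⊢
  nlinarith

theorem scale_pow_le (hn : 1 ≤ n) :
    (scale n : ℝ) ^ (d + 2) ≤ 2 ^ (d + 2) * (n : ℝ) ^ ((d : ℝ) / 2 + 1) := by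
  have hn0 : (0 : ℝ) ≤ n := Nat.cast_nonneg _
  have h1 : (scale n : ℝ) ≤ 2 * Real.sqrt n := by
    have h2 : (scale n : ℝ) * scale n ≤ 4 * n := by exact_mod_cast scale_mul_self_le hn
    refine abs_le_of_sq_le_sq' ?_ (by positivity) |>.2
    rw [mul_pow, Real.sq_sqrt hn0]
    linarith
  calc (scale n : ℝ) ^ (d + 2) ≤ (2 * Real.sqrt n) ^ (d + 2) := by gcongr
    _ = 2 ^ (d + 2) * (n : ℝ) ^ ((d : ℝ) / 2 + 1) := by
      rw [mul_pow, Real.sqrt_eq_rpow, ← Real.rpow_mul_natCast hn0]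
      congr 2
      push_cast
      ring

theorem timeBound_le_real (hK : 1 ≤ K) (hn : 1 ≤ n) :
    (timeBound n d K (scale n) (logScale n) (cellBound n d K) : ℝ) ≤
      timeConst d K * 4 ^ (d + 2) * (n : ℝ) ^ ((d : ℝ) / 2 + 1) *
        (1 + Real.log n) ^ (d + 2) := by
  have h1 : (timeBound n d K (scale n) (logScale n) (cellBound n d K) : ℝ) ≤
      timeConst d K * ((logScale n : ℝ) ^ (d + 2) * (scale n : ℝ) ^ (d + 2)) := by
    exact_mod_cast timeBound_le (n := n) (d := d) hK
  have h3 : 0 ≤ Real.log n := Real.log_nonneg (by exact_mod_cast hn)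
  have h4 := logScale_le hn
  have h5 := scale_pow_le (d := d) hn
  calc _ ≤ _ := h1
    _ ≤ (timeConst d K : ℝ) * ((2 * (1 + Real.log n)) ^ (d + 2) *
        (2 ^ (d + 2) * (n : ℝ) ^ ((d : ℝ) / 2 + 1))) := by gcongr
    _ = _ := by
      rw [mul_pow, show (4 : ℝ) = 2 * 2 by norm_num, mul_pow]
      ring

/-- The constant `K` is chosen such that both sources of errors have small probability. -/
theorem error_terms_le {δ t : ℝ} (hδ : 0 < δ) (hn : 1 ≤ n)
    (h1 : 2 * δ ≤ K * t ^ 2) (h2 : 2 * (d + δ) ≤ K) :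
    2 * Real.exp (-(K * logScale n * t ^ 2)) + (n : ℝ) ^ d * Real.exp (-(K * logScale n)) ≤
      3 * (n : ℝ) ^ (-δ) := by
  have hn0 : (0 : ℝ) < n := by exact_mod_cast hn
  have hlog := log_le_logScale hn
  have hL : (0 : ℝ) ≤ logScale n := Nat.cast_nonneg _
  have e1 : (n : ℝ) ^ (-δ) = Real.exp (-(δ * Real.log n)) := by
    rw [Real.rpow_def_of_pos hn0]; congr 1; ring
  have e2 : (n : ℝ) ^ d = Real.exp (d * Real.log n) := by
    rw [Real.exp_nat_mul, Real.exp_log hn0]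
  have g1 : Real.exp (-(K * logScale n * t ^ 2)) ≤ Real.exp (-(δ * Real.log n)) := by
    refine Real.exp_le_exp.2 (neg_le_neg ?_)
    calc δ * Real.log n ≤ δ * (2 * logScale n) := by gcongr
      _ = 2 * δ * logScale n := by ring
      _ ≤ K * t ^ 2 * logScale n := by gcongr
      _ = K * logScale n * t ^ 2 := by ring
  have g2 : (n : ℝ) ^ d * Real.exp (-(K * logScale n)) ≤ Real.exp (-(δ * Real.log n)) := by
    rw [e2, ← Real.exp_add]
    refine Real.exp_le_exp.2 ?_
    have : (d + δ) * Real.log n ≤ K * logScale n :=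
      calc (d + δ) * Real.log n ≤ (d + δ) * (2 * logScale n) := by gcongr
        _ = 2 * (d + δ) * logScale n := by ring
        _ ≤ K * logScale n := by gcongr
    linarith
  rw [e1]
  linarith

/-- For all sufficiently large `n` the parameters satisfy what is needed in the proof of
correctness. -/
theorem scale_bounds (hn : (d + 8) ^ 2 ≤ n) :
    d + 1 ≤ scale n ∧ d + 1 ≤ n ∧ scale n ≤ n - d := by
  have h0 : 1 ≤ n := le_trans (Nat.one_le_pow _ _ (by omega)) hn
  have h1 := le_scale_mul_self n
  have h2 := scale_mul_self_le h0
  have h3 : d + d + 8 ≤ n := by nlinarith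
  obtain ⟨m, rfl⟩ : ∃ m, n = d + m := ⟨n - d, by omega⟩
  rw [Nat.add_sub_cancel_left]
  refine ⟨?_, by omega, ?_⟩
  · by_contra! h
    nlinarith
  · by_contra! h
    have : 8 ≤ m := by omega
    nlinarith

/-- The algorithm is correct, if the parameter `K` is large enough. -/
theorem depthP_correct [NeZero n] {ε δ : ℝ} (hε : 0 < ε) (hδ : 0 < δ)
    (hK : 1 ≤ K) (hK₁ : 2 * δ ≤ K * (ε / (2 * (1 + ε))) ^ 2) (hK₂ : 2 * (d + δ) ≤ K)
    {p : Fin n → EuclideanSpace ℝ (Fin d)} {q : EuclideanSpace ℝ (Fin d)} (hp : Injective p)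
    (H₁ : ∀ t : Fin (d + 1) → Fin n, Injective t → rowDet ((homog ∘ p) ∘ t) ≠ 0)
    (H₂ : (∀ i, p i ≠ q) → ∀ t : Fin (d + 1) → Fin n, Injective t → ∀ k,
      rowDet (update ((homog ∘ p) ∘ t) k (homog q)) ≠ 0)
    {σ : ℕ} (hσ : feasibleCard p q = (d + 1).factorial * σ) :
    ∃ T : ℕ, (T : ℝ) ≤ timeConst d K * 4 ^ (d + 2) * (n : ℝ) ^ ((d : ℝ) / 2 + 1) *
        (1 + Real.log n) ^ (d + 2) ∧
      (depthP d K).StopsWithin (inputState p q) T ∧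
      (depthP d K).errorProb (inputState p q) T (IsRelApprox ε σ) ≤
        ENNReal.ofReal ((3 + (((d + 8) ^ 2 : ℕ) : ℝ) ^ δ) * (n : ℝ) ^ (-δ)) := by
  have hn : 1 ≤ n := NeZero.pos n
  have hn0 : (0 : ℝ) < n := by exact_mod_cast hn
  obtain ⟨hB, hrB⟩ := bounds_cellBound (n := n) (d := d) hK
  have hKl : 1 ≤ K * logScale n := Nat.mul_pos hK (Nat.succ_pos _)
  obtain ⟨g, hg, hgood⟩ := exec_depthP (r := scale n) (lg := logScale n) rfl rfl hB hrB hKl p q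
  refine ⟨_, timeBound_le_real hK hn, stopsWithin_of_exec_eq hg fun ρ => (hgood ρ).1, ?_⟩
  rcases Nat.lt_or_ge n ((d + 8) ^ 2) with hsmall | hlarge
  · -- The constant is so large that nothing is claimed about small `n`.
    refine (errorProb_le_of_exec_eq hg (fun ρ => (hgood ρ).1) Finset.univ
      fun ρ _ => Finset.mem_univ ρ).trans (ENNReal.ofReal_le_ofReal ?_)
    rw [Finset.card_univ]
    refine (div_self_le_one _).trans ?_
    have h1 : (n : ℝ) ^ δ ≤ (((d + 8) ^ 2 : ℕ) : ℝ) ^ δ :=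
      Real.rpow_le_rpow hn0.le (by exact_mod_cast hsmall.le) hδ.le
    rw [Real.rpow_neg hn0.le, ← div_eq_mul_inv, one_le_div (Real.rpow_pos_of_pos hn0 _)]
    linarith
  · obtain ⟨hdr, hdn, hrn⟩ := scale_bounds hlarge
    obtain ⟨S, hS, hSgood⟩ := exists_badSet hp H₁ H₂ (le_scale_mul_self n) hdr hdn hrn hKl hσ hε
    refine (errorProb_le_of_exec_eq hg (fun ρ => (hgood ρ).1) S fun ρ hρ => ?_).trans
      (ENNReal.ofReal_le_ofReal ?_)
    · by_contra hρS
      obtain ⟨-, a, ha, hout⟩ := hgood ρ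
      exact hρ (hSgood ρ hρS a _ ha hout)
    · have hpos : (0 : ℝ) < Fintype.card (Fin (K * logScale n * scale n ^ (d + 2)) →
          Fin (n ^ (d + 1) - 1 + 1)) := Nat.cast_pos.2 Fintype.card_pos
      rw [div_le_iff₀' hpos]
      refine hS.trans (mul_le_mul_of_nonneg_left ?_ hpos.le)
      refine (error_terms_le hδ hn hK₁ hK₂).trans ?_
      have h1 : 0 ≤ (((d + 8) ^ 2 : ℕ) : ℝ) ^ δ := Real.rpow_nonneg (Nat.cast_nonneg _) _
      have h2 : 0 ≤ (n : ℝ) ^ (-δ) := Real.rpow_nonneg hn0.le _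
      exact mul_le_mul_of_nonneg_right (by linarith) h2

end RealRAM

theorem mainTheorem3 (d : ℕ) (ε δ : ℝ) (hε : 0 < ε) (hδ : 0 < δ) :
    ∃ (A : RealRAM.Program) (C : ℝ) (c : ℕ),
      ∀ (P : Finset (EuclideanSpace ℝ (Fin d))) (q : EuclideanSpace ℝ (Fin d)),
        P.Nonempty →
        InGeneralPosition (insert q (P : Set (EuclideanSpace ℝ (Fin d)))) →
        ∀ p : Fin P.card ≃ P,
          ∃ T : ℕ,
            (T : ℝ) ≤ C * (P.card : ℝ) ^ ((d : ℝ) / 2 + 1) * (1 + Real.log (P.card : ℝ)) ^ c ∧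
            A.StopsWithin (RealRAM.inputState (fun i => (p i : EuclideanSpace ℝ (Fin d))) q) T ∧
            A.errorProb (RealRAM.inputState (fun i => (p i : EuclideanSpace ℝ (Fin d))) q) T
                (IsRelApprox ε (simplicialDepth P q : ℝ)) ≤
              ENNReal.ofReal (C * (P.card : ℝ) ^ (-δ)) := by
  have hpos : 0 < ε / (2 * (1 + ε)) := by positivity
  obtain ⟨K, hK⟩ := exists_nat_ge (2 * δ / (ε / (2 * (1 + ε))) ^ 2 + 2 * (d + δ) + 1)
  have h1 : 0 ≤ 2 * ((d : ℝ) + δ) := by positivity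
  have h2 : 0 ≤ 2 * δ / (ε / (2 * (1 + ε))) ^ 2 := by positivity
  have hK₀ : 1 ≤ K := by
    have : (1 : ℝ) ≤ K := by linarith
    exact_mod_cast this
  have hK₁ : 2 * δ ≤ K * (ε / (2 * (1 + ε))) ^ 2 := by
    rw [← div_le_iff₀ (by positivity)]
    linarith
  have hK₂ : 2 * (d + δ) ≤ K := by linarith
  set C₁ : ℝ := RealRAM.timeConst d K * 4 ^ (d + 2) with hC₁
  set C₂ : ℝ := 3 + (((d + 8) ^ 2 : ℕ) : ℝ) ^ δ with hC₂
  have hC₁0 : 0 ≤ C₁ := by positivity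
  have hC₂0 : 0 ≤ C₂ := by positivity
  refine ⟨RealRAM.depthP d K, C₁ + C₂, d + 2, fun P q hP hgen p => ?_⟩
  have : NeZero P.card := ⟨hP.card_ne_zero⟩
  have hinj : Function.Injective fun i => (p i : EuclideanSpace ℝ (Fin d)) :=
    Subtype.val_injective.comp p.injective
  have hmem : ∀ i, (p i : EuclideanSpace ℝ (Fin d)) ∈
      insert q (P : Set (EuclideanSpace ℝ (Fin d))) := fun i => by simp
  obtain ⟨T, hT, hT₁, herr⟩ := RealRAM.depthP_correct hε hδ hK₀ hK₁ hK₂ hinj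
    (FeasibleBasis.rowDet_ne_zero_of_inGeneralPosition hgen hinj hmem)
    (FeasibleBasis.rowDet_update_ne_zero_of_inGeneralPosition hgen hinj hmem (Set.mem_insert _ _))
    (FeasibleBasis.card_feasible P q hgen p)
  have hlog : 0 ≤ Real.log P.card := Real.log_natCast_nonneg _
  have h3 : (0 : ℝ) ≤ (P.card : ℝ) ^ ((d : ℝ) / 2 + 1) := by positivity
  have h4 : (0 : ℝ) ≤ (P.card : ℝ) ^ (-δ) := by positivity
  refine ⟨T, hT.trans ?_, hT₁, herr.trans (ENNReal.ofReal_le_ofReal ?_)⟩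
  · gcongr
    exact le_add_of_nonneg_right hC₂0
  · exact mul_le_mul_of_nonneg_right (le_add_of_nonneg_left hC₁0) h4
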